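/- Let $n\ge 0$ be an integer and $\mathbb K=\mathbb Q(t_1,t_2)$. **Heisenberg algebra and Fock space.** Let $\mathcal A_n\to\mathbb C^2/\mathbb Z_{n+1}$ be the minimal resolution (for $n=0$, $\mathcal A_0=\mathbb C^2$), with the action of $T=(\mathbb C^*)^2$, fixed points $p_1,\dots,p_{n+1}$ with tangent weights $w_i^L=(n+2-i)t_1+(1-i)t_2$ and $w_i^R=(-n+i-1)t_1+it_2$, and exceptional curves $E_1,\dots,E_n$, where $E_i$ joins $p_i$ to $p_{i+1}$. The equivariant cohomology $H_T^*(\mathcal A_n,\mathbb Q)$ is described by restriction to the fixed points, as the ring of tuples $(f_1,\dots,f_{n+1})\in\mathbb Q[t_1,t_2]^{n+1}$ with $f_i\equiv f_{i+1}$ mod $w_i^R$ for $1\le i\le n$; the class $E_i$ restricts to $w_i^L$ at $p_i$, to $w_{i+1}^R$ at $p_{i+1}$ and to $0$ at the other points. The Poincaré pairing is defined by residue, $\langle\gamma,\gamma'\rangle=\sum_i \gamma|_{p_i}\gamma'|_{p_i}/(w_i^Lw_i^R)\in\mathbb K$. Let $\mathcal H$ be the Heisenberg Lie algebra over $\mathbb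 K$ with central element $c$ and elements $\mathfrak p_k(\gamma)$ ($k\in\mathbb Z\setminus\{0\}$, $\mathbb K$-linear in $\gamma\in H_T^*(\mathcal A_n,\mathbb Q)\otimes\mathbb K$), with $$[\mathfrak p_k(\gamma_1),\mathfrak p_l(\gamma_2)]=-k\,\delta_{k+l,0}\langle\gamma_1,\gamma_2\rangle\,c .$$ The Fock space $\mathcal F_{\mathcal A_n}$ is freely generated over $\mathbb Q[t_1,t_2]$ by the commuting creation operators $\mathfrak p_{-k}(\gamma)$, $k>0$, $\gamma\in H^*_T(\mathcal A_n,\mathbb Q)$, acting on the vacuum $v_\emptyset$. The algebra $\mathcal H$ acts on $\mathcal F_{\mathcal A_n}\otimes\mathbb K$: the annihilation operators $\mathfrak p_k(\gamma)$, $k>0$, kill $v_\emptyset$, and $c$ acts as the identity. **Basic representation.** Let $\widehat{\mathfrak g}=\widehat{\mathfrak{gl}}(n+1)=\mathfrak{gl}(n+1)\otimes\mathbb Q[t,t^{-1}]\oplus\mathbb Qc\oplus\mathbb Qd$ over $\mathbb Q$, with $c$ central, $[x(k),y(l)]=[x,y](k+l)+k\,\delta_{k+l,0}\operatorname{tr}(xy)\,c$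 and $[d,x(k)]=k\,x(k)$, where $x(k)=x\,t^k$, and let $\hat{\mathfrak h}=\mathfrak h\oplus\mathbb Qc\oplus\mathbb Qd$ with $\mathfrak h$ the diagonal matrices. Let $\Lambda,\delta\in\hat{\mathfrak h}^*$ vanish on $\mathfrak h$, with $\Lambda(c)=1$, $\Lambda(d)=0$, $\delta(c)=0$, $\delta(d)=1$. Let $V_\Lambda$ be the basic representation, that is, the irreducible highest weight representation of $\widehat{\mathfrak g}$ generated by a vector $v$ of weight $\Lambda$ with $(\mathfrak{gl}(n+1)\otimes\mathbb Q[t])v=0$ and $cv=v$, and let $$W=\bigoplus_{m\ge0}V_\Lambda[\Lambda-m\delta]\subset V_\Lambda .$$ **Proposition.** There is a unique homomorphism of Lie algebras $\mathcal H\to\widehat{\mathfrak g}\otimes\mathbb K$ over $\mathbb K$ with $$\mathfrak p_{-k}(1)\mapsto \mathrm{Id}(-k),\qquad \mathfrak p_k(1)\mapsto-\frac{\mathrm{Id}(k)}{(n+1)^2t_1t_2}\quad(k>0),$$ $$\mathfrak p_k(E_i)\mapsto e_{i,i}(k)-e_{i+1,i+1}(k)\quad(k\ne0,\ 1\le i\le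 n),\qquad c\mapsto c,$$ and it is injective. Through this embedding $\mathcal H$ acts on $V_\Lambda\otimes\mathbb K$, this action preserves $W\otimes\mathbb K$, the vector $v$ lies in $W\otimes\mathbb K$, and there is exactly one isomorphism of $\mathcal H$-modules $$W\otimes\mathbb Q(t_1,t_2)\;\longrightarrow\;\mathcal F_{\mathcal A_n}\otimes\mathbb Q(t_1,t_2)$$ that maps $v$ to $v_\emptyset$. -/

import Mathlib

open scoped TensorProduct

namespace AnHilb

noncomputable section

/-- The matrices of `gl(n+1)` over `ℚ`. -/
abbrev Gl (n : ℕ) := Matrix (Fin (n + 1)) (Fin (n + 1)) ℚ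

/-- The loop space `gl(n+1) ⊗ ℚ[t, t⁻¹]`: the element `Finsupp.single k x` is `x t^k`. -/
abbrev LoopGl (n : ℕ) := ℤ →₀ Gl n

/-- The bracket of the loop algebra, `[x t^k, y t^l] = [x, y] t^(k+l)`. -/
def loopBracket (n : ℕ) : LoopGl n →ₗ[ℚ] LoopGl n →ₗ[ℚ] LoopGl n :=
  LinearMap.mk₂ ℚ
    (fun f g => f.sum fun k x => g.sum fun l y => Finsupp.single (k + l) (x * y - y * x))
    (fun f f' g => by
      apply Finsupp.sum_add_index'
      · simp
      · intro k x x'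
        simp only [← Finsupp.sum_add, ← Finsupp.single_add]
        congr! 3
        noncomm_ring)
    (fun r f g => by
      rw [Finsupp.sum_smul_index' (by simp), Finsupp.smul_sum]
      simp only [Finsupp.smul_sum, Finsupp.smul_single, smul_sub, Matrix.smul_mul, Matrix.mul_smul])
    (fun f g g' => by
      rw [← Finsupp.sum_add]
      refine Finsupp.sum_congr fun k _ => Finsupp.sum_add_index' (by simp) ?_
      · intro l y y'
        rw [← Finsupp.single_add]
        congr 1
        noncomm_ring)
    (fun r f g => by
      rw [Finsupp.smul_sum]
      refine Finsupp.sum_congr fun k _ => ?_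
      rw [Finsupp.sum_smul_index' (by simp)]
      simp only [Finsupp.smul_sum, Finsupp.smul_single, smul_sub, Matrix.smul_mul, Matrix.mul_smul])

/-- The two-cocycle `(x t^k, y t^l) ↦ k δ_{k+l,0} tr(xy)`. -/
def loopCocycle (n : ℕ) : LoopGl n →ₗ[ℚ] LoopGl n →ₗ[ℚ] ℚ :=
  LinearMap.mk₂ ℚ
    (fun f g => f.sum fun k x => (k : ℚ) * (x * g (-k)).trace)
    (fun f f' g => by
      apply Finsupp.sum_add_index'
      · simp
      · intro k x x'
        simp [add_mul, mul_add])
    (fun r f g => by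
      rw [Finsupp.sum_smul_index' (by simp), Finsupp.smul_sum]
      congr! 2 with k x
      simp [mul_left_comm])
    (fun f g g' => by
      rw [← Finsupp.sum_add]
      simp [mul_add])
    (fun r f g => by
      rw [Finsupp.smul_sum]
      congr! 2 with k x
      simp [mul_left_comm])

/-- The derivation `t d/dt`, that is `x t^k ↦ k x t^k`. -/
def loopEuler (n : ℕ) : LoopGl n →ₗ[ℚ] LoopGl n :=
  Finsupp.lsum ℚ fun k : ℤ => (k : ℚ) • Finsupp.lsingle k

@[simp] lemma loopBracket_single {n : ℕ} (x y : Gl n) (k l : ℤ) :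
    loopBracket n (.single k x) (.single l y) = .single (k + l) (x * y - y * x) := by
  simp [loopBracket]

lemma loopCocycle_single {n : ℕ} (x y : Gl n) (k l : ℤ) :
    loopCocycle n (.single k x) (.single l y) = if k + l = 0 then (k : ℚ) * (x * y).trace else 0 := by
  simp only [loopCocycle, LinearMap.mk₂_apply]
  rw [Finsupp.sum_single_index (by simp)]
  split_ifs with h
  · obtain rfl : l = -k := by omega
    simp
  · rw [Finsupp.single_eq_of_ne (by omega)]
    simp

@[simp] lemma loopEuler_single {n : ℕ} (x : Gl n) (k : ℤ) :
    loopEuler n (.single k x) = (k : ℚ) • .single k x := by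
  simp [loopEuler]

lemma loopBracket_skew {n : ℕ} (u v : LoopGl n) : loopBracket n u v = -loopBracket n v u := by
  induction u using Finsupp.induction_linear with
  | zero => simp
  | add u u' hu hu' => rw [map_add, map_add, LinearMap.add_apply, hu, hu', neg_add]
  | single k x =>
    induction v using Finsupp.induction_linear with
    | zero => simp
    | add v v' hv hv' => rw [map_add, map_add, LinearMap.add_apply, hv, hv', neg_add]
    | single l y => simp [add_comm k l]

lemma loopBracket_self {n : ℕ} (u : LoopGl n) : loopBracket n u u = 0 := by
  have h := loopBracket_skew u u
  have h2 : (2 : ℚ) • loopBracket n u u = 0 := by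
    rw [two_smul]; exact add_eq_zero_iff_eq_neg.mpr h
  simpa using h2

lemma loopBracket_leibniz {n : ℕ} (u v w : LoopGl n) :
    loopBracket n u (loopBracket n v w) =
      loopBracket n (loopBracket n u v) w + loopBracket n v (loopBracket n u w) := by
  induction u using Finsupp.induction_linear with
  | zero => simp
  | add u u' hu hu' => simp only [map_add, LinearMap.add_apply, hu, hu']; abel
  | single k x =>
    induction v using Finsupp.induction_linear with
    | zero => simp
    | add v v' hv hv' => simp only [map_add, LinearMap.add_apply, hv, hv']; abel
    | single l y =>
      induction w using Finsupp.induction_linear with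
      | zero => simp
      | add w w' hw hw' => simp only [map_add, hw, hw']; abel
      | single m z =>
        simp only [loopBracket_single]
        rw [show l + (k + m) = k + (l + m) by ring, show k + l + m = k + (l + m) by ring,
          ← Finsupp.single_add]
        congr 1
        noncomm_ring

lemma loopCocycle_skew {n : ℕ} (u v : LoopGl n) : loopCocycle n u v = -loopCocycle n v u := by
  induction u using Finsupp.induction_linear with
  | zero => simp
  | add u u' hu hu' => rw [map_add, map_add, LinearMap.add_apply, hu, hu', neg_add]
  | single k x =>
    induction v using Finsupp.induction_linear with
    | zero => simp
    | add v v' hv hv' => rw [map_add, map_add, LinearMap.add_apply, hv, hv', neg_add]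
    | single l y =>
      rw [loopCocycle_single, loopCocycle_single, add_comm l k, Matrix.trace_mul_comm y x]
      split_ifs with h
      · obtain rfl : l = -k := by omega
        push_cast; ring
      · simp

lemma loopCocycle_self {n : ℕ} (u : LoopGl n) : loopCocycle n u u = 0 := by
  have := loopCocycle_skew u u
  linarith

lemma loopCocycle_leibniz {n : ℕ} (u v w : LoopGl n) :
    loopCocycle n u (loopBracket n v w) =
      loopCocycle n (loopBracket n u v) w + loopCocycle n v (loopBracket n u w) := by
  induction u using Finsupp.induction_linear with
  | zero => simp
  | add u u' hu hu' => simp only [map_add, LinearMap.add_apply, hu, hu']; ring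
  | single k x =>
    induction v using Finsupp.induction_linear with
    | zero => simp
    | add v v' hv hv' => simp only [map_add, LinearMap.add_apply, hv, hv']; ring
    | single l y =>
      induction w using Finsupp.induction_linear with
      | zero => simp
      | add w w' hw hw' => simp only [map_add, hw, hw']; ring
      | single m z =>
        simp only [loopBracket_single, loopCocycle_single]
        rw [show l + (k + m) = k + (l + m) by ring, show k + l + m = k + (l + m) by ring]
        split_ifs with h
        · obtain rfl : k = -l - m := by omega
          have h1 : (y * (x * z)).trace = (x * z * y).trace := Matrix.trace_mul_comm _ _
          have h2 : (y * (z * x)).trace = (x * y * z).trace := by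
            rw [← mul_assoc, Matrix.trace_mul_comm, mul_assoc]
          have h3 : (y * x * z).trace = (x * z * y).trace := by
            rw [mul_assoc, Matrix.trace_mul_comm]
          simp only [mul_sub, sub_mul, Matrix.trace_sub, h1, h2, h3]
          rw [← mul_assoc x y z, ← mul_assoc x z y]
          push_cast; ring
        · simp

lemma loopEuler_leibniz {n : ℕ} (u v : LoopGl n) :
    loopEuler n (loopBracket n u v) =
      loopBracket n (loopEuler n u) v + loopBracket n u (loopEuler n v) := by
  induction u using Finsupp.induction_linear with
  | zero => simp
  | add u u' hu hu' => simp only [map_add, LinearMap.add_apply, hu, hu']; abel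
  | single k x =>
    induction v using Finsupp.induction_linear with
    | zero => simp
    | add v v' hv hv' => simp only [map_add, hv, hv']; abel
    | single l y =>
      simp only [loopBracket_single, loopEuler_single, map_smul, LinearMap.smul_apply, ← add_smul]
      push_cast; rfl

lemma loopCocycle_euler {n : ℕ} (u v : LoopGl n) :
    loopCocycle n (loopEuler n u) v + loopCocycle n u (loopEuler n v) = 0 := by
  induction u using Finsupp.induction_linear with
  | zero => simp
  | add u u' hu hu' =>
    simp only [map_add, LinearMap.add_apply]
    linear_combination hu + hu'
  | single k x =>
    induction v using Finsupp.induction_linear with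
    | zero => simp
    | add v v' hv hv' =>
      simp only [map_add]
      linear_combination hv + hv'
    | single l y =>
      simp only [loopEuler_single, map_smul, LinearMap.smul_apply, loopCocycle_single, smul_eq_mul]
      split_ifs with h
      · obtain rfl : l = -k := by omega
        push_cast; ring
      · simp

/-- The affine Lie algebra `gl^(n+1) = gl(n+1) ⊗ ℚ[t, t⁻¹] ⊕ ℚ c ⊕ ℚ d` (underlying space). -/
@[ext]
structure AffineGl (n : ℕ) where
  loop : LoopGl n
  c : ℚ
  d : ℚ

namespace AffineGl
variable {n : ℕ}

/-- The underlying space as a product, used to transport the linear structure. -/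
def toProd : AffineGl n ≃ LoopGl n × ℚ × ℚ where
  toFun x := (x.loop, x.c, x.d)
  invFun p := ⟨p.1, p.2.1, p.2.2⟩
  left_inv _ := rfl
  right_inv _ := rfl

instance : AddCommGroup (AffineGl n) := toProd.addCommGroup
instance : Module ℚ (AffineGl n) := toProd.module ℚ

@[simp] lemma add_loop (x y : AffineGl n) : (x + y).loop = x.loop + y.loop := rfl
@[simp] lemma add_c (x y : AffineGl n) : (x + y).c = x.c + y.c := rfl
@[simp] lemma add_d (x y : AffineGl n) : (x + y).d = x.d + y.d := rfl
@[simp] lemma zero_loop : (0 : AffineGl n).loop = 0 := rfl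
@[simp] lemma zero_c : (0 : AffineGl n).c = 0 := rfl
@[simp] lemma zero_d : (0 : AffineGl n).d = 0 := rfl
@[simp] lemma smul_loop (r : ℚ) (x : AffineGl n) : (r • x).loop = r • x.loop := rfl
@[simp] lemma smul_c (r : ℚ) (x : AffineGl n) : (r • x).c = r * x.c := rfl
@[simp] lemma smul_d (r : ℚ) (x : AffineGl n) : (r • x).d = r * x.d := rfl

instance : Bracket (AffineGl n) (AffineGl n) where
  bracket x y :=
    { loop := loopBracket n x.loop y.loop + x.d • loopEuler n y.loop - y.d • loopEuler n x.loop
      c := loopCocycle n x.loop y.loop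
      d := 0 }

@[simp] lemma lie_loop (x y : AffineGl n) :
    ⁅x, y⁆.loop =
      loopBracket n x.loop y.loop + x.d • loopEuler n y.loop - y.d • loopEuler n x.loop := rfl
@[simp] lemma lie_c (x y : AffineGl n) : ⁅x, y⁆.c = loopCocycle n x.loop y.loop := rfl
@[simp] lemma lie_d (x y : AffineGl n) : ⁅x, y⁆.d = 0 := rfl

instance : LieRing (AffineGl n) where
  add_lie x y z := by
    ext1
    · simp only [lie_loop, add_loop, add_d, LinearMap.add_apply, map_add]; module
    · simp
    · simp
  lie_add x y z := by
    ext1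
    · simp only [lie_loop, add_loop, add_d, map_add]; module
    · simp
    · simp
  lie_self x := by
    ext1
    · simp [loopBracket_self]
    · simp [loopCocycle_self]
    · simp
  leibniz_lie x y z := by
    ext1
    · simp only [lie_loop, lie_d, add_loop, loopEuler_leibniz, map_add, map_sub, map_smul,
        LinearMap.add_apply, LinearMap.sub_apply, LinearMap.smul_apply, zero_smul,
        loopBracket_leibniz x.loop y.loop z.loop, loopBracket_skew y.loop (loopEuler n x.loop)]
      module
    · simp only [lie_c, lie_loop, add_c, map_add, map_sub, map_smul, LinearMap.add_apply,
        LinearMap.sub_apply, LinearMap.smul_apply, loopCocycle_leibniz x.loop y.loop z.loop,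
        smul_eq_mul]
      have h1 := loopCocycle_euler x.loop y.loop
      have h2 := loopCocycle_euler x.loop z.loop
      have h3 := loopCocycle_euler y.loop z.loop
      have h4 := loopCocycle_skew y.loop (loopEuler n x.loop)
      linear_combination y.d * h2 - z.d * h1 + z.d * h4 - x.d * h3
    · simp

instance : LieAlgebra ℚ (AffineGl n) where
  lie_smul r x y := by
    ext1
    · simp only [lie_loop, smul_loop, smul_d, map_smul]; module
    · simp
    · simp

/-- The element `x(k) = x t^k`. -/
def mode (x : Gl n) (k : ℤ) : AffineGl n := ⟨.single k x, 0, 0⟩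
/-- The central element `c`. -/
def central (n : ℕ) : AffineGl n := ⟨0, 1, 0⟩
/-- The differential `d`. -/
def degree (n : ℕ) : AffineGl n := ⟨0, 0, 1⟩

lemma mode_lie_mode (x y : Gl n) (k l : ℤ) :
    ⁅mode x k, mode y l⁆ =
      mode (x * y - y * x) (k + l) + (if k + l = 0 then (k : ℚ) * (x * y).trace else 0) • central n := by
  ext1
  · simp only [lie_loop, mode, central, add_loop, smul_loop, loopBracket_single]
    simp
  · simp only [lie_c, mode, central, add_c, smul_c, loopCocycle_single]
    simp
  · simp only [lie_d, mode, central, add_d, smul_d]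
    simp

lemma degree_lie_mode (x : Gl n) (k : ℤ) : ⁅degree n, mode x k⁆ = (k : ℚ) • mode x k := by
  ext1 <;> simp [mode, degree]

lemma central_lie (x : AffineGl n) : ⁅central n, x⁆ = 0 := by
  ext1 <;> simp [central]

end AffineGl

section Basic
variable (n : ℕ)

/-- The universal enveloping algebra of `gl^(n+1)`. -/
abbrev UAff := UniversalEnvelopingAlgebra ℚ (AffineGl n)

/-- The left ideal generated by `x(k)` for `x ∈ gl(n+1)` and `k ≥ 0`, by `c - 1` and by `d`.
These are the relations `ρ(gl(n+1) ⊗ ℚ[t]) v = 0`, `ρ(c) v = v`, `ρ(d) v = 0` of a highest weight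
vector of weight `Λ`, where `Λ(𝔥) = 0`, `Λ(c) = 1`, `Λ(d) = 0`. -/
def vacuumIdeal : Submodule (UAff n) (UAff n) :=
  Submodule.span (UAff n)
    ({u | ∃ (x : Gl n) (k : ℤ), 0 ≤ k ∧ u = UniversalEnvelopingAlgebra.ι ℚ (AffineGl.mode x k)} ∪
      {UniversalEnvelopingAlgebra.ι ℚ (AffineGl.central n) - 1,
        UniversalEnvelopingAlgebra.ι ℚ (AffineGl.degree n)})

/-- The universal module generated by a vector with these relations. -/
abbrev VacuumModule := UAff n ⧸ vacuumIdeal n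

/-- The sum of all proper submodules of the universal module. -/
def maxProper : Submodule (UAff n) (VacuumModule n) := sSup {N | N ≠ ⊤}

/-- The basic representation `V_Λ`: the irreducible quotient of the universal highest weight module
of weight `Λ`, by the sum of all its proper submodules. -/
abbrev BasicRep := VacuumModule n ⧸ maxProper n

instance : LieRingModule (AffineGl n) (BasicRep n) where
  bracket x w := UniversalEnvelopingAlgebra.ι ℚ x • w
  add_lie x y w := by
    change UniversalEnvelopingAlgebra.ι ℚ (x + y) • w = _
    rw [map_add, add_smul]
  lie_add x w w' := smul_add _ _ _
  leibniz_lie x y w := by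
    change UniversalEnvelopingAlgebra.ι ℚ x • UniversalEnvelopingAlgebra.ι ℚ y • w =
      UniversalEnvelopingAlgebra.ι ℚ ⁅x, y⁆ • w +
        UniversalEnvelopingAlgebra.ι ℚ y • UniversalEnvelopingAlgebra.ι ℚ x • w
    let : LieRing (UAff n) := LieRing.ofAssociativeRing
    let : LieAlgebra ℚ (UAff n) := LieAlgebra.ofAssociativeAlgebra
    rw [LieHom.map_lie, LieRing.of_associative_ring_bracket, sub_smul, mul_smul, mul_smul]
    abel

lemma lie_def (x : AffineGl n) (w : BasicRep n) : ⁅x, w⁆ = UniversalEnvelopingAlgebra.ι ℚ x • w := rfl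

instance : LieModule ℚ (AffineGl n) (BasicRep n) where
  smul_lie r x w := by rw [lie_def, lie_def, map_smul, smul_assoc]
  lie_smul r x w := by
    rw [lie_def, lie_def]
    exact smul_algebra_smul_comm r _ w

/-- The highest weight vector `v` of `V_Λ`. -/
def hwVector : BasicRep n := (maxProper n).mkQ ((vacuumIdeal n).mkQ 1)

/-- The Cartan subalgebra `𝔥 ⊕ ℚ c ⊕ ℚ d`; a triple `(a, r, s)` stands for
`diag(a) + r c + s d`. -/
abbrev AffCartan := (Fin (n + 1) → ℚ) × ℚ × ℚ

/-- The inclusion of the Cartan subalgebra. -/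
def cartanIncl (h : AffCartan n) : AffineGl n :=
  ⟨.single 0 (Matrix.diagonal h.1), h.2.1, h.2.2⟩

/-- The weight `Λ`, the coordinate dual to `c`. -/
def fundWeight : Module.Dual ℚ (AffCartan n) := LinearMap.fst ℚ ℚ ℚ ∘ₗ LinearMap.snd ℚ _ _
/-- The weight `δ`, the coordinate dual to `d`. -/
def delta : Module.Dual ℚ (AffCartan n) := LinearMap.snd ℚ ℚ ℚ ∘ₗ LinearMap.snd ℚ _ _

/-- The weight space `V_Λ[α]`. -/
def weightSpace (α : Module.Dual ℚ (AffCartan n)) : Submodule ℚ (BasicRep n) where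
  carrier := {w | ∀ h, ⁅cartanIncl n h, w⁆ = α h • w}
  add_mem' := by
    intro a b ha hb h
    rw [lie_add, ha h, hb h, smul_add]
  zero_mem' := by intro h; simp
  smul_mem' := by
    intro r a ha h
    rw [lie_smul, ha h, smul_comm]

/-- `W = ⨁_{m ≥ 0} V_Λ[Λ - m δ]`, as the (automatically direct) sum inside `V_Λ`. -/
def zeroWeightSum : Submodule ℚ (BasicRep n) := ⨆ m : ℕ, weightSpace n (fundWeight n - (m : ℚ) • delta n)

end Basic

/-- The equivariant coefficient ring `ℚ[t₁, t₂]`. -/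
def EqRing : Type := MvPolynomial (Fin 2) ℚ

instance : CommRing EqRing := inferInstanceAs (CommRing (MvPolynomial (Fin 2) ℚ))
instance : IsDomain EqRing := inferInstanceAs (IsDomain (MvPolynomial (Fin 2) ℚ))
instance : Algebra ℚ EqRing := inferInstanceAs (Algebra ℚ (MvPolynomial (Fin 2) ℚ))
instance : CharZero EqRing := inferInstanceAs (CharZero (MvPolynomial (Fin 2) ℚ))

/-- The field `ℚ(t₁, t₂)`. -/
def EqField : Type := FractionRing EqRing

instance : Field EqField := inferInstanceAs (Field (FractionRing EqRing))
instance : Algebra EqRing EqField := inferInstanceAs (Algebra EqRing (FractionRing EqRing))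
instance : IsFractionRing EqRing EqField := inferInstanceAs (IsFractionRing EqRing (FractionRing EqRing))
instance : CharZero EqField := inferInstanceAs (CharZero (FractionRing EqRing))

/-- The weight `t₁`. -/
def t₁ : EqRing := (MvPolynomial.X 0 : MvPolynomial (Fin 2) ℚ)
/-- The weight `t₂`. -/
def t₂ : EqRing := (MvPolynomial.X 1 : MvPolynomial (Fin 2) ℚ)

/-- The tangent weight `w^L_i = (n+2-i) t₁ + (1-i) t₂` at the fixed point `p_i`, with `i = j + 1`. -/
def wL (n : ℕ) (j : Fin (n + 1)) : EqRing := ((n : EqRing) + 1 - (j : ℕ)) * t₁ - ((j : ℕ) : EqRing) * t₂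
/-- The tangent weight `w^R_i = (-n+i-1) t₁ + i t₂` at the fixed point `p_i`, with `i = j + 1`. -/
def wR (n : ℕ) (j : Fin (n + 1)) : EqRing := (((j : ℕ) : EqRing) - n) * t₁ + (((j : ℕ) : EqRing) + 1) * t₂

/-- The equivariant cohomology ring `H_T^*(𝒜_n, ℚ)`, in its standard description by restriction to the
fixed points `p_1, …, p_{n+1}`: tuples of polynomials whose components at the two ends `p_i`, `p_{i+1}`
of each compact `T`-invariant curve `E_i` agree modulo the tangent weight `w^R_i` of `E_i` at `p_i`. -/
def HT (n : ℕ) : Subalgebra EqRing (Fin (n + 1) → EqRing) where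
  carrier := {f | ∀ i : Fin n, wR n i.castSucc ∣ f i.castSucc - f i.succ}
  mul_mem' := by
    intro f g hf hg i
    have : (f * g) i.castSucc - (f * g) i.succ =
        (f i.castSucc - f i.succ) * g i.castSucc + f i.succ * (g i.castSucc - g i.succ) := by
      simp only [Pi.mul_apply]; ring
    rw [this]
    exact dvd_add ((hf i).mul_right _) ((hg i).mul_left _)
  add_mem' := by
    intro f g hf hg i
    have : (f + g) i.castSucc - (f + g) i.succ =
        (f i.castSucc - f i.succ) + (g i.castSucc - g i.succ) := by
      simp only [Pi.add_apply]; ring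
    rw [this]
    exact dvd_add (hf i) (hg i)
  algebraMap_mem' := by intro r i; simp

/-- The restrictions of the class `[E_i]` to the fixed points: the weight of the normal bundle of `E_i`
at `p_i` and at `p_{i+1}`, and zero at all other points. -/
def curveFun (n : ℕ) (i : Fin n) : Fin (n + 1) → EqRing :=
  Pi.single i.castSucc (wL n i.castSucc) + Pi.single i.succ (wR n i.succ)

lemma curveFun_mem (n : ℕ) (i : Fin n) : curveFun n i ∈ HT n := by
  intro j
  simp only [curveFun, Pi.add_apply]
  rcases lt_trichotomy i j with h | rfl | h
  · have h0 : (i : ℕ) < j := h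
    rw [Pi.single_eq_of_ne (i := i.castSucc) (i' := j.castSucc) (by simp [Fin.ext_iff]; omega),
      Pi.single_eq_of_ne (i := i.castSucc) (i' := j.succ) (by simp [Fin.ext_iff]; omega),
      Pi.single_eq_of_ne (i := i.succ) (i' := j.succ) (by simp [Fin.ext_iff]; omega)]
    by_cases h' : i.succ = j.castSucc
    · rw [← h', Pi.single_eq_same]
      simp
    · rw [Pi.single_eq_of_ne (Ne.symm h')]
      simp
  · rw [Pi.single_eq_same, Pi.single_eq_of_ne (by simp [Fin.ext_iff]),
      Pi.single_eq_of_ne (by simp [Fin.ext_iff]), Pi.single_eq_same]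
    refine ⟨-2, ?_⟩
    simp only [wL, wR, Fin.val_castSucc, Fin.val_succ]
    push_cast
    ring
  · have h0 : (j : ℕ) < i := h
    rw [Pi.single_eq_of_ne (i := i.castSucc) (i' := j.castSucc) (by simp [Fin.ext_iff]; omega),
      Pi.single_eq_of_ne (i := i.succ) (i' := j.castSucc) (by simp [Fin.ext_iff]; omega),
      Pi.single_eq_of_ne (i := i.succ) (i' := j.succ) (by simp [Fin.ext_iff]; omega)]
    by_cases h' : i.castSucc = j.succ
    · rw [← h', Pi.single_eq_same]
      refine ⟨1, ?_⟩
      have h2 : (i : ℕ) = j + 1 := by simpa [Fin.ext_iff] using h'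
      simp only [wL, wR, Fin.val_castSucc, h2]
      push_cast
      ring
    · rw [Pi.single_eq_of_ne (Ne.symm h')]
      simp

/-- The class `E_i` in equivariant cohomology. -/
def curveClass (n : ℕ) (i : Fin n) : HT n := ⟨curveFun n i, curveFun_mem n i⟩

/-- The labels of the Heisenberg operators, `H_T^*(𝒜_n, ℚ) ⊗ ℚ(t₁, t₂)`. -/
abbrev HTK (n : ℕ) := EqField ⊗[EqRing] HT n

/-- Restriction of a class to a fixed point. -/
def restrictTo (n : ℕ) (j : Fin (n + 1)) : HTK n →ₗ[EqField] EqField :=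
  LinearMap.liftBaseChange EqField
    (Algebra.linearMap EqRing EqField ∘ₗ LinearMap.proj j ∘ₗ (HT n).val.toLinearMap)

/-- The equivariant Poincaré pairing, `⟨γ, γ'⟩ = ∑_i γ|_{p_i} γ'|_{p_i} / (w^L_i w^R_i)`, defined by residue. -/
def pairing (n : ℕ) : HTK n →ₗ[EqField] HTK n →ₗ[EqField] EqField :=
  ∑ j, (algebraMap EqRing EqField (wL n j * wR n j))⁻¹ •
    (LinearMap.mul EqField EqField).compl₁₂ (restrictTo n j) (restrictTo n j)

lemma pairing_comm {n : ℕ} (x y : HTK n) : pairing n x y = pairing n y x := by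
  simp only [pairing, LinearMap.sum_apply, LinearMap.smul_apply, LinearMap.compl₁₂_apply,
    LinearMap.mul_apply', mul_comm]

/-- The nonzero integers, the indices of the Heisenberg operators. -/
abbrev NZ := {k : ℤ // k ≠ 0}
instance : Neg NZ := ⟨fun k => ⟨-k.1, neg_ne_zero.mpr k.2⟩⟩

/-- A positive integer as a nonzero integer. -/
def NZ.ofPos (k : ℕ+) : NZ := ⟨(k : ℤ), by have := k.pos; omega⟩

/-- The Heisenberg algebra `ℋ` over `ℚ(t₁, t₂)` (underlying space), with one copy of the space of labels
for each `k ≠ 0` and the central line. -/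
@[ext]
structure Heis (n : ℕ) where
  modes : NZ →₀ HTK n
  c : EqField

/-- The form `(𝔭_k(γ₁), 𝔭_l(γ₂)) ↦ -k δ_{k+l} ⟨γ₁, γ₂⟩`. -/
def heisCocycle (n : ℕ) : (NZ →₀ HTK n) →ₗ[EqField] (NZ →₀ HTK n) →ₗ[EqField] EqField :=
  LinearMap.mk₂ EqField
    (fun f g => f.sum fun k γ => -(k.1 : EqField) * pairing n γ (g (-k)))
    (fun f f' g => by
      apply Finsupp.sum_add_index'
      · simp
      · intro k x x'
        simp [mul_add])
    (fun r f g => by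
      rw [Finsupp.sum_smul_index' (by simp), Finsupp.smul_sum]
      refine Finsupp.sum_congr fun k _ => ?_
      simp [mul_left_comm])
    (fun f g g' => by
      rw [← Finsupp.sum_add]
      simp [mul_add])
    (fun r f g => by
      rw [Finsupp.smul_sum]
      refine Finsupp.sum_congr fun k _ => ?_
      simp [mul_left_comm])

lemma heisCocycle_single {n : ℕ} (γ γ' : HTK n) (k l : NZ) :
    heisCocycle n (.single k γ) (.single l γ') =
      if k.1 + l.1 = 0 then -(k.1 : EqField) * pairing n γ γ' else 0 := by
  simp only [heisCocycle, LinearMap.mk₂_apply]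
  rw [Finsupp.sum_single_index (by simp)]
  split_ifs with h
  · obtain rfl : l = -k := Subtype.ext (by simp only [Neg.neg]; exact eq_neg_of_add_eq_zero_right h)
    simp
  · rw [Finsupp.single_eq_of_ne (fun e => h (by rw [← e]; exact add_neg_cancel k.1))]
    simp

lemma heisCocycle_skew {n : ℕ} (u v : NZ →₀ HTK n) : heisCocycle n u v = -heisCocycle n v u := by
  induction u using Finsupp.induction_linear with
  | zero => simp
  | add u u' hu hu' => rw [map_add, map_add, LinearMap.add_apply, hu, hu', neg_add]
  | single k x =>
    induction v using Finsupp.induction_linear with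
    | zero => simp
    | add v v' hv hv' => rw [map_add, map_add, LinearMap.add_apply, hv, hv', neg_add]
    | single l y =>
      rw [heisCocycle_single, heisCocycle_single, add_comm l.1 k.1, pairing_comm y x]
      split_ifs with h
      · have : l.1 = -k.1 := by omega
        rw [this]
        push_cast; ring
      · simp

lemma heisCocycle_self {n : ℕ} (u : NZ →₀ HTK n) : heisCocycle n u u = 0 :=
  self_eq_neg.mp (heisCocycle_skew u u)

namespace Heis
variable {n : ℕ}

/-- The underlying space as a product, used to transport the linear structure. -/
def toProd : Heis n ≃ (NZ →₀ HTK n) × EqField where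
  toFun x := (x.modes, x.c)
  invFun p := ⟨p.1, p.2⟩
  left_inv _ := rfl
  right_inv _ := rfl

instance : AddCommGroup (Heis n) := toProd.addCommGroup
instance : Module EqField (Heis n) := toProd.module EqField

@[simp] lemma add_modes (x y : Heis n) : (x + y).modes = x.modes + y.modes := rfl
@[simp] lemma add_c (x y : Heis n) : (x + y).c = x.c + y.c := rfl
@[simp] lemma zero_modes : (0 : Heis n).modes = 0 := rfl
@[simp] lemma zero_c : (0 : Heis n).c = 0 := rfl
@[simp] lemma smul_modes (r : EqField) (x : Heis n) : (r • x).modes = r • x.modes := rfl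
@[simp] lemma smul_c (r : EqField) (x : Heis n) : (r • x).c = r * x.c := rfl

instance : Bracket (Heis n) (Heis n) where
  bracket x y := ⟨0, heisCocycle n x.modes y.modes⟩

@[simp] lemma lie_modes (x y : Heis n) : ⁅x, y⁆.modes = 0 := rfl
@[simp] lemma lie_c (x y : Heis n) : ⁅x, y⁆.c = heisCocycle n x.modes y.modes := rfl

instance : LieRing (Heis n) where
  add_lie x y z := by ext1 <;> simp
  lie_add x y z := by ext1 <;> simp
  lie_self x := by ext1 <;> simp [heisCocycle_self]
  leibniz_lie x y z := by ext1 <;> simp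

instance : LieAlgebra EqField (Heis n) where
  lie_smul r x y := by ext1 <;> simp

/-- The operator `𝔭_k(γ)`. -/
def p (k : NZ) (γ : HTK n) : Heis n := ⟨.single k γ, 0⟩
/-- The central element `c`. -/
def central (n : ℕ) : Heis n := ⟨0, 1⟩

lemma p_lie_p (k l : NZ) (γ γ' : HTK n) :
    ⁅p k γ, p l γ'⁆ =
      (if k.1 + l.1 = 0 then -(k.1 : EqField) * pairing n γ γ' else 0) • central n := by
  ext1
  · simp only [lie_modes, smul_modes, central, smul_zero]
  · simp only [lie_c, p, heisCocycle_single, central, smul_c, mul_one]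

end Heis

section SymDer
variable {R M S B : Type*} [CommRing R] [AddCommMonoid M] [Module R M] [CommRing S] [Algebra R S]
  [CommRing B] [Algebra R B] {i : M →ₗ[R] S}

/-- The algebra homomorphism `f ↦ j f + ε D f` that encodes the derivation `D` extending `m`. -/
def symDerHom (hi : IsSymmetricAlgebra i) (j : S →ₐ[R] B) (m : M →ₗ[R] B) :
    S →ₐ[R] TrivSqZeroExt B B :=
  hi.lift ((TrivSqZeroExt.inlAlgHom R B B).toLinearMap ∘ₗ j.toLinearMap ∘ₗ i +
    (TrivSqZeroExt.inrHom B B).restrictScalars R ∘ₗ m)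

lemma symDerHom_fst (hi : IsSymmetricAlgebra i) (j : S →ₐ[R] B) (m : M →ₗ[R] B) (f : S) :
    (symDerHom hi j m f).fst = j f := by
  have : (TrivSqZeroExt.fstHom R B B).comp (symDerHom hi j m) = j := by
    apply hi.algHom_ext
    ext x
    simp [symDerHom]
  exact congr($this f)

/-- The derivation of a symmetric algebra `S` with values in an `S`-algebra that extends a given linear
map on generators. -/
def symDer (hi : IsSymmetricAlgebra i) (j : S →ₐ[R] B) (m : M →ₗ[R] B) : S →ₗ[R] B where
  toFun f := (symDerHom hi j m f).snd
  map_add' f g := by simp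
  map_smul' r f := by simp

lemma symDer_mul (hi : IsSymmetricAlgebra i) (j : S →ₐ[R] B) (m : M →ₗ[R] B) (f g : S) :
    symDer hi j m (f * g) = j f * symDer hi j m g + j g * symDer hi j m f := by
  simp [symDer, symDerHom_fst, mul_comm]

lemma symDer_gen (hi : IsSymmetricAlgebra i) (j : S →ₐ[R] B) (m : M →ₗ[R] B) (x : M) :
    symDer hi j m (i x) = m x := by
  simp [symDer, symDerHom]

end SymDer

section Fock
variable (n : ℕ)

/-- The Fock space `ℱ_{𝒜_n}`, freely generated over `ℚ[t₁, t₂]` by the commuting creation operators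
`𝔭_{-k}(γ)`, `k > 0`, `γ ∈ H_T^*(𝒜_n, ℚ)`, on the vacuum. -/
def Fock : Type := SymmetricAlgebra EqRing (ℕ+ →₀ HT n)

instance : CommRing (Fock n) := inferInstanceAs (CommRing (SymmetricAlgebra EqRing (ℕ+ →₀ HT n)))
instance : Algebra EqRing (Fock n) := inferInstanceAs (Algebra EqRing (SymmetricAlgebra EqRing (ℕ+ →₀ HT n)))

/-- The generators: `Finsupp.single k γ` is sent to `𝔭_{-k}(γ) v_∅`. -/
def creation : (ℕ+ →₀ HT n) →ₗ[EqRing] Fock n := SymmetricAlgebra.ι EqRing (ℕ+ →₀ HT n)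

lemma creation_isSymmetricAlgebra : IsSymmetricAlgebra (creation n) :=
  SymmetricAlgebra.isSymmetricAlgebra_ι

/-- The Fock space `ℱ_{𝒜_n} ⊗ ℚ(t₁, t₂)`. -/
def FockK : Type := EqField ⊗[EqRing] Fock n

instance : CommRing (FockK n) := inferInstanceAs (CommRing (EqField ⊗[EqRing] Fock n))
instance : Algebra EqField (FockK n) := inferInstanceAs (Algebra EqField (EqField ⊗[EqRing] Fock n))
instance : Algebra EqRing (FockK n) := inferInstanceAs (Algebra EqRing (EqField ⊗[EqRing] Fock n))
instance : IsScalarTower EqRing EqField (FockK n) := inferInstanceAs (IsScalarTower EqRing EqField (EqField ⊗[EqRing] Fock n))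

/-- The canonical map from the Fock space to its extension of scalars. -/
def toFockK : Fock n →ₐ[EqRing] FockK n :=
  (Algebra.TensorProduct.includeRight : Fock n →ₐ[EqRing] EqField ⊗[EqRing] Fock n)

/-- The vacuum vector `v_∅`. -/
def vac : FockK n := 1

/-- The generator `Finsupp.single k γ` viewed as the Heisenberg element `𝔭_{-k}(γ)`. -/
def creationEmb : (ℕ+ →₀ HT n) →ₗ[EqRing] (NZ →₀ HTK n) :=
  Finsupp.lsum EqRing fun k : ℕ+ =>
    (Finsupp.lsingle (R := EqRing) (⟨-(k : ℤ), by have := k.pos; omega⟩ : NZ)) ∘ₗ TensorProduct.mk EqRing EqField (HT n) 1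

lemma creationEmb_single (k : ℕ+) (γ : HT n) : creationEmb n (.single k γ) =
    .single ⟨-(k : ℤ), by have := k.pos; omega⟩ (1 ⊗ₜ γ) := by
  simp [creationEmb]

/-- The positive integer `-k` for a negative `k`. -/
def negPNat (k : NZ) (h : k.1 < 0) : ℕ+ := ⟨(-k.1).toNat, by omega⟩

/-- The element by which the creation part of a Heisenberg element multiplies: `𝔭_k(γ) v_∅` for
`𝔭_k(γ)` with `k < 0`, and zero for `k > 0`. -/
def creator : (NZ →₀ HTK n) →ₗ[EqField] FockK n :=
  Finsupp.lsum EqField fun k =>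
    if h : k.1 < 0 then
      LinearMap.liftBaseChange EqField ((toFockK n).toLinearMap ∘ₗ creation n ∘ₗ
        Finsupp.lsingle (negPNat k h))
    else 0

/-- The derivation sending each generator `𝔭_{-l}(γ') v_∅` to the scalar of `[x, 𝔭_{-l}(γ')]`. -/
def annihDer (x : NZ →₀ HTK n) : Fock n →ₗ[EqRing] FockK n :=
  symDer (creation_isSymmetricAlgebra n) (toFockK n)
    ((IsScalarTower.toAlgHom EqRing EqField (FockK n)).toLinearMap ∘ₗ
      (heisCocycle n x).restrictScalars EqRing ∘ₗ creationEmb n)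

/-- The same derivation on the extended Fock space: the action of the annihilation part of `x`. -/
def annihilator (x : NZ →₀ HTK n) : FockK n →ₗ[EqField] FockK n :=
  (LinearMap.liftBaseChange EqField (annihDer n x) : EqField ⊗[EqRing] Fock n →ₗ[EqField] FockK n)

variable {n}

lemma annihDer_mul (x : NZ →₀ HTK n) (f g : Fock n) :
    annihDer n x (f * g) = toFockK n f * annihDer n x g + toFockK n g * annihDer n x f :=
  symDer_mul _ _ _ f g

lemma annihDer_creation (x : NZ →₀ HTK n) (m : ℕ+ →₀ HT n) :
    annihDer n x (creation n m) = algebraMap EqField (FockK n) (heisCocycle n x (creationEmb n m)) :=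
  symDer_gen _ _ _ m

lemma annihilator_smul_toFockK (x : NZ →₀ HTK n) (a : EqField) (f : Fock n) :
    annihilator n x (a • toFockK n f) = a • annihDer n x f := by
  rw [map_smul]
  congr 1
  exact LinearMap.liftBaseChange_one_tmul (A := EqField) (R := EqRing) (annihDer n x) f

lemma fockK_ind {P : FockK n → Prop} (h0 : P 0) (hadd : ∀ f g, P f → P g → P (f + g))
    (hs : ∀ (a : EqField) f, P (a • toFockK n f)) (f : FockK n) : P f := by
  refine TensorProduct.induction_on (motive := P) f h0 (fun a f => ?_) hadd
  have : (a ⊗ₜ[EqRing] f : EqField ⊗[EqRing] Fock n) = a • ((1 : EqField) ⊗ₜ[EqRing] f) := by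
    rw [TensorProduct.smul_tmul', smul_eq_mul, mul_one]
  have h2 := hs a f
  exact (show (a ⊗ₜ[EqRing] f : EqField ⊗[EqRing] Fock n) = a • toFockK n f from this) ▸ h2

lemma annihilator_mul (x : NZ →₀ HTK n) (f g : FockK n) :
    annihilator n x (f * g) = f * annihilator n x g + g * annihilator n x f := by
  induction f using fockK_ind with
  | h0 => simp
  | hadd f f' hf hf' => simp only [add_mul, map_add, hf, hf', mul_add]; ring
  | hs a f =>
    induction g using fockK_ind with
    | h0 => simp
    | hadd g g' hg hg' => simp only [add_mul, map_add, hg, hg', mul_add]; ring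
    | hs b g =>
      rw [smul_mul_smul_comm, ← map_mul, annihilator_smul_toFockK, annihilator_smul_toFockK,
        annihilator_smul_toFockK, annihDer_mul, smul_mul_smul_comm, smul_mul_smul_comm, smul_add,
        mul_comm b a]

lemma annihilator_one (x : NZ →₀ HTK n) : annihilator n x 1 = 0 := by
  have h := annihilator_mul x 1 1
  rw [one_mul, one_mul] at h
  exact left_eq_add.mp h

lemma annihilator_algebraMap (x : NZ →₀ HTK n) (r : EqField) :
    annihilator n x (algebraMap EqField (FockK n) r) = 0 := by
  rw [Algebra.algebraMap_eq_smul_one, map_smul, annihilator_one, smul_zero]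

lemma annihilator_ι (x : NZ →₀ HTK n) (m : ℕ+ →₀ HT n) :
    annihilator n x (toFockK n (creation n m)) =
      algebraMap EqField (FockK n) (heisCocycle n x (creationEmb n m)) := by
  have h := annihilator_smul_toFockK x 1 (creation n m)
  rw [one_smul, one_smul] at h
  rw [h, annihDer_creation]

lemma fock_induction {P : FockK n → Prop} (hc : ∀ r, P (algebraMap EqField (FockK n) r))
    (hι : ∀ m, P (toFockK n (creation n m))) (hmul : ∀ f g, P f → P g → P (f * g))
    (hadd : ∀ f g, P f → P g → P (f + g)) (f : FockK n) : P f := by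
  have h1 : ∀ f : Fock n, P (toFockK n f) := by
    intro f
    refine (creation_isSymmetricAlgebra n).induction (motive := fun f : Fock n => P (toFockK n f))
      (fun r => ?_) hι (fun f g hf hg => ?_) (fun f g hf hg => ?_) f
    · have h : toFockK n (algebraMap EqRing (Fock n) r) = algebraMap EqField (FockK n) (algebraMap EqRing EqField r) := by
        rw [AlgHom.commutes, ← IsScalarTower.algebraMap_apply]
      exact h.symm ▸ hc _
    · exact (map_mul (toFockK n) f g).symm ▸ hmul _ _ hf hg
    · exact (map_add (toFockK n) f g).symm ▸ hadd _ _ hf hg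
  induction f using fockK_ind with
  | h0 => simpa using hc 0
  | hadd f g hf hg => exact hadd _ _ hf hg
  | hs a f => rw [Algebra.smul_def]; exact hmul _ _ (hc a) (h1 f)

lemma annihilator_add (x y : NZ →₀ HTK n) (f : FockK n) :
    annihilator n (x + y) f = annihilator n x f + annihilator n y f := by
  induction f using fock_induction with
  | hc r => simp [annihilator_algebraMap]
  | hι m => simp [annihilator_ι]
  | hmul f g hf hg => simp only [annihilator_mul, hf, hg]; ring
  | hadd f g hf hg => simp only [map_add, hf, hg]; ring

lemma annihilator_smul (r : EqField) (x : NZ →₀ HTK n) (f : FockK n) :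
    annihilator n (r • x) f = r • annihilator n x f := by
  induction f using fock_induction with
  | hc r => simp [annihilator_algebraMap]
  | hι m => simp [annihilator_ι, Algebra.smul_def]
  | hmul f g hf hg => simp only [annihilator_mul, hf, hg, smul_add, mul_smul_comm]
  | hadd f g hf hg => simp only [map_add, hf, hg, smul_add]

lemma annihilator_comm (x y : NZ →₀ HTK n) (f : FockK n) :
    annihilator n x (annihilator n y f) = annihilator n y (annihilator n x f) := by
  induction f using fock_induction with
  | hc r => simp [annihilator_algebraMap]
  | hι m => simp [annihilator_ι, annihilator_algebraMap]
  | hmul f g hf hg => simp only [annihilator_mul, map_add, hf, hg]; ring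
  | hadd f g hf hg => simp only [map_add, hf, hg]

lemma heisCocycle_creationEmb_of_neg (k : NZ) (hk : k.1 < 0) (γ : HTK n) (m : ℕ+ →₀ HT n) :
    heisCocycle n (.single k γ) (creationEmb n m) = 0 := by
  induction m using Finsupp.induction_linear with
  | zero => simp
  | add m m' hm hm' => rw [map_add, map_add, hm, hm', add_zero]
  | single l γ' =>
    rw [creationEmb_single, heisCocycle_single, if_neg]
    have := l.pos
    simp only; omega

lemma annihilator_of_neg (k : NZ) (hk : k.1 < 0) (γ : HTK n) (f : FockK n) :
    annihilator n (.single k γ) f = 0 := by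
  induction f using fock_induction with
  | hc r => simp [annihilator_algebraMap]
  | hι m => rw [annihilator_ι, heisCocycle_creationEmb_of_neg k hk, map_zero]
  | hmul f g hf hg => simp only [annihilator_mul, hf, hg]; ring
  | hadd f g hf hg => simp only [map_add, hf, hg, add_zero]

lemma creator_of_pos (k : NZ) (hk : ¬ k.1 < 0) (γ : HTK n) : creator n (.single k γ) = 0 := by
  simp [creator, hk]

lemma annihilator_creator_single (x : NZ →₀ HTK n) (k : NZ) (hk : k.1 < 0) (γ : HTK n) :
    annihilator n x (creator n (.single k γ)) =
      algebraMap EqField (FockK n) (heisCocycle n x (.single k γ)) := by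
  induction γ using TensorProduct.induction_on with
  | zero => simp
  | add γ γ' h h' => simp only [Finsupp.single_add, map_add, h, h']
  | tmul a γ =>
    have h1 : (a ⊗ₜ[EqRing] γ : HTK n) = a • (1 ⊗ₜ γ) := by simp [TensorProduct.smul_tmul']
    rw [h1, ← Finsupp.smul_single, map_smul, map_smul, map_smul, smul_eq_mul, map_mul,
      ← Algebra.smul_def]
    congr 1
    have h2 : creator n (.single k (1 ⊗ₜ γ)) =
        toFockK n (creation n (.single (negPNat k hk) γ)) := by
      simp [creator, hk, Finsupp.lsingle_apply]
    rw [h2, annihilator_ι, creationEmb_single]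
    congr 3
    exact Subtype.ext (by simp only [negPNat, PNat.mk_coe]; omega)

lemma annihilator_creator_sub (x y : NZ →₀ HTK n) :
    annihilator n x (creator n y) - annihilator n y (creator n x) =
      algebraMap EqField (FockK n) (heisCocycle n x y) := by
  induction x using Finsupp.induction_linear with
  | zero =>
    have := annihilator_smul (n := n) 0 0 (creator n y)
    simp only [zero_smul] at this
    simp [this]
  | add x x' h h' =>
    simp only [map_add, annihilator_add, LinearMap.add_apply, ← h, ← h']; ring
  | single k γ =>
    induction y using Finsupp.induction_linear with
    | zero =>
      have := annihilator_smul (n := n) 0 0 (creator n (.single k γ))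
      simp only [zero_smul] at this
      simp [this]
    | add y y' h h' => simp only [map_add, annihilator_add, ← h, ← h']; ring
    | single l γ' =>
      have hk0 := k.2
      have hl0 := l.2
      by_cases hk : k.1 < 0 <;> by_cases hl : l.1 < 0
      · rw [annihilator_of_neg k hk, annihilator_of_neg l hl, heisCocycle_single, if_neg (by omega)]
        simp
      · rw [annihilator_of_neg k hk, annihilator_creator_single _ _ hk, heisCocycle_skew, map_neg,
          zero_sub]; simp
      · rw [annihilator_of_neg l hl, annihilator_creator_single _ _ hl, sub_zero]
      · rw [creator_of_pos k hk, creator_of_pos l hl, heisCocycle_single, if_neg (by omega)]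
        simp

/-- The representation of `ℋ` on Fock space: `𝔭_k(γ)` for `k < 0` multiplies, `𝔭_k(γ)` for `k > 0` kills
the vacuum and acts through the commutation relations, and `c` acts by `1`. -/
instance : LieRingModule (Heis n) (FockK n) where
  bracket x f := creator n x.modes * f + annihilator n x.modes f + x.c • f
  add_lie x y f := by
    simp only [Heis.add_modes, Heis.add_c, map_add, annihilator_add, add_mul, add_smul]; abel
  lie_add x f g := by simp only [mul_add, map_add, smul_add]; abel
  leibniz_lie x y f := by
    have h := annihilator_creator_sub x.modes y.modes
    have h0 : annihilator n (0 : NZ →₀ HTK n) f = 0 := by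
      simpa using annihilator_smul (0 : EqField) (0 : NZ →₀ HTK n) f
    simp only [Heis.lie_modes, Heis.lie_c, map_zero, zero_mul, zero_add, h0, annihilator_mul,
      map_add, mul_add, Algebra.smul_def, ← h, annihilator_algebraMap, mul_zero, annihilator_comm x.modes y.modes]
    ring

lemma heis_lie_def (x : Heis n) (f : FockK n) :
    ⁅x, f⁆ = creator n x.modes * f + annihilator n x.modes f + x.c • f := rfl

instance : LieModule EqField (Heis n) (FockK n) where
  smul_lie r x f := by
    simp only [heis_lie_def, Heis.smul_modes, Heis.smul_c, map_smul, annihilator_smul, smul_add,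
      smul_mul_assoc, mul_smul]
  lie_smul r x f := by
    simp only [heis_lie_def, map_smul, smul_add, mul_smul_comm]
    rw [smul_comm r]
end Fock

section Embedding
variable (n : ℕ)

/-- `W ⊗ ℚ(t₁, t₂)` inside `V_Λ ⊗ ℚ(t₁, t₂)`. -/
def WK : Submodule EqField (EqField ⊗[ℚ] BasicRep n) := (zeroWeightSum n).baseChange EqField

/-- The vector `v` in `V_Λ ⊗ ℚ(t₁, t₂)`. -/
def hwVectorK : EqField ⊗[ℚ] BasicRep n := 1 ⊗ₜ hwVector n

variable {n}

/-- The formulas for the embedding of `ℋ` into `gl^(n+1) ⊗ ℚ(t₁, t₂)`. -/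
structure IsHeisEmbedding (φ : Heis n →ₗ⁅EqField⁆ EqField ⊗[ℚ] AffineGl n) : Prop where
  one_neg (k : ℕ+) : φ (Heis.p (-NZ.ofPos k) 1) = 1 ⊗ₜ AffineGl.mode 1 (-(k : ℤ))
  one_pos (k : ℕ+) : φ (Heis.p (NZ.ofPos k) 1) =
    (-(((n : EqField) + 1) ^ 2 * algebraMap EqRing EqField (t₁ * t₂))⁻¹) ⊗ₜ AffineGl.mode 1 (k : ℤ)
  curve (k : NZ) (i : Fin n) : φ (Heis.p k (1 ⊗ₜ curveClass n i)) =
    1 ⊗ₜ AffineGl.mode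
      (Matrix.single i.castSucc i.castSucc 1 - Matrix.single i.succ i.succ 1) k.1
  central : φ (Heis.central n) = 1 ⊗ₜ AffineGl.central n

end Embedding

end

end AnHilb

open AnHilb

/-! The formulas respect the Heisenberg relations because of two computations. On the span of
$E_1,\dots,E_n$ the residue pairing is minus the trace form of the matrices $e_{i,i}-e_{i+1,i+1}$.
Moreover $1$ is orthogonal to all $E_i$, and $\langle 1,1\rangle=1/((n+1)t_1t_2)$ while
$\operatorname{tr}(\mathrm{Id}^2)=n+1$, which forces the constant $-1/((n+1)^2t_1t_2)$
(`heisCoeff_mul`). Since $1,E_1,\dots,E_n$ is a basis over $\mathbb Q(t_1,t_2)$, this gives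
existence and uniqueness of the homomorphism, and nondegeneracy of the pairing gives injectivity.

The positive modes kill $v$, so the creation operators define an intertwiner from Fock space to
$V_\Lambda\otimes\mathbb K$ with $v_\emptyset\mapsto v$. It is injective because a nonzero subspace
of Fock space stable under annihilation contains the vacuum (`one_mem_of_annihilator_mem`) and
because $v\ne0$. What remains is that its image is all of $W\otimes\mathbb K$, that is, that $W$ is
generated from $v$ by the negative diagonal modes (`zeroWeightSum_le`). This is the heart of the
proof.

The tool for it is the boson-fermion energy identity. The algebra acts at level one on an exterior
algebra through normally ordered products of fermions $\psi_{a,r},\psi^*_{a,r}$. For each colour $a$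
the bosonic energy $\frac12\sum_k{:}h_a(-k)h_a(k){:}$ and the fermionic operator
$\sum_r(r+\frac12){:}\psi_{a,r}\psi^*_{a,r}{:}$ add up to zero (`sugawara_eq`). Summed over colours,
this expresses $-d$ through the diagonal modes. The identity passes to $V_\Lambda$, because the
kernel of the map from the universal module to the fermionic space misses the vacuum and so lies in
the maximal proper submodule. On a vector $w$ of weight $\Lambda-m\delta$ the zero modes vanish, and
the identity reads $mw=\sum_a\sum_{k>0}h_a(-k)h_a(k)w$. Every $h_a(k)w$ has smaller energy, so
induction on $m$ finishes. The fermionic model also shows that $v\ne0$. -/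

namespace AnHilb

noncomputable section

/-! ### Infinite sums of operators that are finite on each vector -/

section LocallyFinite
variable {V : Type*} [AddCommGroup V] [Module ℚ V]

/-- A family of operators, only finitely many of which are nonzero on each vector. -/
def LocFin (T : ℤ → Module.End ℚ V) : Prop := ∀ u, (fun r => T r u).HasFiniteSupport

open Classical in
/-- The sum of a locally finite family of operators. -/
def lfsum (T : ℤ → Module.End ℚ V) : Module.End ℚ V :=
  if h : LocFin T then
    { toFun := fun u => ∑ᶠ r, T r u
      map_add' := fun u w => by
        simp only [map_add]
        exact finsum_add_distrib (h u) (h w)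
      map_smul' := fun c u => by
        simp only [map_smul, RingHom.id_apply]
        exact (smul_finsum' c (h u)).symm }
  -- A junk value. The sum is evaluated on vectors only through `LocFin.lfsum_apply`, which requires
  -- local finiteness.
  else 0

variable {T S : ℤ → Module.End ℚ V}

lemma LocFin.lfsum_apply (h : LocFin T) (u : V) : lfsum T u = ∑ᶠ r, T r u := by
  simp [lfsum, h]

lemma LocFin.of_subset (h : ∀ u, ∃ s : Set ℤ, s.Finite ∧ ∀ r, r ∉ s → T r u = 0) : LocFin T := by
  intro u
  obtain ⟨s, hs, h⟩ := h u
  exact hs.subset fun r hr => by_contra fun hrs => hr (h r hrs)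

lemma LocFin.add (hT : LocFin T) (hS : LocFin S) : LocFin (fun r => T r + S r) :=
  .of_subset fun u => ⟨_, (hT u).union (hS u), fun r hr => by
    simp only [Set.mem_union, not_or, Function.mem_support, not_not] at hr
    simp [hr.1, hr.2]⟩

lemma LocFin.mul_left (hT : LocFin T) (A : ℤ → Module.End ℚ V) : LocFin (fun r => A r * T r) :=
  .of_subset fun u => ⟨_, hT u, fun r hr => by
    simp only [Function.mem_support, not_not] at hr
    simp [hr]⟩

lemma LocFin.mul_right (hT : LocFin T) (A : Module.End ℚ V) : LocFin (fun r => T r * A) :=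
  fun u => hT (A u)

lemma LocFin.smul (hT : LocFin T) (f : ℤ → ℚ) : LocFin (fun r => f r • T r) :=
  .of_subset fun u => ⟨_, hT u, fun r hr => by
    simp only [Function.mem_support, not_not] at hr
    simp [hr]⟩

lemma LocFin.neg (hT : LocFin T) : LocFin (fun r => -T r) := by
  simpa using hT.smul fun _ => -1

lemma LocFin.sub (hT : LocFin T) (hS : LocFin S) : LocFin (fun r => T r - S r) := by
  simpa [sub_eq_add_neg] using hT.add hS.neg

lemma LocFin.comp (hT : LocFin T) (e : ℤ ≃ ℤ) : LocFin (fun r => T (e r)) :=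
  .of_subset fun u => ⟨_, (hT u).preimage e.injective.injOn, fun r hr => by
    simpa using hr⟩

lemma locFin_of_finite {s : Set ℤ} (hs : s.Finite) (h : ∀ r, r ∉ s → T r = 0) : LocFin T :=
  .of_subset fun _ => ⟨s, hs, fun r hr => by simp [h r hr]⟩

lemma lfsum_add (hT : LocFin T) (hS : LocFin S) :
    lfsum (fun r => T r + S r) = lfsum T + lfsum S := by
  ext u
  rw [(hT.add hS).lfsum_apply, LinearMap.add_apply, hT.lfsum_apply, hS.lfsum_apply]
  exact finsum_add_distrib (hT u) (hS u)

lemma lfsum_smul (hT : LocFin T) (c : ℚ) : lfsum (fun r => c • T r) = c • lfsum T := by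
  ext u
  rw [(hT.smul fun _ => c).lfsum_apply, LinearMap.smul_apply, hT.lfsum_apply, smul_finsum' c (hT u)]
  rfl

lemma lfsum_neg (hT : LocFin T) : lfsum (fun r => -T r) = -lfsum T := by
  simpa using lfsum_smul hT (-1)

lemma lfsum_sub (hT : LocFin T) (hS : LocFin S) :
    lfsum (fun r => T r - S r) = lfsum T - lfsum S := by
  simp only [sub_eq_add_neg]
  rw [lfsum_add hT hS.neg, lfsum_neg hS]

lemma mul_lfsum (hT : LocFin T) (A : Module.End ℚ V) :
    A * lfsum T = lfsum (fun r => A * T r) := by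
  ext u
  rw [(hT.mul_left fun _ => A).lfsum_apply, Module.End.mul_apply, hT.lfsum_apply,
    map_finsum _ (hT u)]
  rfl

lemma lfsum_mul (hT : LocFin T) (A : Module.End ℚ V) :
    lfsum T * A = lfsum (fun r => T r * A) := by
  ext u
  rw [(hT.mul_right A).lfsum_apply, Module.End.mul_apply, hT.lfsum_apply]
  rfl

lemma lfsum_comm (hT : LocFin T) (A : Module.End ℚ V) :
    lfsum T * A - A * lfsum T = lfsum (fun r => T r * A - A * T r) := by
  rw [lfsum_mul hT, mul_lfsum hT, lfsum_sub (hT.mul_right A) (hT.mul_left fun _ => A)]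

lemma lfsum_comp (hT : LocFin T) (e : ℤ ≃ ℤ) : lfsum (fun r => T (e r)) = lfsum T := by
  ext u
  rw [(hT.comp e).lfsum_apply, hT.lfsum_apply]
  exact finsum_comp_equiv e (f := fun r => T r u)

lemma lfsum_eq_single (a : ℤ) (h : ∀ r, r ≠ a → T r = 0) : lfsum T = T a := by
  ext u
  rw [(locFin_of_finite (Set.finite_singleton a) h).lfsum_apply]
  exact finsum_eq_single _ a fun r hr => by simp [h r hr]

lemma lfsum_zero : lfsum (fun _ => (0 : Module.End ℚ V)) = 0 :=
  lfsum_eq_single 0 fun _ _ => rfl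

lemma lfsum_scalar {c : ℤ → ℚ} (s : Finset ℤ) (h : ∀ r, r ∉ s → c r = 0) :
    lfsum (fun r => c r • (1 : Module.End ℚ V)) = (∑ r ∈ s, c r) • 1 := by
  ext u
  rw [LocFin.lfsum_apply (locFin_of_finite s.finite_toSet fun r hr => by simp [h r hr])]
  rw [finsum_eq_finsetSum_of_support_subset (s := s)]
  · simp [Finset.sum_smul]
  · intro r hr
    by_contra hrs
    exact hr (by simp [h r hrs])

end LocallyFinite

/-! ### Fermions, normal ordering and the commutators of currents -/

section Fermions
variable {ι V : Type*} [DecidableEq ι] [AddCommGroup V] [Module ℚ V]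

/-- Operators `ψ_{i,r}`, `ψ*_{i,r}` with the canonical anticommutation relations, such that for each
colour and each vector almost all `ψ_{i,r}` with `r ≥ 0` and almost all `ψ*_{i,r}` with `r < 0`
kill the vector. -/
structure IsFermion (ψ ψs : ι → ℤ → Module.End ℚ V) : Prop where
  anti i r j s : ψ i r * ψ j s = -(ψ j s * ψ i r)
  anti_star i r j s : ψs i r * ψs j s = -(ψs j s * ψs i r)
  car i r j s : ψs j s * ψ i r = (if i = j ∧ r = s then 1 else 0) - ψ i r * ψs j s
  fin i u : {r | 0 ≤ r ∧ ψ i r u ≠ 0}.Finite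
  fin_star i u : {r | r < 0 ∧ ψs i r u ≠ 0}.Finite

/-- The normally ordered product `:ψ_{i,r} ψ*_{j,s}:`. -/
def normalProd (ψ ψs : ι → ℤ → Module.End ℚ V) (i : ι) (r : ℤ) (j : ι) (s : ℤ) : Module.End ℚ V :=
  ψ i r * ψs j s - (if i = j ∧ r = s ∧ 0 ≤ s then (1 : ℚ) else 0) • 1

/-- The current `∑_r f(r) :ψ_{i,r+k} ψ*_{j,r}:`. -/
def current (ψ ψs : ι → ℤ → Module.End ℚ V) (f : ℤ → ℚ) (i j : ι) (k : ℤ) : Module.End ℚ V :=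
  lfsum fun r => f r • normalProd ψ ψs i (r + k) j r

namespace IsFermion
variable {ψ ψs : ι → ℤ → Module.End ℚ V}

/-- Exchanging the roles of `ψ` and `ψ*`. -/
lemma dual (H : IsFermion ψ ψs) : IsFermion (fun i r => ψs i (-1 - r)) (fun i r => ψ i (-1 - r)) where
  anti i r j s := H.anti_star _ _ _ _
  anti_star i r j s := H.anti _ _ _ _
  car i r j s := by
    have h := H.car j (-1 - s) i (-1 - r)
    rw [eq_sub_iff_add_eq, add_comm] at h
    rw [eq_sub_iff_add_eq, h]
    congr 1
    simp only [eq_iff_iff]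
    constructor <;> rintro ⟨rfl, h⟩ <;> exact ⟨rfl, by omega⟩
  fin i u := by
    -- The reflection $r\mapsto-1-r$ exchanges the modes $r\ge0$ with the modes $r<0$, so the two
    -- finiteness conditions trade places.
    refine ((H.fin_star i u).preimage (f := fun r => -1 - r) (fun a _ b _ h => ?_)).subset ?_
    · simpa using h
    · rintro r ⟨h1, h2⟩
      exact ⟨by simp only; omega, h2⟩
  fin_star i u := by
    refine ((H.fin i u).preimage (f := fun r => -1 - r) (fun a _ b _ h => ?_)).subset ?_
    · simpa using h
    · rintro r ⟨h1, h2⟩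
      exact ⟨by simp only; omega, h2⟩

/-- For $r+l<0$ the factor $\psi^*$ already stands on the right and kills the vector for almost all
$r$. For $r+l\ge0$ the normal ordering constant is exactly what moving $\psi$ to the right produces,
and $\psi_{r+k}$ kills the vector for almost all $r$ with $r+k\ge0$. Only the finite gap $-l\le
r<-k$ escapes both cases. -/
lemma locFin_normalProd (H : IsFermion ψ ψs) (i j : ι) (k l : ℤ) :
    LocFin fun r => normalProd ψ ψs i (r + k) j (r + l) := by
  refine .of_subset fun u => ⟨(fun r => r + k) ⁻¹' _ ∪ (fun r => r + l) ⁻¹' _ ∪ Set.Ico (-l) (-k),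
    (((H.fin i u).preimage (add_left_injective k).injOn).union
      ((H.fin_star j u).preimage (add_left_injective l).injOn)).union (Set.finite_Ico _ _), ?_⟩
  intro r hr
  simp only [Set.mem_union, Set.mem_preimage, Set.mem_ofPred_eq, Set.mem_Ico, not_or, not_and,
    not_not] at hr
  obtain ⟨⟨h1, h2⟩, h3⟩ := hr
  rcases lt_or_ge (r + l) 0 with h | h
  · rw [normalProd, if_neg (by omega)]
    simp [h2 h]
  · have hk : 0 ≤ r + k := by omega
    have : normalProd ψ ψs i (r + k) j (r + l) = -(ψs j (r + l) * ψ i (r + k)) := by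
      rw [normalProd, H.car]
      simp only [h, and_true]
      split_ifs <;> simp
    rw [this]
    simp [h1 hk]

lemma locFin_psi_mul_psi (H : IsFermion ψ ψs) (i j : ι) (k l : ℤ) :
    LocFin fun r => ψ i (k + r) * ψ j (l - r) := by
  refine .of_subset fun u => ⟨(fun r => k + r) ⁻¹' _ ∪ (fun r => l - r) ⁻¹' _ ∪ Set.Ioo l (-k),
    (((H.fin i u).preimage (add_right_injective k).injOn).union
      ((H.fin j u).preimage (sub_right_injective (b := l)).injOn)).union (Set.finite_Ioo _ _), ?_⟩
  intro r hr
  simp only [Set.mem_union, Set.mem_preimage, Set.mem_ofPred_eq, Set.mem_Ioo, not_or, not_and,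
    not_not] at hr
  obtain ⟨⟨h1, h2⟩, h3⟩ := hr
  rcases lt_or_ge (l - r) 0 with h | h
  · rw [H.anti]
    simp [h1 (by omega)]
  · simp [h2 h]

lemma normalProd_comm_psi (H : IsFermion ψ ψs) (i j l : ι) (r s t : ℤ) :
    normalProd ψ ψs i r j s * ψ l t - ψ l t * normalProd ψ ψs i r j s =
      if j = l ∧ s = t then ψ i r else 0 := by
  have h1 : ψ i r * ψs j s * ψ l t = (if j = l ∧ s = t then ψ i r else 0) +
      ψ l t * (ψ i r * ψs j s) := by
    rw [mul_assoc, H.car, mul_sub, ← mul_assoc, H.anti i r l t]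
    simp only [eq_comm (a := l), eq_comm (a := t)]
    split_ifs <;> simp [mul_assoc]
  simp only [normalProd, sub_mul, mul_sub, h1, smul_mul_assoc, mul_smul_comm, one_mul, mul_one]
  abel

lemma normalProd_comm_psiStar (H : IsFermion ψ ψs) (i j l : ι) (r s t : ℤ) :
    normalProd ψ ψs i r j s * ψs l t - ψs l t * normalProd ψ ψs i r j s =
      -(if i = l ∧ r = t then ψs j s else 0) := by
  have h1 : ψs l t * (ψ i r * ψs j s) = (if i = l ∧ r = t then ψs j s else 0) +
      ψ i r * ψs j s * ψs l t := by
    rw [← mul_assoc, H.car, sub_mul, mul_assoc, H.anti_star l t j s]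
    split_ifs <;> simp [mul_assoc]
  simp only [normalProd, sub_mul, mul_sub, h1, smul_mul_assoc, mul_smul_comm, one_mul, mul_one]
  abel

lemma locFin_current (H : IsFermion ψ ψs) (f : ℤ → ℚ) (i j : ι) (k : ℤ) :
    LocFin fun r => f r • normalProd ψ ψs i (r + k) j r := by
  simpa using (H.locFin_normalProd i j k 0).smul f

lemma current_comm_psi (H : IsFermion ψ ψs) (f : ℤ → ℚ) (i j l : ι) (k s : ℤ) :
    current ψ ψs f i j k * ψ l s - ψ l s * current ψ ψs f i j k =
      if j = l then f s • ψ i (s + k) else 0 := by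
  have h : ∀ r, f r • normalProd ψ ψs i (r + k) j r * ψ l s -
      ψ l s * f r • normalProd ψ ψs i (r + k) j r = if j = l ∧ r = s then f r • ψ i (r + k) else 0 := by
    intro r
    rw [smul_mul_assoc, mul_smul_comm, ← smul_sub, H.normalProd_comm_psi]
    split_ifs <;> simp
  rw [current, lfsum_comm (H.locFin_current f i j k)]
  simp only [h]
  rw [lfsum_eq_single s fun r hr => if_neg fun h => hr h.2]
  simp

lemma current_comm_psiStar (H : IsFermion ψ ψs) (f : ℤ → ℚ) (i j l : ι) (k s : ℤ) :
    current ψ ψs f i j k * ψs l s - ψs l s * current ψ ψs f i j k =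
      -(if i = l then f (s - k) • ψs j (s - k) else 0) := by
  have h : ∀ r, f r • normalProd ψ ψs i (r + k) j r * ψs l s -
      ψs l s * f r • normalProd ψ ψs i (r + k) j r =
        -(if i = l ∧ r + k = s then f r • ψs j r else 0) := by
    intro r
    rw [smul_mul_assoc, mul_smul_comm, ← smul_sub, H.normalProd_comm_psiStar]
    split_ifs <;> simp
  rw [current, lfsum_comm (H.locFin_current f i j k)]
  simp only [h]
  rw [lfsum_eq_single (s - k) fun r hr => by rw [if_neg fun h => hr (by omega), neg_zero]]
  simp

/-- Commuting with a current acts as a derivation on $\psi\psi^*$ and shifts each factor. The two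
resulting families are again currents after renormalising, and the two normal ordering constants
differ by $1_{r\ge0}-1_{r\ge k}$, which is supported between $0$ and $k$. This finite sum is the
central term. General weights are allowed because $f=1$ gives the loop algebra, $f(r)=r$ gives $d$,
and $f(r)=r+\frac12$ gives the fermionic energy. -/
lemma current_comm_current (H : IsFermion ψ ψs) (f g : ℤ → ℚ) (i j l m : ι) (k p : ℤ) :
    current ψ ψs f i j k * current ψ ψs g l m p - current ψ ψs g l m p * current ψ ψs f i j k =
      (if j = l then current ψ ψs (fun r => f (r + p) * g r) i m (k + p) else 0) -
        (if i = m then current ψ ψs (fun r => f r * g (r + k)) l j (k + p) else 0) +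
      (if j = l ∧ i = m ∧ k + p = 0 then
        ∑ r ∈ Finset.Ico (min 0 k) (max 0 k),
          f (r - k) * g r * ((if 0 ≤ r then 1 else 0) - (if k ≤ r then 1 else 0)) else 0) • 1 := by
  -- Only the second current is expanded; the first is kept whole, so that its commutators with
  -- single fermions apply. The commutator is taken in the opposite order, whence the overall sign.
  have h : ∀ r, g r • normalProd ψ ψs l (r + p) m r * current ψ ψs f i j k -
      current ψ ψs f i j k * g r • normalProd ψ ψs l (r + p) m r =
      -(((if j = l then 1 else 0 : ℚ) •
          (f (r + p) * g r) • normalProd ψ ψs i (r + (k + p)) m r) -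
        (if i = m then 1 else 0 : ℚ) • (f (r - k) * g r) • normalProd ψ ψs l (r + p) j (r - k) +
      (if j = l ∧ i = m ∧ k + p = 0 then
          f (r - k) * g r * ((if 0 ≤ r then 1 else 0) - (if k ≤ r then 1 else 0)) else 0 : ℚ) •
            (1 : Module.End ℚ V)) := by
    intro r
    have h1 := H.current_comm_psi f i j l k (r + p)
    have h2 := H.current_comm_psiStar f i j m k r
    rw [sub_eq_iff_eq_add] at h1 h2
    rw [smul_mul_assoc, mul_smul_comm, ← smul_sub]
    have h3 : normalProd ψ ψs l (r + p) m r * current ψ ψs f i j k -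
      current ψ ψs f i j k * normalProd ψ ψs l (r + p) m r =
        - ((if j = l then f (r + p) • ψ i (r + p + k) else 0) * ψs m r) +
        ψ l (r + p) * (if i = m then f (r - k) • ψs j (r - k) else 0) := by
      simp only [normalProd, sub_mul, mul_sub, ← mul_assoc, h1, smul_mul_assoc, mul_smul_comm,
        one_mul, mul_one, add_mul]
      rw [mul_assoc _ (current ψ ψs f i j k), h2]
      simp only [mul_add, mul_neg, mul_assoc]
      abel
    rw [h3, show r + (k + p) = r + p + k by ring]
    simp only [normalProd]
    by_cases h4 : j = l <;> by_cases h5 : i = m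
    · subst h4 h5
      by_cases h6 : k + p = 0
      · obtain rfl : p = -k := by omega
        simp only [if_true, true_and, ← sub_eq_add_neg, sub_add_cancel,
          smul_mul_assoc, mul_smul_comm, sub_nonneg, sub_self]
        split_ifs <;> simp [smul_sub, smul_smul] <;> module
      · have h7 : ¬ r + p + k = r := by omega
        have h8 : ¬ r + p = r - k := by omega
        simp [h6, h7, h8, smul_smul, mul_comm (g r)]
        module
    · simp [h4, h5, smul_smul, mul_comm (g r)]
    · simp [h4, h5, Ne.symm h4, smul_smul, mul_comm (g r)]
    · simp [h4, h5]
  have hA : LocFin fun r => (if j = l then 1 else 0 : ℚ) •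
      (f (r + p) * g r) • normalProd ψ ψs i (r + (k + p)) m r :=
    (H.locFin_current _ i m _).smul _
  have hB0 : LocFin fun r => (f r * g (r + k)) • normalProd ψ ψs l (r + (k + p)) j r :=
    H.locFin_current _ l j _
  -- The second family becomes a current after the shift $r\mapsto r-k$ of the summation index.
  have hB1 : ∀ r, (f (r - k) * g r) • normalProd ψ ψs l (r + p) j (r - k) =
      (f (Equiv.subRight k r) * g (Equiv.subRight k r + k)) •
        normalProd ψ ψs l (Equiv.subRight k r + (k + p)) j (Equiv.subRight k r) := by
    intro r
    simp only [Equiv.subRight_apply, sub_add_cancel, show r - k + (k + p) = r + p by ring]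
  have hB : LocFin fun r => (if i = m then 1 else 0 : ℚ) •
      (f (r - k) * g r) • normalProd ψ ψs l (r + p) j (r - k) := by
    simp only [hB1]
    exact (hB0.comp (Equiv.subRight k)).smul _
  have hc : ∀ r, r ∉ Finset.Ico (min 0 k) (max 0 k) → (if j = l ∧ i = m ∧ k + p = 0 then
      f (r - k) * g r * ((if 0 ≤ r then 1 else 0) - (if k ≤ r then 1 else 0)) else 0 : ℚ) = 0 := by
    intro r hr
    simp only [Finset.mem_Ico, not_and, not_lt] at hr
    split_ifs <;> first | omega | simp
  have hC : LocFin fun r => (if j = l ∧ i = m ∧ k + p = 0 then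
      f (r - k) * g r * ((if 0 ≤ r then 1 else 0) - (if k ≤ r then 1 else 0)) else 0 : ℚ) •
        (1 : Module.End ℚ V) :=
    locFin_of_finite (Finset.finite_toSet _) fun r hr => by
      rw [hc r hr, zero_smul]
  have h0 := lfsum_comm (H.locFin_current g l m p) (current ψ ψs f i j k)
  simp only [h] at h0
  rw [lfsum_neg ((hA.sub hB).add hC), lfsum_add (hA.sub hB) hC, lfsum_sub hA hB,
    lfsum_smul (H.locFin_current _ i m _), lfsum_scalar _ hc] at h0
  simp only [hB1] at h0
  rw [lfsum_smul (hB0.comp _), lfsum_comp hB0] at h0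
  rw [← neg_sub]
  refine (congrArg Neg.neg h0).trans ?_
  rw [neg_neg]
  congr 1
  · congr 1
    · split_ifs <;> simp [current]
    · split_ifs <;> simp [current]
  · congr 1
    split_ifs <;> simp

end IsFermion
end Fermions

/-! ### Sugawara energy: its brackets with the fermions of one colour -/

section Energy
variable {ι V : Type*} [DecidableEq ι] [AddCommGroup V] [Module ℚ V]
  {ψ ψs : ι → ℤ → Module.End ℚ V}

open Filter in
lemma eventually_of_finite_nonneg {P : ℤ → Prop} (h : {r | 0 ≤ r ∧ ¬ P r}.Finite) :
    ∀ᶠ r in atTop, P r := by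
  obtain ⟨b, hb⟩ := h.bddAbove
  filter_upwards [eventually_gt_atTop b, eventually_ge_atTop 0] with r h1 h2
  by_contra hr
  exact absurd (hb ⟨h2, hr⟩) (not_le.mpr h1)

-- Only finitely many $\psi^*_{j,r}u$ with $r<0$ are nonzero, and $\psi_{i,r+k}$ kills each of them
-- once $k$ is large. For $r\ge0$ and $k>0$ the product may be reordered without a constant, and
-- $\psi_{i,r+k}u=0$ uniformly in $r$ for large $k$.
open Filter in
lemma IsFermion.eventually_current (H : IsFermion ψ ψs) (f : ℤ → ℚ) (i j : ι) (u : V) :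
    ∀ᶠ k in atTop, current ψ ψs f i j k u = 0 := by
  have h1 : ∀ w, ∀ᶠ r in atTop, ψ i r w = 0 := fun w => eventually_of_finite_nonneg (H.fin i w)
  obtain ⟨b, hb⟩ := eventually_atTop.mp (h1 u)
  have h2 : ∀ᶠ k in atTop, ∀ r ∈ {r | r < 0 ∧ ψs j r u ≠ 0}, ψ i (r + k) (ψs j r u) = 0 :=
    (eventually_all_finite (H.fin_star j u)).mpr fun r _ =>
      (tendsto_atTop_add_const_left atTop r tendsto_id).eventually (h1 _)
  filter_upwards [h2, eventually_ge_atTop b, eventually_gt_atTop 0] with k hk hkb hk0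
  rw [current, (H.locFin_current f i j k).lfsum_apply]
  refine finsum_eq_zero_of_forall_eq_zero fun r => ?_
  rw [LinearMap.smul_apply]
  convert smul_zero _
  rcases lt_or_ge r 0 with h | h
  · rw [normalProd, if_neg (by omega)]
    by_cases h3 : ψs j r u = 0
    · simp [h3]
    · simpa using hk r ⟨h, h3⟩
  · have h4 : normalProd ψ ψs i (r + k) j r = -(ψs j r * ψ i (r + k)) := by
      rw [normalProd, H.car, if_neg (by omega), if_neg (by omega)]
      simp
    rw [h4]
    simp [hb (r + k) (by omega)]

/-- The Heisenberg current of one colour. -/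
def heisCurrent (ψ ψs : ι → ℤ → Module.End ℚ V) (a : ι) (k : ℤ) : Module.End ℚ V :=
  current ψ ψs (fun _ => 1) a a k

/-- The Sugawara energy operator `½ ∑_k :h(-k) h(k):`. -/
def sugawara (h : ℤ → Module.End ℚ V) : Module.End ℚ V :=
  lfsum fun k => (1 / 2 : ℚ) • (h (-|k|) * h |k|)

namespace IsFermion

lemma heis_comm_psi (H : IsFermion ψ ψs) (a b : ι) (k s : ℤ) :
    heisCurrent ψ ψs a k * ψ b s = ψ b s * heisCurrent ψ ψs a k +
      if a = b then ψ a (s + k) else 0 := by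
  rw [← sub_eq_iff_eq_add', heisCurrent, H.current_comm_psi]
  simp

lemma heis_comm_psiStar (H : IsFermion ψ ψs) (a b : ι) (k s : ℤ) :
    heisCurrent ψ ψs a k * ψs b s = ψs b s * heisCurrent ψ ψs a k -
      if a = b then ψs a (s - k) else 0 := by
  rw [sub_eq_add_neg, ← sub_eq_iff_eq_add', heisCurrent, H.current_comm_psiStar]
  simp

lemma heis_comm_heis_zero (H : IsFermion ψ ψs) (a : ι) (k : ℤ) :
    heisCurrent ψ ψs a 0 * heisCurrent ψ ψs a k = heisCurrent ψ ψs a k * heisCurrent ψ ψs a 0 := by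
  rw [← sub_eq_zero, heisCurrent, heisCurrent, H.current_comm_current]
  simp

lemma locFin_sugawara (H : IsFermion ψ ψs) (a : ι) :
    LocFin fun k => (1 / 2 : ℚ) • (heisCurrent ψ ψs a (-|k|) * heisCurrent ψ ψs a |k|) := by
  refine .of_subset fun u => ?_
  obtain ⟨b, hb⟩ := Filter.eventually_atTop.mp (H.eventually_current (fun _ => 1) a a u)
  refine ⟨Set.Ioo (-b) b, Set.finite_Ioo _ _, fun k hk => ?_⟩
  have : b ≤ |k| := by
    rw [Set.mem_Ioo, ← abs_lt] at hk
    omega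
  simp [heisCurrent, hb _ this]

lemma sugawara_comm_psi_aux (H : IsFermion ψ ψs) (a : ι) (r k : ℤ) :
    (1 / 2 : ℚ) • (heisCurrent ψ ψs a (-|k|) * heisCurrent ψ ψs a |k|) * ψ a r -
      ψ a r * (1 / 2 : ℚ) • (heisCurrent ψ ψs a (-|k|) * heisCurrent ψ ψs a |k|) =
    (1 / 2 : ℚ) • (heisCurrent ψ ψs a (-|k|) * ψ a (r + |k|) +
      ψ a (r - |k|) * heisCurrent ψ ψs a |k|) := by
  rw [smul_mul_assoc, mul_smul_comm, ← smul_sub, mul_assoc, H.heis_comm_psi, mul_add, ← mul_assoc,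
    H.heis_comm_psi, if_pos rfl, if_pos rfl, add_mul, mul_assoc, ← sub_eq_add_neg]
  abel_nf

lemma sugawara_comm_psi_eq (H : IsFermion ψ ψs) (a : ι) (r : ℤ) :
    LocFin (fun k => (1 / 2 : ℚ) • (heisCurrent ψ ψs a (-|k|) * ψ a (r + |k|) +
      ψ a (r - |k|) * heisCurrent ψ ψs a |k|)) ∧
    sugawara (heisCurrent ψ ψs a) * ψ a r - ψ a r * sugawara (heisCurrent ψ ψs a) =
      lfsum fun k => (1 / 2 : ℚ) • (heisCurrent ψ ψs a (-|k|) * ψ a (r + |k|) +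
        ψ a (r - |k|) * heisCurrent ψ ψs a |k|) := by
  have h := H.locFin_sugawara a
  constructor
  · simpa only [H.sugawara_comm_psi_aux] using (h.mul_right (ψ a r)).sub (h.mul_left fun _ => ψ a r)
  · rw [sugawara, lfsum_comm h]
    simp only [H.sugawara_comm_psi_aux]

/-- The reindexing $k\mapsto s-r-k$ swaps the two factors, which anticommute, so the sum equals its
own negative. -/
lemma sum_psi_psi_eq_zero (H : IsFermion ψ ψs) (a : ι) (r s : ℤ) :
    lfsum (fun k => ψ a (r + k) * ψ a (s - k)) = 0 := by
  have h := H.locFin_psi_mul_psi a a r s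
  have h1 := lfsum_comp h (Equiv.subLeft (s - r))
  have h2 : ∀ k, ψ a (r + Equiv.subLeft (s - r) k) * ψ a (s - Equiv.subLeft (s - r) k) =
      -(ψ a (r + k) * ψ a (s - k)) := by
    intro k
    rw [H.anti]
    simp only [Equiv.subLeft_apply]
    congr 3 <;> ring
  simp only [h2] at h1
  rw [lfsum_neg h] at h1
  have h3 : (2 : ℚ) • lfsum (fun k => ψ a (r + k) * ψ a (s - k)) = 0 := by
    rw [two_smul]; nth_rw 1 [← h1]; exact neg_add_cancel _
  simpa using h3

/-- Anticommuting the $k$-th term of $[L,\psi_r]$ with $\psi_s$ removes the current and leaves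
$\frac12(\psi_{r+k}\psi_{s-k}+\psi_{r-k}\psi_{s+k})$. The sum over $k$ vanishes by
`sum_psi_psi_eq_zero`. -/
lemma sugawara_psi_anti_psi (H : IsFermion ψ ψs) (a : ι) (r s : ℤ) :
    (sugawara (heisCurrent ψ ψs a) * ψ a r - ψ a r * sugawara (heisCurrent ψ ψs a)) * ψ a s =
      -(ψ a s *
        (sugawara (heisCurrent ψ ψs a) * ψ a r - ψ a r * sugawara (heisCurrent ψ ψs a))) := by
  obtain ⟨h1, h2⟩ := H.sugawara_comm_psi_eq a r
  have hS := H.locFin_psi_mul_psi a a r s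
  have hS' := hS.comp (Equiv.neg ℤ)
  rw [h2, ← add_eq_zero_iff_eq_neg, lfsum_mul h1, mul_lfsum h1,
    ← lfsum_add (h1.mul_right _) (h1.mul_left fun _ => _)]
  have h3 : ∀ k, (1 / 2 : ℚ) • (heisCurrent ψ ψs a (-|k|) * ψ a (r + |k|) +
      ψ a (r - |k|) * heisCurrent ψ ψs a |k|) * ψ a s +
      ψ a s * (1 / 2 : ℚ) • (heisCurrent ψ ψs a (-|k|) * ψ a (r + |k|) +
      ψ a (r - |k|) * heisCurrent ψ ψs a |k|) =
      (1 / 2 : ℚ) • (ψ a (r + k) * ψ a (s - k) +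
        ψ a (r + Equiv.neg ℤ k) * ψ a (s - Equiv.neg ℤ k)) := by
    intro k
    have e1 : heisCurrent ψ ψs a (-|k|) * ψ a (r + |k|) * ψ a s +
        ψ a s * (heisCurrent ψ ψs a (-|k|) * ψ a (r + |k|)) = ψ a (r + |k|) * ψ a (s - |k|) := by
      rw [mul_assoc, H.anti _ _ _ s, mul_neg, ← mul_assoc, H.heis_comm_psi, if_pos rfl, add_mul,
        H.anti a (r + |k|), mul_assoc, ← sub_eq_add_neg]
      abel
    have e2 : ψ a (r - |k|) * heisCurrent ψ ψs a |k| * ψ a s +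
        ψ a s * (ψ a (r - |k|) * heisCurrent ψ ψs a |k|) = ψ a (r - |k|) * ψ a (s + |k|) := by
      rw [mul_assoc, H.heis_comm_psi, if_pos rfl, mul_add, ← mul_assoc, ← mul_assoc,
        H.anti a s]
      simp
    rw [smul_mul_assoc, mul_smul_comm, ← smul_add, add_mul, mul_add, add_add_add_comm, e1, e2]
    congr 1
    simp only [Equiv.neg_apply, sub_neg_eq_add, ← sub_eq_add_neg]
    rcases abs_choice k with h | h <;> rw [h]
    simp only [sub_neg_eq_add, ← sub_eq_add_neg]
    abel
  simp only [h3]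
  rw [lfsum_smul (hS.add hS'), lfsum_add hS hS', lfsum_comp hS, H.sum_psi_psi_eq_zero]
  simp

/-- This is the constant that normal ordering leaves in `sugawara_psi_anti_psiStar` when $r=s$. For
$s\ge0$ all $2s+1$ terms equal $-\frac12$. For $s<0$ the $-2s-1$ inner terms equal $\frac12$ and the
two end terms vanish. -/
lemma sum_half_indicator (s : ℤ) :
    ∑ k ∈ Finset.Icc (-|s|) |s|, ((1 / 2 : ℚ) *
      (1 - (if 0 ≤ s + k then 1 else 0) - (if 0 ≤ s - k then 1 else 0))) = -(s + 1 / 2) := by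
  rcases le_or_gt 0 s with h | h
  · rw [abs_of_nonneg h, Finset.sum_congr rfl (g := fun _ => -(1 / 2 : ℚ))]
    · rw [Finset.sum_const, Int.card_Icc, nsmul_eq_mul]
      have : ((s + 1 - -s).toNat : ℚ) = 2 * s + 1 := by
        have : ((s + 1 - -s).toNat : ℤ) = 2 * s + 1 := by omega
        exact_mod_cast this
      rw [this]; ring
    · intro k hk
      rw [Finset.mem_Icc] at hk
      rw [if_pos (by omega), if_pos (by omega)]; norm_num
  · rw [abs_of_neg h, ← Finset.sum_subset (s₁ := Finset.Ioo s (-s)),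
      Finset.sum_congr rfl (g := fun _ => (1 / 2 : ℚ))]
    · rw [Finset.sum_const, Int.card_Ioo, nsmul_eq_mul]
      have : ((-s - s - 1).toNat : ℚ) = -2 * s - 1 := by
        have : ((-s - s - 1).toNat : ℤ) = -2 * s - 1 := by omega
        exact_mod_cast this
      rw [this]; ring
    · intro k hk
      rw [Finset.mem_Ioo] at hk
      rw [if_neg (by omega), if_neg (by omega)]; norm_num
    · intro k hk
      rw [Finset.mem_Ioo] at hk
      rw [Finset.mem_Icc]; omega
    · intro k hk hk'
      rw [Finset.mem_Icc] at hk
      rw [Finset.mem_Ioo] at hk'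
      by_cases h1 : k = s
      · rw [if_neg (by omega), if_pos (by omega)]; norm_num
      · rw [if_pos (by omega), if_neg (by omega)]; norm_num

/-- Anticommuting with $\psi^*_s$ produces three contributions: multiples of $h(r-s)$ from the terms
with $|k|=|r-s|$, a double series of products $\psi\psi^*$ whose normal ordering sums to $-h(r-s)$,
and scalars. The two currents cancel, and the scalars are present only for $r=s$. -/
lemma sugawara_psi_anti_psiStar (H : IsFermion ψ ψs) (a : ι) (r s : ℤ) :
    (sugawara (heisCurrent ψ ψs a) * ψ a r - ψ a r * sugawara (heisCurrent ψ ψs a)) * ψs a s +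
      ψs a s *
        (sugawara (heisCurrent ψ ψs a) * ψ a r - ψ a r * sugawara (heisCurrent ψ ψs a)) =
      (if r = s then -(r + 1 / 2) else 0 : ℚ) • 1 := by
  obtain ⟨h1, h2⟩ := H.sugawara_comm_psi_eq a r
  have hN := H.locFin_normalProd a a r s
  have hN' := hN.comp (Equiv.neg ℤ)
  rw [h2, lfsum_mul h1, mul_lfsum h1, ← lfsum_add (h1.mul_right _) (h1.mul_left fun _ => _)]
  have h3 : ∀ k, (1 / 2 : ℚ) • (heisCurrent ψ ψs a (-|k|) * ψ a (r + |k|) +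
      ψ a (r - |k|) * heisCurrent ψ ψs a |k|) * ψs a s +
      ψs a s * (1 / 2 : ℚ) • (heisCurrent ψ ψs a (-|k|) * ψ a (r + |k|) +
      ψ a (r - |k|) * heisCurrent ψ ψs a |k|) =
      (((1 / 2 : ℚ) * ((if |k| = s - r then 1 else 0) + (if |k| = r - s then 1 else 0))) •
        (1 : Module.End ℚ V)) * heisCurrent ψ ψs a (r - s) -
      (1 / 2 : ℚ) • (normalProd ψ ψs a (k + r) a (k + s) +
        normalProd ψ ψs a (Equiv.neg ℤ k + r) a (Equiv.neg ℤ k + s)) +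
      (if r = s then (1 / 2 : ℚ) * (1 - (if 0 ≤ s + k then 1 else 0) -
        (if 0 ≤ s - k then 1 else 0)) else 0) • (1 : Module.End ℚ V) := by
    intro k
    have e1 : heisCurrent ψ ψs a (-|k|) * ψ a (r + |k|) * ψs a s +
        ψs a s * (heisCurrent ψ ψs a (-|k|) * ψ a (r + |k|)) =
        (if |k| = s - r then 1 else 0 : ℚ) • heisCurrent ψ ψs a (r - s) +
          (if r = s then 1 else 0 : ℚ) • 1 - ψ a (r + |k|) * ψs a (s + |k|) := by
      have := H.heis_comm_psiStar a a (-|k|) s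
      rw [if_pos rfl, eq_sub_iff_add_eq] at this
      rw [← mul_assoc, ← this, add_mul, mul_assoc _ (ψs a s), H.car, mul_sub, mul_assoc,
        sub_neg_eq_add, H.car]
      have i1 : r + |k| = s ↔ |k| = s - r := by constructor <;> intro h <;> linarith
      simp only [true_and, i1, add_left_inj]
      by_cases h : |k| = s - r
      · rw [h, neg_sub]; by_cases h' : r = s <;> simp [h'] <;> abel
      · by_cases h' : r = s
        · rw [if_neg h, if_neg h, if_pos h', if_pos h']; simp
        · simp [h, h']
    have e2 : ψ a (r - |k|) * heisCurrent ψ ψs a |k| * ψs a s +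
        ψs a s * (ψ a (r - |k|) * heisCurrent ψ ψs a |k|) =
        (if |k| = r - s then 1 else 0 : ℚ) • heisCurrent ψ ψs a (r - s) -
          ψ a (r - |k|) * ψs a (s - |k|) := by
      rw [mul_assoc, H.heis_comm_psiStar, if_pos rfl, ← mul_assoc, H.car, mul_sub, sub_mul]
      by_cases h : |k| = r - s
      · simp [h]; noncomm_ring
      · have h' : ¬ r - |k| = s := by omega
        simp [h, h']; noncomm_ring
    rw [smul_mul_assoc, mul_smul_comm, ← smul_add, add_mul, mul_add, add_add_add_comm, e1, e2]
    have e3 : ψ a (r + |k|) * ψs a (s + |k|) + ψ a (r - |k|) * ψs a (s - |k|) =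
        ψ a (r + k) * ψs a (s + k) + ψ a (r - k) * ψs a (s - k) := by
      rcases abs_choice k with h | h <;> rw [h]
      simp only [sub_neg_eq_add, ← sub_eq_add_neg]
      abel
    have e4 : ∀ A B C D E F : Module.End ℚ V, D + F = E → A + B - D + (C - F) = A + C + B - E := by
      intro A B C D E F h
      rw [← h]; abel
    rw [e4 _ _ _ _ _ _ e3]
    simp only [normalProd, Equiv.neg_apply, add_comm k, add_comm (-k), ← sub_eq_add_neg,
      smul_mul_assoc, one_mul]
    by_cases h : r = s
    · subst h
      simp only [true_and, if_true]
      module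
    · have h5 : ¬ r + k = s + k := by omega
      have h6 : ¬ r - k = s - k := by omega
      simp only [h, h5, h6, false_and, and_false, if_false]
      module
  simp only [h3]
  have hc1 : ∀ k, k ∉ ({s - r, r - s} : Finset ℤ) → ((1 / 2 : ℚ) * ((if |k| = s - r then 1 else 0) +
      (if |k| = r - s then 1 else 0))) = 0 := by
    intro k hk
    simp only [Finset.mem_insert, Finset.mem_singleton, not_or] at hk
    rw [if_neg, if_neg] <;> first | simp | (rcases abs_choice k with h | h <;> omega)
  have hc2 : ∀ k, k ∉ Finset.Icc (-|s|) |s| → (if r = s then (1 / 2 : ℚ) *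
      (1 - (if 0 ≤ s + k then 1 else 0) - (if 0 ≤ s - k then 1 else 0)) else 0) = 0 := by
    intro k hk
    rw [Finset.mem_Icc, ← abs_le, not_le] at hk
    have h0 := abs_nonneg s
    rcases abs_choice k with h | h <;> rcases abs_choice s with h' | h' <;>
      rw [h, h'] at hk <;> rw [h'] at h0 <;> split_ifs <;> first | omega | norm_num
  have hL1 : LocFin fun k => ((1 / 2 : ℚ) * ((if |k| = s - r then 1 else 0) +
      (if |k| = r - s then 1 else 0))) • (1 : Module.End ℚ V) :=
    locFin_of_finite (Finset.finite_toSet _) fun k hk => by rw [hc1 k hk, zero_smul]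
  have hL2 : LocFin fun k => (if r = s then (1 / 2 : ℚ) *
      (1 - (if 0 ≤ s + k then 1 else 0) - (if 0 ≤ s - k then 1 else 0)) else 0) •
      (1 : Module.End ℚ V) :=
    locFin_of_finite (Finset.finite_toSet _) fun k hk => by rw [hc2 k hk, zero_smul]
  rw [lfsum_add ((hL1.mul_right _).sub ((hN.add hN').smul _)) hL2,
    lfsum_sub (hL1.mul_right _) ((hN.add hN').smul _), lfsum_smul (hN.add hN'), lfsum_add hN hN',
    lfsum_comp hN, ← lfsum_mul hL1, lfsum_scalar _ hc1, lfsum_scalar _ hc2]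
  -- The total weight of $h(r-s)$ is one: for $r\ne s$ the two values $k=\pm(r-s)$ give $\frac12$
  -- each, and for $r=s$ both indicators are met at the single value $k=0$.
  have hs1 : ∑ k ∈ ({s - r, r - s} : Finset ℤ), ((1 / 2 : ℚ) * ((if |k| = s - r then 1 else 0) +
      (if |k| = r - s then 1 else 0))) = 1 := by
    rcases lt_trichotomy r s with h | rfl | h
    · rw [Finset.sum_pair (by omega), abs_of_pos (by omega : 0 < s - r),
        abs_of_neg (by omega : r - s < 0), if_pos rfl, if_neg (by omega), if_pos (by omega),
        if_neg (by omega)]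
      norm_num
    · simp
      norm_num
    · rw [Finset.sum_pair (by omega), abs_of_pos (by omega : 0 < r - s),
        abs_of_neg (by omega : s - r < 0), if_neg (by omega), if_pos (by omega),
        if_neg (by omega), if_pos rfl]
      norm_num
  have hs2 : lfsum (fun k => normalProd ψ ψs a (k + r) a (k + s)) =
      heisCurrent ψ ψs a (r - s) := by
    have hh := H.locFin_normalProd a a (r - s) 0
    rw [heisCurrent, current, ← lfsum_comp (H.locFin_current _ a a _) (Equiv.addRight s)]
    congr 1
    ext1 k
    rw [one_smul]
    simp only [Equiv.coe_addRight, show k + s + (r - s) = k + r by ring]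
  rw [hs1, hs2]
  split_ifs with h
  · subst h
    rw [sum_half_indicator, one_smul, one_mul]
    module
  · simp only [Finset.sum_const_zero, zero_smul, one_smul, one_mul]
    module

end IsFermion
end Energy

/-! ### Sugawara energy against fermionic energy -/

section Energy
variable {ι V : Type*} [DecidableEq ι] [AddCommGroup V] [Module ℚ V]
  {ψ ψs : ι → ℤ → Module.End ℚ V}

namespace IsFermion

/-- Each summand of $h(0)$ is, up to a scalar, a product of two fermions of colour $a$, so the two
signs cancel. -/
lemma heis_zero_comm_of_anti (H : IsFermion ψ ψs) (a : ι) (X : Module.End ℚ V)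
    (h1 : ∀ s, X * ψ a s = -(ψ a s * X)) (h2 : ∀ s, X * ψs a s = -(ψs a s * X)) :
    heisCurrent ψ ψs a 0 * X = X * heisCurrent ψ ψs a 0 := by
  rw [← sub_eq_zero, heisCurrent, current, lfsum_comm (H.locFin_current _ a a 0)]
  refine (congrArg lfsum (funext fun r => ?_)).trans lfsum_zero
  rw [smul_mul_assoc, mul_smul_comm, ← smul_sub, normalProd, sub_mul, mul_sub, mul_smul_comm,
    smul_mul_assoc, mul_one, one_mul, ← mul_assoc X, h1, neg_mul, mul_assoc _ X, h2]
  simp [mul_assoc]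

lemma heis_zero_comm_sugawara (H : IsFermion ψ ψs) (a : ι) :
    heisCurrent ψ ψs a 0 * sugawara (heisCurrent ψ ψs a) =
      sugawara (heisCurrent ψ ψs a) * heisCurrent ψ ψs a 0 := by
  rw [sugawara, lfsum_mul (H.locFin_sugawara a), mul_lfsum (H.locFin_sugawara a)]
  congr 1
  ext1 k
  rw [mul_smul_comm, smul_mul_assoc, ← mul_assoc, heis_comm_heis_zero H, mul_assoc,
    heis_comm_heis_zero H, mul_assoc]

/-- A charge argument. By the two anticommutators above, $X=[L,\psi_r]+(r+\frac12)\psi_r$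
anticommutes with all fermions of its colour, so it commutes with the charge $h(0)$. But $h(0)$
commutes with $L$ and satisfies $[h(0),\psi_r]=\psi_r$, so that $[h(0),X]=X$. Hence $X=0$. -/
lemma sugawara_comm_psi (H : IsFermion ψ ψs) (a : ι) (r : ℤ) :
    sugawara (heisCurrent ψ ψs a) * ψ a r - ψ a r * sugawara (heisCurrent ψ ψs a) =
      -(r + 1 / 2 : ℚ) • ψ a r := by
  rw [neg_smul, ← add_eq_zero_iff_eq_neg]
  set Y := sugawara (heisCurrent ψ ψs a) * ψ a r - ψ a r * sugawara (heisCurrent ψ ψs a) with hY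
  have h1 := H.heis_zero_comm_of_anti a (Y + (r + 1 / 2 : ℚ) • ψ a r) (fun s => by
      rw [add_mul, mul_add, neg_add, H.sugawara_psi_anti_psi, smul_mul_assoc, mul_smul_comm,
        H.anti, smul_neg]) (fun s => by
      rw [← add_eq_zero_iff_eq_neg, add_mul, mul_add, add_add_add_comm,
        H.sugawara_psi_anti_psiStar, smul_mul_assoc, mul_smul_comm, H.car]
      by_cases h : r = s
      · simp only [h, true_and, if_true]; module
      · simp [h])
  have h2 := H.heis_comm_psi a a 0 r
  rw [if_pos rfl, add_zero] at h2
  have h3 : heisCurrent ψ ψs a 0 * Y = Y * heisCurrent ψ ψs a 0 + Y := by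
    rw [hY, mul_sub, sub_mul, ← mul_assoc, ← mul_assoc, H.heis_zero_comm_sugawara, mul_assoc, h2,
      add_mul, mul_assoc (ψ a r), H.heis_zero_comm_sugawara]
    noncomm_ring
  rw [mul_add, add_mul, h3, mul_smul_comm, h2, smul_mul_assoc, smul_add, add_assoc,
    add_right_inj, add_left_comm, add_eq_left] at h1
  exact h1

/-- Particle-hole symmetry reverses the sign of the current, the normal ordering constants absorbing
the anticommutator. The Sugawara energy is quadratic in the current and therefore unchanged, so its
bracket with $\psi^*$ follows from the one with $\psi$. -/
lemma heisCurrent_dual (H : IsFermion ψ ψs) (a : ι) (k : ℤ) :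
    heisCurrent (fun i r => ψs i (-1 - r)) (fun i r => ψ i (-1 - r)) a k =
      -heisCurrent ψ ψs a k := by
  have h := H.locFin_current (fun _ => 1) a a k
  rw [heisCurrent, heisCurrent, current, current, ← lfsum_comp h (Equiv.subLeft (-1 - k)),
    ← lfsum_neg (h.comp _)]
  congr 1
  ext1 r
  simp only [one_smul, normalProd, Equiv.subLeft_apply]
  rw [H.car, show -1 - k - r + k = -1 - r by ring, show -1 - (r + k) = -1 - k - r by ring]
  by_cases hk : k = 0
  · by_cases hr : 0 ≤ r
    · have hr' : ¬ r ≤ -1 := by omega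
      simp [hk, hr, hr']
    · have hr' : r ≤ -1 := by omega
      simp [hk, hr, hr']
  · have h1 : ¬ -1 - r = -1 - k - r := by omega
    simp [hk, h1]

lemma sugawara_comm_psiStar (H : IsFermion ψ ψs) (a : ι) (r : ℤ) :
    sugawara (heisCurrent ψ ψs a) * ψs a r - ψs a r * sugawara (heisCurrent ψ ψs a) =
      (r + 1 / 2 : ℚ) • ψs a r := by
  have h := H.dual.sugawara_comm_psi a (-1 - r)
  have h1 : sugawara (heisCurrent (fun i r => ψs i (-1 - r)) (fun i r => ψ i (-1 - r)) a) =
      sugawara (heisCurrent ψ ψs a) := by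
    simp only [sugawara, H.heisCurrent_dual, neg_mul_neg]
  rw [h1, sub_sub_cancel] at h
  rw [h]
  congr 1
  push_cast
  ring

/-- The Sugawara energy of one colour plus its fermionic energy commutes with all fermions. -/
lemma energy_comm_psi (H : IsFermion ψ ψs) (a b : ι) (s : ℤ) :
    Commute (sugawara (heisCurrent ψ ψs a) + current ψ ψs (fun r => r + 1 / 2) a a 0) (ψ b s) := by
  have h2 := H.current_comm_psi (fun r => r + 1 / 2) a a b 0 s
  rw [add_zero] at h2
  rw [Commute, SemiconjBy, add_mul, mul_add, ← sub_eq_zero, add_sub_add_comm, h2]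
  split_ifs with h
  · subst h
    rw [H.sugawara_comm_psi]
    module
  · rw [add_zero, sugawara, lfsum_comm (H.locFin_sugawara a)]
    refine (congrArg lfsum (funext fun r => ?_)).trans lfsum_zero
    have h3 : ∀ k, heisCurrent ψ ψs a k * ψ b s = ψ b s * heisCurrent ψ ψs a k := fun k => by
      rw [H.heis_comm_psi, if_neg h, add_zero]
    rw [smul_mul_assoc, mul_smul_comm, mul_assoc, h3, ← mul_assoc, h3, mul_assoc, sub_self]

lemma energy_comm_psiStar (H : IsFermion ψ ψs) (a b : ι) (s : ℤ) :
    Commute (sugawara (heisCurrent ψ ψs a) + current ψ ψs (fun r => r + 1 / 2) a a 0) (ψs b s) := by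
  have h2 := H.current_comm_psiStar (fun r => r + 1 / 2) a a b 0 s
  rw [sub_zero] at h2
  rw [Commute, SemiconjBy, add_mul, mul_add, ← sub_eq_zero, add_sub_add_comm, h2]
  split_ifs with h
  · subst h
    rw [H.sugawara_comm_psiStar]
    module
  · rw [neg_zero, add_zero, sugawara, lfsum_comm (H.locFin_sugawara a)]
    refine (congrArg lfsum (funext fun r => ?_)).trans lfsum_zero
    have h3 : ∀ k, heisCurrent ψ ψs a k * ψs b s = ψs b s * heisCurrent ψ ψs a k := fun k => by
      rw [H.heis_comm_psiStar, if_neg h, sub_zero]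
    rw [smul_mul_assoc, mul_smul_comm, mul_assoc, h3, ← mul_assoc, h3, mul_assoc, sub_self]

/-- A vector killed by `ψ_{i,r}` for `r ≥ 0` and by `ψ*_{j,r}` for `r < 0` is killed by the currents
that do not lower the mode. -/
lemma current_vacuum (H : IsFermion ψ ψs) {w : V} (h1 : ∀ i r, 0 ≤ r → ψ i r w = 0)
    (h2 : ∀ i r, r < 0 → ψs i r w = 0) (f : ℤ → ℚ) (i j : ι) {k : ℤ} (hk : 0 ≤ k) :
    current ψ ψs f i j k w = 0 := by
  rw [current, (H.locFin_current f i j k).lfsum_apply]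
  refine finsum_eq_zero_of_forall_eq_zero fun r => ?_
  rw [LinearMap.smul_apply]
  convert smul_zero _
  rcases lt_or_ge r 0 with h | h
  · rw [normalProd, if_neg (by omega)]
    simp [h2 j r h]
  · have h4 : normalProd ψ ψs i (r + k) j r = -(ψs j r * ψ i (r + k)) := by
      rw [normalProd, H.car]
      simp only [h, and_true]
      split_ifs <;> simp
    rw [h4]
    simp [h1 i (r + k) (by omega)]

lemma sugawara_vacuum (H : IsFermion ψ ψs) {w : V} (h1 : ∀ i r, 0 ≤ r → ψ i r w = 0)
    (h2 : ∀ i r, r < 0 → ψs i r w = 0) (a : ι) : sugawara (heisCurrent ψ ψs a) w = 0 := by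
  rw [sugawara, (H.locFin_sugawara a).lfsum_apply]
  refine finsum_eq_zero_of_forall_eq_zero fun k => ?_
  simp [heisCurrent, H.current_vacuum h1 h2 _ a a (abs_nonneg k)]

end IsFermion
end Energy

/-! ### The exterior algebra as a fermionic Fock space -/

section FermionFock
variable (n : ℕ)

/-- The fermionic Fock space: the exterior algebra on the elementary excitations of the Dirac sea. -/
abbrev FermiFock := ExteriorAlgebra ℚ ((Fin (n + 1) × ℤ) →₀ ℚ)

variable {n}

/-- Exterior multiplication by a basis vector. -/
def wedge (A : Fin (n + 1) × ℤ) : Module.End ℚ (FermiFock n) :=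
  LinearMap.mulLeft ℚ (ExteriorAlgebra.ι ℚ (Finsupp.single A 1))

/-- Contraction with a dual basis vector. -/
def contract (A : Fin (n + 1) × ℤ) : Module.End ℚ (FermiFock n) :=
  CliffordAlgebra.contractLeft (Finsupp.lapply A)

/-- The fermion `ψ_{i,r}`: it creates for `r < 0` and annihilates for `r ≥ 0`. -/
def psi (i : Fin (n + 1)) (r : ℤ) : Module.End ℚ (FermiFock n) :=
  if r < 0 then wedge (i, r) else contract (i, r)

/-- The fermion `ψ*_{i,r}`: it annihilates for `r < 0` and creates for `r ≥ 0`. -/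
def psiStar (i : Fin (n + 1)) (r : ℤ) : Module.End ℚ (FermiFock n) :=
  if r < 0 then contract (i, r) else wedge (i, r)

lemma wedge_anti (A B : Fin (n + 1) × ℤ) :
    (wedge A * wedge B : Module.End ℚ (FermiFock n)) = -(wedge B * wedge A) := by
  have h := ExteriorAlgebra.ι_add_mul_swap (R := ℚ) (Finsupp.single A (1 : ℚ)) (Finsupp.single B 1)
  rw [← add_eq_zero_iff_eq_neg]
  refine LinearMap.ext fun u => ?_
  simp only [wedge, LinearMap.add_apply, Module.End.mul_apply, LinearMap.mulLeft_apply, ← mul_assoc,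
    ← add_mul, h, zero_mul, LinearMap.zero_apply]

lemma contract_anti (A B : Fin (n + 1) × ℤ) :
    (contract A * contract B : Module.End ℚ (FermiFock n)) = -(contract B * contract A) := by
  refine LinearMap.ext fun u => ?_
  exact CliffordAlgebra.contractLeft_comm _ _ _

lemma contract_wedge (A B : Fin (n + 1) × ℤ) :
    (contract A * wedge B : Module.End ℚ (FermiFock n)) =
      (if B = A then 1 else 0) - wedge B * contract A := by
  refine LinearMap.ext fun u => ?_
  refine (CliffordAlgebra.contractLeft_ι_mul _ _ _).trans ?_
  rw [Finsupp.lapply_apply, Finsupp.single_apply]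
  split_ifs <;> simp [wedge, contract]

lemma contract_one (A : Fin (n + 1) × ℤ) : contract A (1 : FermiFock n) = 0 :=
  CliffordAlgebra.contractLeft_one _ _

lemma fermiFock_induction {P : FermiFock n → Prop} (h1 : P 1) (h0 : P 0)
    (hadd : ∀ u w, P u → P w → P (u + w)) (hs : ∀ (c : ℚ) u, P u → P (c • u))
    (hw : ∀ A u, P u → P (wedge A u)) (u : FermiFock n) : P u := by
  induction u using CliffordAlgebra.left_induction with
  | algebraMap r => rw [Algebra.algebraMap_eq_smul_one]; exact hs _ _ h1
  | add u w hu hw => exact hadd _ _ hu hw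
  | ι_mul u m hu =>
    induction m using Finsupp.induction_linear with
    | zero => rw [map_zero, zero_mul]; exact h0
    | add m m' hm hm' => rw [map_add, add_mul]; exact hadd _ _ hm hm'
    | single A c =>
      have := hs c _ (hw A _ hu)
      rwa [wedge, LinearMap.mulLeft_apply, ← smul_mul_assoc, ← map_smul, Finsupp.smul_single,
        smul_eq_mul, mul_one] at this

/-- The vacuum is killed by every contraction, and one exterior multiplication enlarges the set of
nonvanishing contractions by at most one index. This yields the finiteness axioms of `IsFermion`. -/
lemma contract_finite (u : FermiFock n) : {A | contract A u ≠ 0}.Finite := by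
  induction u using fermiFock_induction with
  | h1 => simp [contract_one]
  | h0 => simp
  | hadd u w hu hw =>
    refine (hu.union hw).subset fun A hA => ?_
    by_contra h
    simp only [Set.mem_union, Set.mem_ofPred_eq, not_or, not_not] at h
    exact hA (by rw [map_add, h.1, h.2, add_zero])
  | hs c u hu =>
    refine hu.subset fun A hA h => hA ?_
    rw [map_smul, h, smul_zero]
  | hw B u hu =>
    refine (hu.union (Set.finite_singleton B)).subset fun A hA => ?_
    by_contra h
    simp only [Set.mem_union, Set.mem_ofPred_eq, not_or, not_not, Set.mem_singleton_iff] at h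
    refine hA ?_
    rw [← Module.End.mul_apply, contract_wedge, if_neg (Ne.symm h.2)]
    simp [h.1]

lemma psi_isFermion : IsFermion (psi (n := n)) psiStar where
  anti i r j s := by
    simp only [psi]
    split_ifs
    · exact wedge_anti _ _
    · rw [contract_wedge, if_neg (by simp only [Prod.mk.injEq]; omega)]; simp
    · rw [contract_wedge, if_neg (by simp only [Prod.mk.injEq]; omega)]; simp
    · exact contract_anti _ _
  anti_star i r j s := by
    simp only [psiStar]
    split_ifs
    · exact contract_anti _ _
    · rw [contract_wedge, if_neg (by simp only [Prod.mk.injEq]; omega)]; simp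
    · rw [contract_wedge, if_neg (by simp only [Prod.mk.injEq]; omega)]; simp
    · exact wedge_anti _ _
  car i r j s := by
    simp only [psi, psiStar]
    by_cases hs : s < 0 <;> by_cases hr : r < 0
    · rw [if_pos hs, if_pos hr, contract_wedge]; simp
    · rw [if_pos hs, if_neg hr, if_neg (by omega), contract_anti, zero_sub]
    · rw [if_neg hs, if_pos hr, if_neg (by omega), wedge_anti, zero_sub]
    · rw [if_neg hs, if_neg hr, contract_wedge, sub_sub_eq_add_sub, eq_comm]
      simp only [Prod.mk.injEq, eq_comm (a := j), eq_comm (a := s)]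
      abel
  fin i u := by
    refine ((contract_finite u).preimage (f := fun r => (i, r)) (by simp [Set.InjOn])).subset ?_
    rintro r ⟨h1, h2⟩
    rwa [psi, if_neg (not_lt.mpr h1)] at h2
  fin_star i u := by
    refine ((contract_finite u).preimage (f := fun r => (i, r)) (by simp [Set.InjOn])).subset ?_
    rintro r ⟨h1, h2⟩
    rwa [psiStar, if_pos h1] at h2

lemma psi_one (i : Fin (n + 1)) (r : ℤ) (hr : 0 ≤ r) : psi i r (1 : FermiFock n) = 0 := by
  rw [psi, if_neg (not_lt.mpr hr), contract_one]

lemma psiStar_one (i : Fin (n + 1)) (r : ℤ) (hr : r < 0) : psiStar i r (1 : FermiFock n) = 0 := by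
  rw [psiStar, if_pos hr, contract_one]

/-- Every exterior multiplication by a basis vector is one of the fermion modes, and these generate
the whole space from the vacuum. -/
lemma eq_zero_of_commute_fermions {T : Module.End ℚ (FermiFock n)} (h1 : T 1 = 0)
    (h : ∀ i r, Commute T (psi i r)) (hs : ∀ i r, Commute T (psiStar i r)) : T = 0 := by
  have hw : ∀ A, Commute T (wedge A) := by
    rintro ⟨i, r⟩
    by_cases hr : r < 0
    · simpa [psi, hr] using h i r
    · simpa [psiStar, hr] using hs i r
  refine LinearMap.ext fun u => ?_
  induction u using fermiFock_induction with
  | h1 => simpa using h1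
  | h0 => simp
  | hadd u w hu hw => simp [hu, hw]
  | hs c u hu => simp [hu]
  | hw A u hu =>
    rw [← Module.End.mul_apply, hw A, Module.End.mul_apply, hu]; simp

/-- The bosonic energy of each colour is the fermionic one. -/
lemma sugawara_eq (a : Fin (n + 1)) :
    sugawara (heisCurrent (psi (n := n)) psiStar a) + current psi psiStar (fun r => r + 1 / 2) a a 0 = 0 := by
  refine eq_zero_of_commute_fermions ?_ (fun i r => psi_isFermion.energy_comm_psi a i r)
    fun i r => psi_isFermion.energy_comm_psiStar a i r
  rw [LinearMap.add_apply, psi_isFermion.sugawara_vacuum psi_one psiStar_one,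
    psi_isFermion.current_vacuum psi_one psiStar_one _ _ _ le_rfl, add_zero]

end FermionFock

lemma end_smul_sub_smul {V : Type*} [AddCommGroup V] [Module ℚ V] (c : ℚ) (A B : Module.End ℚ V) :
    c • A - c • B = c • (A - B) :=
  (smul_sub c A B).symm

/-! ### The level one action of the affine algebra on fermions -/

section FermionRep
variable {n : ℕ}

/-- The action of `x t^k` on the fermionic Fock space. -/
def fermiMode (k : ℤ) : Gl n →ₗ[ℚ] Module.End ℚ (FermiFock n) :=
  ∑ i, ∑ j, (Matrix.entryLinearMap ℚ ℚ i j).smulRight (current psi psiStar (fun _ => 1) i j k)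

lemma fermiMode_single (k : ℤ) (i j : Fin (n + 1)) (c : ℚ) :
    fermiMode k (Matrix.single i j c) = c • current psi psiStar (fun _ => 1) i j k := by
  simp only [fermiMode, LinearMap.sum_apply, LinearMap.smulRight_apply,
    Matrix.entryLinearMap_apply, Matrix.single_apply]
  rw [Finset.sum_eq_single i, Finset.sum_eq_single j]
  · simp
  · intro b _ hb; simp [hb.symm]
  · simp
  · intro b _ hb; simp [hb.symm]
  · simp

/-- The energy operator on the fermionic Fock space. -/
def fermiEnergy : Module.End ℚ (FermiFock n) :=
  ∑ i, current psi psiStar (fun r => (r : ℚ)) i i 0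

lemma sum_Ico_indicator (k : ℤ) :
    ∑ r ∈ Finset.Ico (min 0 k) (max 0 k),
      ((if 0 ≤ r then 1 else 0) - (if k ≤ r then 1 else 0) : ℚ) = k := by
  rcases le_or_gt 0 k with h | h
  · rw [min_eq_left h, max_eq_right h, Finset.sum_congr rfl (g := fun _ => (1 : ℚ))]
    · rw [Finset.sum_const, Int.card_Ico, nsmul_eq_mul, mul_one, sub_zero]
      exact_mod_cast Int.toNat_of_nonneg h
    · intro r hr
      rw [Finset.mem_Ico] at hr
      rw [if_pos hr.1, if_neg (by omega), sub_zero]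
  · rw [min_eq_right h.le, max_eq_left h.le, Finset.sum_congr rfl (g := fun _ => (-1 : ℚ))]
    · rw [Finset.sum_const, Int.card_Ico, nsmul_eq_mul, zero_sub]
      have : ((-k).toNat : ℚ) = -k := by exact_mod_cast Int.toNat_of_nonneg (by omega : 0 ≤ -k)
      rw [this]; ring
    · intro r hr
      rw [Finset.mem_Ico] at hr
      rw [if_neg (by omega), if_pos hr.1, zero_sub]

/-- By bilinearity it suffices to take matrix units, where this is `current_comm_current` with
constant weights. The central sum is then the signed length $k$ of the interval from $0$ to $k$, so
the level is one. -/
lemma fermiMode_comm (x y : Gl n) (k l : ℤ) :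
    fermiMode k x * fermiMode l y - fermiMode l y * fermiMode k x =
      fermiMode (k + l) (x * y - y * x) +
        (if k + l = 0 then (k : ℚ) * (x * y).trace else 0) • 1 := by
  induction x using Matrix.induction_on' with
  | h_zero => simp
  | h_add x x' hx hx' =>
    have e : (x + x') * y - y * (x + x') = (x * y - y * x) + (x' * y - y * x') := by noncomm_ring
    rw [e, map_add, map_add, add_mul, mul_add, add_sub_add_comm, hx, hx', add_mul x x' y,
      Matrix.trace_add]
    split_ifs <;> module
  | h_std_basis i j c =>
    induction y using Matrix.induction_on' with
    | h_zero => simp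
    | h_add y y' hy hy' =>
      have e : Matrix.single i j c * (y + y') - (y + y') * Matrix.single i j c =
        (Matrix.single i j c * y - y * Matrix.single i j c) +
          (Matrix.single i j c * y' - y' * Matrix.single i j c) := by noncomm_ring
      rw [e, map_add, map_add, add_mul, mul_add, add_sub_add_comm, hy, hy', mul_add _ y y',
        Matrix.trace_add]
      split_ifs <;> module
    | h_std_basis l' m d =>
      rw [fermiMode_single, fermiMode_single, smul_mul_smul_comm, smul_mul_smul_comm, mul_comm d,
        end_smul_sub_smul, psi_isFermion.current_comm_current, map_sub]
      simp only [mul_one, one_mul, sum_Ico_indicator]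
      have h1 : fermiMode (k + l) (Matrix.single i j c * Matrix.single l' m d) =
          if j = l' then (c * d) • current psi psiStar (fun _ => 1) i m (k + l) else 0 := by
        split_ifs with h
        · subst h
          rw [Matrix.single_mul_single_same, fermiMode_single]
        · rw [Matrix.single_mul_single_of_ne _ _ _ _ h, map_zero]
      have h2 : fermiMode (k + l) (Matrix.single l' m d * Matrix.single i j c) =
          if i = m then (c * d) • current psi psiStar (fun _ => 1) l' j (k + l) else 0 := by
        split_ifs with h
        · subst h
          rw [Matrix.single_mul_single_same, fermiMode_single, mul_comm]
        · rw [Matrix.single_mul_single_of_ne _ _ _ _ (Ne.symm h), map_zero]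
      have h3 : (Matrix.single i j c * Matrix.single l' m d).trace =
          if j = l' ∧ i = m then c * d else 0 := by
        by_cases h : j = l'
        · subst h
          rw [Matrix.single_mul_single_same]
          by_cases h' : i = m
          · subst h'; simp
          · rw [Matrix.trace_single_eq_of_ne _ _ _ h']; simp [h']
        · rw [Matrix.single_mul_single_of_ne _ _ _ _ h]; simp [h]
      rw [h1, h2, h3]
      by_cases a1 : j = l' <;> by_cases a2 : i = m <;> by_cases a3 : k + l = 0 <;>
        simp [a1, a2, a3, smul_sub, smul_add, smul_smul, mul_comm]

/-- The energy contributes the weight $r+k$ on the side of $\psi_{r+k}$ and $r$ on the side of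
$\psi^*_r$; the difference is the constant $k$. -/
lemma fermiEnergy_comm (x : Gl n) (k : ℤ) :
    fermiEnergy * fermiMode k x - fermiMode k x * fermiEnergy = (k : ℚ) • fermiMode k x := by
  induction x using Matrix.induction_on' with
  | h_zero => simp
  | h_add x x' hx hx' =>
    rw [map_add, mul_add, add_mul, add_sub_add_comm, hx, hx', smul_add]
  | h_std_basis i j c =>
    rw [fermiMode_single, mul_smul_comm, smul_mul_assoc, end_smul_sub_smul, smul_comm]
    congr 1
    have h : ∀ l, current psi psiStar (fun r => (r : ℚ)) l l 0 *
        current psi psiStar (fun _ => 1) i j k - current psi psiStar (fun _ => 1) i j k *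
          current (psi (n := n)) psiStar (fun r => (r : ℚ)) l l 0 =
        (if l = i then current psi psiStar (fun r => ((r + k : ℤ) : ℚ)) i j k else 0) -
          if l = j then current psi psiStar (fun r => (r : ℚ)) i j k else 0 := by
      intro l
      rw [psi_isFermion.current_comm_current]
      simp only [mul_one, zero_add, min_self, max_self, Finset.Ico_self, Finset.sum_empty, ite_self,
        zero_smul, add_zero]
      split_ifs with h1 h2 h2 <;> simp_all
    rw [fermiEnergy, Finset.sum_mul, Finset.mul_sum, ← Finset.sum_sub_distrib,
      Finset.sum_congr rfl fun l _ => h l, Finset.sum_sub_distrib]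
    simp only [Finset.sum_ite_eq', Finset.mem_univ, if_true]
    have H := psi_isFermion (n := n)
    rw [current, current, current, ← lfsum_sub (H.locFin_current _ i j k) (H.locFin_current _ i j k),
      ← lfsum_smul (H.locFin_current _ i j k)]
    congr 1
    ext1 r
    push_cast
    module

/-- The action of the affine Lie algebra on the fermionic Fock space. -/
def fermiRepLin : AffineGl n →ₗ[ℚ] Module.End ℚ (FermiFock n) where
  toFun x := Finsupp.lsum ℚ fermiMode x.loop + x.c • 1 + x.d • fermiEnergy
  map_add' x y := by
    simp only [AffineGl.add_loop, AffineGl.add_c, AffineGl.add_d, map_add]; module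
  map_smul' r x := by
    simp only [AffineGl.smul_loop, AffineGl.smul_c, AffineGl.smul_d, map_smul, RingHom.id_apply]
    module

lemma fermiRep_loop_comm (u v : LoopGl n) :
    Finsupp.lsum ℚ fermiMode u * Finsupp.lsum ℚ fermiMode v -
      Finsupp.lsum ℚ fermiMode v * Finsupp.lsum ℚ fermiMode u =
      Finsupp.lsum ℚ fermiMode (loopBracket n u v) +
        loopCocycle n u v • (1 : Module.End ℚ (FermiFock n)) := by
  induction u using Finsupp.induction_linear with
  | zero => simp
  | add u u' hu hu' =>
    simp only [map_add, LinearMap.add_apply, add_mul, mul_add, add_smul]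
    rw [add_sub_add_comm, hu, hu']; abel
  | single k x =>
    induction v using Finsupp.induction_linear with
    | zero => simp
    | add v v' hv hv' =>
      simp only [map_add, add_mul, mul_add, add_smul]
      rw [add_sub_add_comm, hv, hv']; abel
    | single l y =>
      rw [loopBracket_single, loopCocycle_single]
      simp only [Finsupp.lsum_single]
      exact fermiMode_comm x y k l

lemma fermiRep_energy_comm (u : LoopGl n) :
    fermiEnergy * Finsupp.lsum ℚ fermiMode u - Finsupp.lsum ℚ fermiMode u * fermiEnergy =
      (Finsupp.lsum ℚ fermiMode (loopEuler n u) : Module.End ℚ (FermiFock n)) := by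
  induction u using Finsupp.induction_linear with
  | zero => simp
  | add u u' hu hu' =>
    simp only [map_add, add_mul, mul_add]
    rw [add_sub_add_comm, hu, hu']
  | single k x =>
    rw [loopEuler_single, map_smul]
    simp only [Finsupp.lsum_single]
    exact fermiEnergy_comm x k

lemma fermiRep_lie (x y : AffineGl n) :
    fermiRepLin ⁅x, y⁆ = fermiRepLin x * fermiRepLin y - fermiRepLin y * fermiRepLin x := by
  have h1 := fermiRep_loop_comm x.loop y.loop
  have h2 := fermiRep_energy_comm x.loop
  have h3 := fermiRep_energy_comm y.loop
  simp only [fermiRepLin, LinearMap.coe_mk, AddHom.coe_mk, AffineGl.lie_loop, AffineGl.lie_c,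
    AffineGl.lie_d, map_add, map_sub, map_smul, zero_smul, add_zero]
  rw [← h2, ← h3]
  rw [← sub_eq_iff_eq_add] at h1
  rw [← h1]
  simp only [add_mul, mul_add, smul_mul_assoc, mul_smul_comm, one_mul, mul_one]
  module

/-- The action of the universal enveloping algebra on the fermionic Fock space. -/
def fermiRep : UAff n →ₐ[ℚ] Module.End ℚ (FermiFock n) :=
  letI : LieRing (Module.End ℚ (FermiFock n)) := LieRing.ofAssociativeRing
  letI : LieAlgebra ℚ (Module.End ℚ (FermiFock n)) := LieAlgebra.ofAssociativeAlgebra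
  UniversalEnvelopingAlgebra.lift ℚ
    { fermiRepLin with map_lie' := fun {x y} => fermiRep_lie x y }

lemma fermiRep_ι (x : AffineGl n) :
    fermiRep (UniversalEnvelopingAlgebra.ι ℚ x) = fermiRepLin x := by
  let : LieRing (Module.End ℚ (FermiFock n)) := LieRing.ofAssociativeRing
  let : LieAlgebra ℚ (Module.End ℚ (FermiFock n)) := LieAlgebra.ofAssociativeAlgebra
  exact UniversalEnvelopingAlgebra.lift_ι_apply ℚ _ _

lemma fermiRep_mode (x : Gl n) (k : ℤ) :
    fermiRep (UniversalEnvelopingAlgebra.ι ℚ (AffineGl.mode x k)) = fermiMode k x := by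
  rw [fermiRep_ι]
  simp [fermiRepLin, AffineGl.mode]

lemma fermiRep_central :
    fermiRep (UniversalEnvelopingAlgebra.ι ℚ (AffineGl.central n)) = 1 := by
  rw [fermiRep_ι]
  simp [fermiRepLin, AffineGl.central]

lemma fermiRep_degree :
    fermiRep (UniversalEnvelopingAlgebra.ι ℚ (AffineGl.degree n)) = fermiEnergy := by
  rw [fermiRep_ι]
  simp [fermiRepLin, AffineGl.degree]

lemma fermiRep_vacuumIdeal {u : UAff n} (hu : u ∈ vacuumIdeal n) : fermiRep u 1 = 0 := by
  have H := psi_isFermion (n := n)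
  induction hu using Submodule.span_induction with
  | mem u hu =>
    rcases hu with ⟨x, k, hk, rfl⟩ | rfl | rfl
    · rw [fermiRep_mode]
      simp [fermiMode, H.current_vacuum psi_one psiStar_one _ _ _ hk]
    · rw [map_sub, fermiRep_central, map_one fermiRep, sub_self, LinearMap.zero_apply]
    · rw [fermiRep_degree]
      simp [fermiEnergy, H.current_vacuum psi_one psiStar_one _ _ _ le_rfl]
  | zero => simp
  | add u w _ _ hu hw => simp [hu, hw]
  | smul a u _ hu => simp [hu]

/-- The vector of the fermionic Fock space given by an element of the vacuum module. -/
def vacuumToFermi : VacuumModule n →ₗ[ℚ] FermiFock n :=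
  (((vacuumIdeal n).restrictScalars ℚ).liftQ ((LinearMap.applyₗ (1 : FermiFock n)) ∘ₗ fermiRep.toLinearMap)
    fun _ hu => fermiRep_vacuumIdeal hu :)

lemma vacuumToFermi_mkQ (u : UAff n) : vacuumToFermi ((vacuumIdeal n).mkQ u) = fermiRep u 1 := rfl

lemma vacuumToFermi_smul (a : UAff n) (w : VacuumModule n) :
    vacuumToFermi (a • w) = fermiRep a (vacuumToFermi w) := by
  obtain ⟨u, rfl⟩ := (vacuumIdeal n).mkQ_surjective w
  rw [← map_smul, vacuumToFermi_mkQ, vacuumToFermi_mkQ, smul_eq_mul, map_mul]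
  rfl

end FermionRep

/-- Subtracting from an eigenvector its component in $p_i$ leaves a vector that lies both in the
$\mu_i$-eigenspace and in the sum of the others, hence zero by independence of eigenspaces. -/
lemma eigenspace_le_of_iSup_eq_top {K V I : Type*} [Field K] [AddCommGroup V] [Module K V]
    {f : Module.End K V} {μ : I → K} (hμ : Function.Injective μ) {p : I → Submodule K V}
    (hp : ∀ i, p i ≤ f.eigenspace (μ i)) (htop : ⨆ i, p i = ⊤) (i : I) :
    f.eigenspace (μ i) ≤ p i := by
  intro w hw
  have h1 : w ∈ p i ⊔ ⨆ (j) (_ : j ≠ i), p j := by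
    have h2 : ⨆ i, p i ≤ p i ⊔ ⨆ (j) (_ : j ≠ i), p j := by
      refine iSup_le fun j => ?_
      by_cases h : j = i
      · subst h; exact le_sup_left
      · exact le_sup_of_le_right (le_iSup₂_of_le j h le_rfl)
    exact h2 (htop ▸ Submodule.mem_top)
  obtain ⟨a, ha, b, hb, rfl⟩ := Submodule.mem_sup.mp h1
  have hd := (f.eigenspaces_iSupIndep.comp hμ) i
  have hb' : b ∈ ⨆ (j) (_ : j ≠ i), f.eigenspace (μ j) := (iSup₂_mono fun j _ => hp j) hb
  have hb'' : b ∈ f.eigenspace (μ i) := by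
    simpa using Submodule.sub_mem _ hw (hp i ha)
  rw [Submodule.disjoint_def.mp hd b hb'' hb', add_zero]
  exact ha

/-! ### Energy decomposition of highest weight modules -/

section HighestWeight
variable {n : ℕ} {M : Type*} [AddCommGroup M] [Module (UAff n) M]

/-- The inclusion of the affine Lie algebra into its enveloping algebra, as a linear map. -/
def ue : AffineGl n →ₗ[ℚ] UAff n where
  toFun x := UniversalEnvelopingAlgebra.ι ℚ x
  map_add' x y := map_add _ x y
  map_smul' r x := map_smul _ r x

lemma ue_apply (x : AffineGl n) : ue x = UniversalEnvelopingAlgebra.ι ℚ x := rfl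

lemma ue_lie (x y : AffineGl n) : ue ⁅x, y⁆ = ue x * ue y - ue y * ue x := by
  let : LieRing (UAff n) := LieRing.ofAssociativeRing
  let : LieAlgebra ℚ (UAff n) := LieAlgebra.ofAssociativeAlgebra
  rw [ue_apply, LieHom.map_lie, LieRing.of_associative_ring_bracket]
  rfl

lemma ue_smul_ue_smul (x y : AffineGl n) (w : M) :
    ue x • ue y • w = ue y • ue x • w + ue ⁅x, y⁆ • w := by
  rw [ue_lie, sub_smul, mul_smul, mul_smul]
  abel

/-- The relations of a highest weight vector of weight `Λ`. -/
structure IsVacuum (n : ℕ) {M : Type*} [AddCommGroup M] [Module (UAff n) M] (v : M) : Prop where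
  mode (x : Gl n) (k : ℤ) : 0 ≤ k → ue (AffineGl.mode x k) • v = 0
  central : ue (AffineGl.central n) • v = v
  degree : ue (AffineGl.degree n) • v = 0

/-- The vectors obtained from `v` by applying lowering modes, with their energies. -/
inductive LoweringWord (n : ℕ) {M : Type*} [AddCommGroup M] [Module (UAff n) M] (v : M) : ℕ → M → Prop
  | vac : LoweringWord n v 0 v
  | cons (x : Gl n) (k m : ℕ) (w : M) : LoweringWord n v m w →
      LoweringWord n v (m + (k + 1)) (ue (AffineGl.mode x (-(k + 1 : ℕ))) • w)

lemma LoweringWord.central {v : M} (hv : IsVacuum n v) {m : ℕ} {w : M} (hw : LoweringWord n v m w) :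
    ue (AffineGl.central n) • w = w := by
  induction hw with
  | vac => exact hv.central
  | cons x k m w _ ih =>
    rw [ue_smul_ue_smul, AffineGl.central_lie, ih, map_zero, zero_smul, add_zero]

variable [Module ℚ M]

/-- The span of the lowering words of a given energy. -/
def energySpan (n : ℕ) {M : Type*} [AddCommGroup M] [Module (UAff n) M] [Module ℚ M]
    (v : M) (z : ℤ) : Submodule ℚ M :=
  Submodule.span ℚ {w | ∃ m : ℕ, (m : ℤ) = z ∧ LoweringWord n v m w}

lemma energySpan_of_neg (v : M) {z : ℤ} (hz : z < 0) : energySpan n v z = ⊥ := by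
  rw [energySpan, Submodule.span_eq_bot]
  rintro w ⟨m, rfl, -⟩
  omega

lemma energySpan_zero (v : M) : energySpan n v 0 = Submodule.span ℚ {v} := by
  rw [energySpan]
  congr 1
  ext w
  constructor
  · rintro ⟨m, hm, hw⟩
    cases hw with
    | vac => rfl
    | cons => omega
  · rintro rfl
    exact ⟨0, rfl, .vac⟩

variable [IsScalarTower ℚ (UAff n) M]

/-- The operator `d`. -/
def degreeEnd (n : ℕ) (M : Type*) [AddCommGroup M] [Module (UAff n) M] [Module ℚ M]
    [IsScalarTower ℚ (UAff n) M] : Module.End ℚ M :=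
  Algebra.lsmul ℚ ℚ M (ue (AffineGl.degree n))

lemma degreeEnd_apply (w : M) : degreeEnd n M w = ue (AffineGl.degree n) • w := rfl

lemma smul_mem_of_span {p q : Set M} {a : UAff n} (h : ∀ w ∈ p, a • w ∈ Submodule.span ℚ q) {w : M}
    (hw : w ∈ Submodule.span ℚ p) : a • w ∈ Submodule.span ℚ q := by
  have : Submodule.span ℚ p ≤ (Submodule.span ℚ q).comap (Algebra.lsmul ℚ ℚ M a) :=
    Submodule.span_le.mpr h
  exact this hw

lemma lowering_mem_energySpan {v : M} (x : Gl n) (k : ℕ) {z : ℤ} {w : M} (hw : w ∈ energySpan n v z) :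
    ue (AffineGl.mode x (-(k + 1 : ℕ))) • w ∈ energySpan n v (z + (k + 1 : ℕ)) := by
  refine smul_mem_of_span (p := {w | ∃ m : ℕ, (m : ℤ) = z ∧ LoweringWord n v m w}) (fun w hw' => Submodule.subset_span ?_) hw
  obtain ⟨m, rfl, hm⟩ := hw'
  exact ⟨m + (k + 1), by push_cast; ring, hm.cons x k m _⟩

lemma LoweringWord.degree {v : M} (hv : IsVacuum n v) {m : ℕ} {w : M} (hw : LoweringWord n v m w) :
    ue (AffineGl.degree n) • w = (-(m : ℚ)) • w := by
  induction hw with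
  | vac => rw [hv.degree]; simp
  | cons x k m w _ ih =>
    rw [ue_smul_ue_smul, AffineGl.degree_lie_mode, ih,
      smul_algebra_smul_comm (-(m : ℚ)) (ue (AffineGl.mode x _)) w]
    rw [map_smul, smul_assoc, ← add_smul]
    congr 1
    push_cast
    ring

/-- Induction on the word, in place of a full Poincaré-Birkhoff-Witt argument. Moving $x(k)$ past
the leftmost lowering mode leaves one mode of the commutator and a central term, both acting on a
shorter word with the right energy. On $v$ itself a nonnegative mode gives zero and a negative one
is a new letter. -/
lemma LoweringWord.mode {v : M} (hv : IsVacuum n v) {m : ℕ} {w : M} (hw : LoweringWord n v m w)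
    (x : Gl n) (k : ℤ) : ue (AffineGl.mode x k) • w ∈ energySpan n v (m - k) := by
  have neg : ∀ {m : ℕ} {w : M} (_ : w ∈ energySpan n v m) (x : Gl n) (k : ℤ) (_ : k < 0),
      ue (AffineGl.mode x k) • w ∈ energySpan n v (m - k) := by
    intro m w hw x k hk
    obtain ⟨l, rfl⟩ : ∃ l : ℕ, k = -(l + 1 : ℕ) := ⟨(-k - 1).toNat, by omega⟩
    have := lowering_mem_energySpan x l hw
    rwa [sub_neg_eq_add]
  have self : ∀ {m : ℕ} {w : M}, LoweringWord n v m w → w ∈ energySpan n v m := fun {m w} hw =>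
    Submodule.subset_span ⟨m, rfl, hw⟩
  induction hw generalizing x k with
  | vac =>
    rcases lt_or_ge k 0 with h | h
    · exact neg (self .vac) x k h
    · rw [hv.mode x k h]
      exact Submodule.zero_mem _
  | cons y l m w hw ih =>
    rw [ue_smul_ue_smul, AffineGl.mode_lie_mode, map_add, add_smul, map_smul, smul_assoc,
      hw.central hv]
    refine Submodule.add_mem _ ?_ (Submodule.add_mem _ ?_ ?_)
    · have := lowering_mem_energySpan y l (ih x k)
      convert this using 2
      push_cast; ring
    · convert ih (x * y - y * x) (k + -(l + 1 : ℕ)) using 2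
      push_cast; ring
    · split_ifs with h
      · refine Submodule.smul_mem _ _ ?_
        convert self hw using 2
        push_cast at h ⊢; linarith
      · simp

lemma mode_mem_energySpan {v : M} (hv : IsVacuum n v) (x : Gl n) (k : ℤ) {z : ℤ} {w : M}
    (hw : w ∈ energySpan n v z) : ue (AffineGl.mode x k) • w ∈ energySpan n v (z - k) := by
  refine smul_mem_of_span (p := {w | ∃ m : ℕ, (m : ℤ) = z ∧ LoweringWord n v m w}) (fun w hw' => ?_) hw
  obtain ⟨m, rfl, hm⟩ := hw'
  exact hm.mode hv x k

lemma energySpan_le_eigenspace {v : M} (hv : IsVacuum n v) (z : ℤ) :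
    energySpan n v z ≤ (degreeEnd n M).eigenspace (-(z : ℚ)) := by
  refine Submodule.span_le.mpr ?_
  rintro w ⟨m, rfl, hw⟩
  rw [SetLike.mem_coe, Module.End.mem_eigenspace_iff, degreeEnd_apply]
  exact_mod_cast hw.degree hv

/-- The elements satisfying `P` form a subalgebra $S$ containing the Lie algebra. The universal
property gives a map to $S$ whose composite with the inclusion is the identity by uniqueness, so $S$
is everything. -/
lemma ue_induction {P : UAff n → Prop} (hx : ∀ x, P (ue x)) (h1 : ∀ r : ℚ, P (algebraMap ℚ _ r))
    (hadd : ∀ a b, P a → P b → P (a + b)) (hmul : ∀ a b, P a → P b → P (a * b)) (a : UAff n) :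
    P a := by
  let S : Subalgebra ℚ (UAff n) :=
    { carrier := {a | P a}
      add_mem' := hadd _ _
      mul_mem' := hmul _ _
      algebraMap_mem' := h1 }
  let : LieRing (UAff n) := LieRing.ofAssociativeRing
  let : LieAlgebra ℚ (UAff n) := LieAlgebra.ofAssociativeAlgebra
  let : LieRing S := LieRing.ofAssociativeRing
  let : LieAlgebra ℚ S := LieAlgebra.ofAssociativeAlgebra
  let f : AffineGl n →ₗ⁅ℚ⁆ S :=
    { toFun := fun x => ⟨ue x, hx x⟩
      map_add' := fun x y => Subtype.ext (map_add _ x y)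
      map_smul' := fun r x => Subtype.ext (map_smul _ r x)
      map_lie' := fun {x y} => Subtype.ext (ue_lie x y) }
  have h : S.val.comp (UniversalEnvelopingAlgebra.lift ℚ f) = AlgHom.id ℚ _ := by
    apply UniversalEnvelopingAlgebra.hom_ext
    ext1 x
    simp [f]
    rfl
  have h2 := congr($h a)
  have h3 := (UniversalEnvelopingAlgebra.lift ℚ f a).2
  rw [AlgHom.comp_apply] at h2
  change S.val _ ∈ S at h3
  rwa [h2] at h3

/-- The sum of the energy spans contains $v$ and is stable under all modes, under $c$, which acts by
one, and under $d$, which acts by scalars on each summand. Hence it is stable under the enveloping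
algebra. -/
lemma iSup_energySpan {v : M} (hv : IsVacuum n v) (htop : Submodule.span (UAff n) {v} = ⊤) :
    ⨆ z, energySpan n v z = ⊤ := by
  have hclosed : ∀ (a : UAff n), ∀ w ∈ ⨆ z, energySpan n v z,
      a • w ∈ ⨆ z, energySpan n v z := by
    intro a
    induction a using ue_induction with
    | h1 r => intro w hw; rw [algebraMap_smul]; exact Submodule.smul_mem _ _ hw
    | hadd a b ha hb => intro w hw; rw [add_smul]; exact Submodule.add_mem _ (ha w hw) (hb w hw)
    | hmul a b ha hb => intro w hw; rw [mul_smul]; exact ha _ (hb w hw)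
    | hx x =>
      have hx : ∀ u : LoopGl n, ∀ w ∈ ⨆ z, energySpan n v z,
          ue (⟨u, 0, 0⟩ : AffineGl n) • w ∈ ⨆ z, energySpan n v z := by
        intro u w hw
        induction u using Finsupp.induction_linear with
        | zero =>
          have : (⟨0, 0, 0⟩ : AffineGl n) = 0 := rfl
          rw [this, map_zero, zero_smul]
          exact Submodule.zero_mem _
        | add u u' hu hu' =>
          have : (⟨u + u', 0, 0⟩ : AffineGl n) = ⟨u, 0, 0⟩ + ⟨u', 0, 0⟩ := by ext1 <;> simp
          rw [this, map_add, add_smul]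
          exact Submodule.add_mem _ hu hu'
        | single k y =>
          induction hw using Submodule.iSup_induction' with
          | mem z w hw =>
            exact Submodule.mem_iSup_of_mem _ (mode_mem_energySpan hv y k hw)
          | zero => rw [smul_zero]; exact Submodule.zero_mem _
          | add w w' _ _ h h' => rw [smul_add]; exact Submodule.add_mem _ h h'
      have hc : ∀ w ∈ ⨆ z, energySpan n v z, ue (AffineGl.central n) • w = w := by
        intro w hw
        induction hw using Submodule.iSup_induction' with
        | mem z w hw =>
          induction hw using Submodule.span_induction with
          | mem w hw => obtain ⟨m, -, hw⟩ := hw; exact hw.central hv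
          | zero => rw [smul_zero]
          | add w w' _ _ h h' => rw [smul_add, h, h']
          | smul r w _ h => rw [smul_algebra_smul_comm, h]
        | zero => rw [smul_zero]
        | add w w' _ _ h h' => rw [smul_add, h, h']
      have hd : ∀ w ∈ ⨆ z, energySpan n v z,
          ue (AffineGl.degree n) • w ∈ ⨆ z, energySpan n v z := by
        intro w hw
        induction hw using Submodule.iSup_induction' with
        | mem z w hw =>
          have := energySpan_le_eigenspace hv z hw
          rw [Module.End.mem_eigenspace_iff, degreeEnd_apply] at this
          rw [this]
          exact Submodule.smul_mem _ _ (Submodule.mem_iSup_of_mem _ hw)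
        | zero => rw [smul_zero]; exact Submodule.zero_mem _
        | add w w' _ _ h h' => rw [smul_add]; exact Submodule.add_mem _ h h'
      intro w hw
      have : x = ⟨x.loop, 0, 0⟩ + x.c • AffineGl.central n + x.d • AffineGl.degree n := by
        ext1 <;> simp [AffineGl.central, AffineGl.degree]
      rw [this, map_add, map_add, map_smul, map_smul, add_smul, add_smul, smul_assoc, smul_assoc,
        hc w hw]
      exact Submodule.add_mem _ (Submodule.add_mem _ (hx _ w hw) (Submodule.smul_mem _ _ hw))
        (Submodule.smul_mem _ _ (hd w hw))
  rw [eq_top_iff]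
  rintro w -
  have hw : w ∈ Submodule.span (UAff n) {v} := htop ▸ Submodule.mem_top
  obtain ⟨a, rfl⟩ := Submodule.mem_span_singleton.mp hw
  exact hclosed a v (Submodule.mem_iSup_of_mem 0 (by
    rw [energySpan_zero]; exact Submodule.mem_span_singleton_self v))

/-- In a highest weight module an eigenvector of `d` is a combination of words of its energy. -/
lemma eigenspace_le_energySpan {v : M} (hv : IsVacuum n v) (htop : Submodule.span (UAff n) {v} = ⊤)
    (z : ℤ) : (degreeEnd n M).eigenspace (-(z : ℚ)) ≤ energySpan n v z :=
  eigenspace_le_of_iSup_eq_top (μ := fun z : ℤ => -(z : ℚ)) (fun a b h => by simpa using h)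
    (energySpan_le_eigenspace hv) (iSup_energySpan hv htop) z

end HighestWeight

/-! ### The basic representation compared with the fermionic space -/

section BasicRepresentation
variable (n : ℕ)

/-- The generator of the vacuum module. -/
def vacuumVector : VacuumModule n := (vacuumIdeal n).mkQ 1

variable {n}

lemma vacuumVector_isVacuum : IsVacuum n (vacuumVector n) := by
  have key : ∀ a ∈ vacuumIdeal n, a • vacuumVector n = 0 := by
    intro a ha
    rw [vacuumVector, ← map_smul, smul_eq_mul, mul_one]
    exact (Submodule.Quotient.mk_eq_zero _).mpr ha
  refine ⟨fun x k hk => key _ (Submodule.subset_span (Or.inl ⟨x, k, hk, rfl⟩)), ?_,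
    key _ (Submodule.subset_span (Or.inr (Or.inr rfl)))⟩
  have h := key _ (Submodule.subset_span (Or.inr (Or.inl rfl)))
  rwa [sub_smul, one_smul, sub_eq_zero] at h

lemma span_vacuumVector : Submodule.span (UAff n) {vacuumVector n} = ⊤ := by
  rw [eq_top_iff]
  rintro w -
  obtain ⟨a, rfl⟩ := (vacuumIdeal n).mkQ_surjective w
  refine Submodule.mem_span_singleton.mpr ⟨a, ?_⟩
  rw [vacuumVector, ← map_smul, smul_eq_mul, mul_one]

lemma vacuumToFermi_vacuumVector : vacuumToFermi (vacuumVector n) = 1 := by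
  rw [vacuumVector, vacuumToFermi_mkQ, map_one fermiRep]
  rfl

lemma IsVacuum.map {M M' : Type*} [AddCommGroup M] [Module (UAff n) M] [AddCommGroup M']
    [Module (UAff n) M'] {v : M} (hv : IsVacuum n v) (f : M →ₗ[UAff n] M') : IsVacuum n (f v) where
  mode x k hk := by rw [← map_smul, hv.mode x k hk, map_zero]
  central := by rw [← map_smul, hv.central]
  degree := by rw [← map_smul, hv.degree, map_zero]

/-- The sum of the eigenspaces of `d` for nonzero eigenvalues. -/
def excited (M : Type*) [AddCommGroup M] [Module (UAff n) M] [Module ℚ M]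
    [IsScalarTower ℚ (UAff n) M] : Submodule ℚ M :=
  ⨆ (z : ℤ) (_ : z ≠ 0), (degreeEnd n M).eigenspace (-(z : ℚ))

lemma eq_zero_of_mem_excited {M : Type*} [AddCommGroup M] [Module (UAff n) M] [Module ℚ M]
    [IsScalarTower ℚ (UAff n) M] {w : M} (h0 : ue (AffineGl.degree n) • w = 0)
    (hw : w ∈ excited (n := n) M) : w = 0 := by
  have hd := ((degreeEnd n M).eigenspaces_iSupIndep.comp
    (fun a b h => by simpa using h : Function.Injective fun z : ℤ => -(z : ℚ))) 0
  refine Submodule.disjoint_def.mp hd w ?_ hw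
  simp [degreeEnd_apply, h0]

/-- Write an element of $N$ as $cv+b$ with $b$ a sum of vectors of nonzero energy. In the quotient
by $N$ the image of $b$ equals that of $-cv$, which has energy zero, so it vanishes. Then $cv\in N$,
and $c\ne0$ would make $N$ everything. The point of the bound is that it survives arbitrary sums, so
the sum of all proper submodules is still proper. -/
lemma le_excited {N : Submodule (UAff n) (VacuumModule n)} (hN : N ≠ ⊤) :
    N.restrictScalars ℚ ≤ excited (n := n) (VacuumModule n) := by
  intro w hw
  have hv := vacuumVector_isVacuum (n := n)
  have h1 : (⊤ : Submodule ℚ (VacuumModule n)) ≤ Submodule.span ℚ {vacuumVector n} ⊔ excited (n := n) _ := by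
    rw [← iSup_energySpan hv span_vacuumVector]
    refine iSup_le fun z => ?_
    by_cases hz : z = 0
    · subst hz; rw [energySpan_zero]; exact le_sup_left
    · exact le_sup_of_le_right ((energySpan_le_eigenspace hv z).trans (le_iSup₂_of_le z hz le_rfl))
  obtain ⟨a, ha, b, hb, rfl⟩ := Submodule.mem_sup.mp (h1 (Submodule.mem_top (x := w)))
  obtain ⟨c, rfl⟩ := Submodule.mem_span_singleton.mp ha
  have hq := hv.map N.mkQ
  have hb' : N.mkQ b ∈ excited (n := n) (VacuumModule n ⧸ N) := by
    have : excited (n := n) (VacuumModule n) ≤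
        (excited (n := n) (VacuumModule n ⧸ N)).comap (N.mkQ.restrictScalars ℚ) := by
      refine iSup₂_le fun z hz => le_trans ?_ (Submodule.comap_mono (le_iSup₂_of_le z hz le_rfl))
      intro u hu
      rw [Module.End.mem_eigenspace_iff, degreeEnd_apply] at hu
      rw [Submodule.mem_comap, Module.End.mem_eigenspace_iff, degreeEnd_apply,
        LinearMap.restrictScalars_apply, ← map_smul, hu]
      exact (N.mkQ.restrictScalars ℚ).map_smul _ _
    exact this hb
  have h2 : N.mkQ b = -(c • N.mkQ (vacuumVector n)) := by
    rw [← add_eq_zero_iff_eq_neg']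
    have h3 : N.mkQ (c • vacuumVector n + b) = 0 := (Submodule.Quotient.mk_eq_zero _).mpr hw
    rw [map_add] at h3
    exact h3
  have h4 : N.mkQ b = 0 := by
    refine eq_zero_of_mem_excited ?_ hb'
    rw [h2, smul_neg, smul_algebra_smul_comm c (ue (AffineGl.degree n)) (N.mkQ (vacuumVector n)),
      hq.degree, smul_zero, neg_zero]
  have h5 : c = 0 := by
    by_contra hc
    refine hN ?_
    rw [h4, eq_comm, neg_eq_zero, smul_eq_zero_iff_right hc] at h2
    have h6 : vacuumVector n ∈ N := (Submodule.Quotient.mk_eq_zero _).mp h2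
    rw [eq_top_iff, ← span_vacuumVector]
    exact Submodule.span_le.mpr (Set.singleton_subset_iff.mpr h6)
  rw [h5, zero_smul, zero_add]
  exact hb

lemma maxProper_le_excited :
    (maxProper n).restrictScalars ℚ ≤ excited (n := n) (VacuumModule n) := by
  intro w hw
  have hw' : w ∈ sSup {N : Submodule (UAff n) (VacuumModule n) | N ≠ ⊤} := hw
  rw [sSup_eq_iSup'] at hw'
  clear hw
  induction hw' using Submodule.iSup_induction' with
  | mem N w hw => exact le_excited N.2 hw
  | zero => exact Submodule.zero_mem _
  | add w w' _ _ h h' => exact Submodule.add_mem _ h h'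

/-- The generator has energy zero, so it can lie in the maximal proper submodule only if it is zero
in the universal module. Its image in the fermionic space is the vacuum $1\ne0$. -/
lemma hwVector_ne_zero : hwVector n ≠ 0 := by
  intro h
  have h1 : vacuumVector n ∈ maxProper n := (Submodule.Quotient.mk_eq_zero _).mp h
  have h2 := eq_zero_of_mem_excited vacuumVector_isVacuum.degree (maxProper_le_excited h1)
  have h3 := vacuumToFermi_vacuumVector (n := n)
  rw [h2, map_zero] at h3
  exact zero_ne_one h3

lemma hwVector_isVacuum : IsVacuum n (hwVector n) := vacuumVector_isVacuum.map _

lemma span_hwVector : Submodule.span (UAff n) {hwVector n} = ⊤ := by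
  have : (maxProper n).mkQ '' {vacuumVector n} = {hwVector n} := Set.image_singleton
  rw [← this, Submodule.span_image, span_vacuumVector, Submodule.map_top, Submodule.range_mkQ]

/-- If `w` generated the universal module, then the vacuum would be a multiple of its image, which
is zero. So `w` generates a proper submodule. Identities verified on fermions thereby descend to
$V_\Lambda$, without knowing that the vacuum generates an irreducible submodule there. -/
lemma mkQ_eq_zero_of_vacuumToFermi {w : VacuumModule n} (h : vacuumToFermi w = 0) :
    (maxProper n).mkQ w = 0 := by
  refine (Submodule.Quotient.mk_eq_zero _).mpr ?_
  refine (le_sSup (a := Submodule.span (UAff n) {w}) ?_) (Submodule.mem_span_singleton_self w)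
  intro htop
  have h1 : vacuumVector n ∈ Submodule.span (UAff n) {w} := htop ▸ Submodule.mem_top
  obtain ⟨a, ha⟩ := Submodule.mem_span_singleton.mp h1
  have h2 := vacuumToFermi_smul a w
  rw [h, map_zero, ha, vacuumToFermi_vacuumVector] at h2
  exact one_ne_zero h2

/-- The element `e_{a,a}(k)`. -/
def cartanMode (a : Fin (n + 1)) (k : ℤ) : AffineGl n := AffineGl.mode (Matrix.single a a 1) k

lemma fermiRep_cartanMode (a : Fin (n + 1)) (k : ℤ) :
    fermiRep (ue (cartanMode a k)) = heisCurrent psi psiStar a k := by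
  rw [ue_apply, cartanMode, fermiRep_mode, fermiMode_single, one_smul, heisCurrent]

lemma finsum_even {V : Type*} [AddCommGroup V] {g : ℤ → V} (hg : ∀ k, g (-k) = g k) {N : ℕ}
    (hN : ∀ k : ℤ, N < k → g k = 0) :
    ∑ᶠ k, g k = g 0 + 2 • ∑ k ∈ Finset.range N, g (k + 1 : ℕ) := by
  have h : ∀ N : ℕ, ∑ k ∈ Finset.Icc (-N : ℤ) N, g k =
      g 0 + 2 • ∑ k ∈ Finset.range N, g (k + 1 : ℕ) := by
    intro N
    induction N with
    | zero => simp
    | succ N ih =>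
      rw [Finset.sum_range_succ, smul_add, ← add_assoc, ← ih]
      have e : Finset.Icc (-((N + 1 : ℕ) : ℤ)) (N + 1 : ℕ) =
          insert (-((N + 1 : ℕ) : ℤ)) (insert ((N + 1 : ℕ) : ℤ) (Finset.Icc (-N : ℤ) N)) := by
        ext k
        simp only [Finset.mem_insert, Finset.mem_Icc]
        omega
      rw [e, Finset.sum_insert, Finset.sum_insert, hg, two_smul]
      · abel
      · simp
      · simp only [Finset.mem_insert, Finset.mem_Icc]
        omega
  rw [← h, finsum_eq_finsetSum_of_support_subset]
  intro k hk
  rw [Function.mem_support] at hk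
  simp only [Finset.coe_Icc, Set.mem_Icc]
  by_contra hk'
  rcases lt_or_ge (N : ℤ) k with h1 | h1
  · exact hk (hN k h1)
  · exact hk (by rw [← hg]; exact hN _ (by omega))

variable (n) in
/-- The truncated difference of the bosonic energy and `-d`. -/
def energyDefect (N : ℕ) : UAff n :=
  ∑ a, ((1 / 2 : ℚ) • (ue (cartanMode a 0) * ue (cartanMode a 0)) +
    ∑ k ∈ Finset.range N, ue (cartanMode a (-(k + 1 : ℕ))) * ue (cartanMode a (k + 1 : ℕ)) +
      (1 / 2 : ℚ) • ue (cartanMode a 0)) + ue (AffineGl.degree n)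

/-- This is `sugawara_eq` summed over the colours, with $r+\frac12$ split so that the fermionic
energy becomes $d+\frac12\sum_ah_a(0)$. On a fixed vector the currents $h_a(k)$ vanish for large
$k$, so the infinite Sugawara sum may be truncated to an element of the enveloping algebra. -/
lemma fermiRep_energyDefect (u : FermiFock n) :
    ∀ᶠ N in Filter.atTop, fermiRep (energyDefect n N) u = 0 := by
  have H := psi_isFermion (n := n)
  have h1 : ∀ a : Fin (n + 1), ∀ᶠ N : ℕ in Filter.atTop, ∀ k : ℤ, N < k →
      heisCurrent psi psiStar a k u = 0 := by
    intro a
    obtain ⟨b, hb⟩ := Filter.eventually_atTop.mp (H.eventually_current (fun _ => 1) a a u)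
    filter_upwards [Filter.eventually_ge_atTop b.toNat] with N hN k hk
    exact hb k (by omega)
  filter_upwards [Filter.eventually_all.mpr h1] with N hN
  have h2 : ∀ a : Fin (n + 1), sugawara (heisCurrent psi psiStar a) u =
      (1 / 2 : ℚ) • heisCurrent psi psiStar a 0 (heisCurrent psi psiStar a 0 u) +
      ∑ k ∈ Finset.range N, heisCurrent psi psiStar a (-(k + 1 : ℕ))
        (heisCurrent psi psiStar a (k + 1 : ℕ) u) := by
    intro a
    rw [sugawara, (H.locFin_sugawara a).lfsum_apply, finsum_even (N := N)]
    · simp only [abs_zero, neg_zero, LinearMap.smul_apply, Module.End.mul_apply, Nat.abs_cast]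
      rw [← Finset.smul_sum, ← Nat.cast_smul_eq_nsmul ℚ, smul_smul]
      norm_num
    · intro k; rw [abs_neg]
    · intro k hk
      rw [abs_of_nonneg (by omega)]
      simp [hN a k hk]
  have h3 : ∀ a : Fin (n + 1), current psi psiStar (fun r => (r : ℚ) + 1 / 2) a a 0 =
      current psi psiStar (fun r => (r : ℚ)) a a 0 + (1 / 2 : ℚ) • heisCurrent (psi (n := n)) psiStar a 0 := by
    intro a
    rw [heisCurrent, current, current, current, ← lfsum_smul (H.locFin_current _ a a 0),
      ← lfsum_add (H.locFin_current _ a a 0) ((H.locFin_current _ a a 0).smul _)]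
    congr 1
    ext1 r
    module
  have h4 : ∀ a : Fin (n + 1), _ := fun a => congr($(sugawara_eq a) u)
  simp only [h3, LinearMap.add_apply, LinearMap.smul_apply, h2, LinearMap.zero_apply] at h4
  rw [energyDefect, map_add, map_sum, ue_apply, fermiRep_degree, fermiEnergy, ← Finset.sum_add_distrib,
    LinearMap.sum_apply]
  refine Finset.sum_eq_zero fun a _ => ?_
  rw [← h4 a]
  simp only [map_add, map_smul, map_mul, map_sum, fermiRep_cartanMode, LinearMap.add_apply,
    LinearMap.smul_apply, LinearMap.sum_apply, Module.End.mul_apply]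
  abel

end BasicRepresentation

/-! ### The weight spaces of $W$ and their generation by diagonal modes -/

section WeightSpaces
variable {n : ℕ}

lemma energyDefect_smul (w : BasicRep n) :
    ∀ᶠ N in Filter.atTop, energyDefect n N • w = 0 := by
  obtain ⟨u, rfl⟩ := (maxProper n).mkQ_surjective w
  filter_upwards [fermiRep_energyDefect (vacuumToFermi u)] with N hN
  rw [← map_smul]
  exact mkQ_eq_zero_of_vacuumToFermi (by rw [vacuumToFermi_smul, hN])

lemma commute_central (a : UAff n) : Commute (ue (AffineGl.central n)) a := by
  induction a using ue_induction with
  | hx x =>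
    have h := ue_lie (AffineGl.central n) x
    rw [AffineGl.central_lie, map_zero] at h
    exact (sub_eq_zero.mp h.symm)
  | h1 r => exact (Algebra.commutes r _).symm
  | hadd a b ha hb => exact ha.add_right hb
  | hmul a b ha hb => exact ha.mul_right hb

lemma central_smul (w : BasicRep n) : ue (AffineGl.central n) • w = w := by
  have hw : w ∈ Submodule.span (UAff n) {hwVector n} := span_hwVector ▸ Submodule.mem_top
  obtain ⟨a, rfl⟩ := Submodule.mem_span_singleton.mp hw
  rw [← mul_smul, (commute_central a).eq, mul_smul, hwVector_isVacuum.central]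

lemma degree_eq_zero_of_pos {w : BasicRep n} {z : ℤ} (hz : z < 0)
    (hw : ue (AffineGl.degree n) • w = (-(z : ℚ)) • w) : w = 0 := by
  have h := eigenspace_le_energySpan hwVector_isVacuum span_hwVector z
    (x := w) (by rwa [Module.End.mem_eigenspace_iff, degreeEnd_apply])
  rwa [energySpan_of_neg _ hz, Submodule.mem_bot] at h

lemma mem_span_hwVector {w : BasicRep n} (hw : ue (AffineGl.degree n) • w = 0) :
    w ∈ Submodule.span ℚ {hwVector n} := by
  rw [← energySpan_zero (n := n)]
  refine eigenspace_le_energySpan hwVector_isVacuum span_hwVector 0 ?_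
  simp [degreeEnd_apply, hw]

/-- The condition on $c$ disappears because $c$ acts by one on all of $V_\Lambda$. -/
lemma mem_weightSpace_iff {w : BasicRep n} {q : ℚ} :
    w ∈ weightSpace n (fundWeight n - q • delta n) ↔
      (∀ D : Fin (n + 1) → ℚ, ue (AffineGl.mode (Matrix.diagonal D) 0) • w = 0) ∧
        ue (AffineGl.degree n) • w = (-q) • w := by
  have e : ∀ h : AffCartan n, cartanIncl n h = AffineGl.mode (Matrix.diagonal h.1) 0 +
      h.2.1 • AffineGl.central n + h.2.2 • AffineGl.degree n := by
    intro h
    ext1 <;> simp [cartanIncl, AffineGl.mode, AffineGl.central, AffineGl.degree]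
  have key : ∀ h : AffCartan n, ⁅cartanIncl n h, w⁆ =
      ue (AffineGl.mode (Matrix.diagonal h.1) 0) • w + h.2.1 • w +
        h.2.2 • ue (AffineGl.degree n) • w := by
    intro h
    rw [lie_def, ← ue_apply, e, map_add, map_add, map_smul, map_smul, add_smul, add_smul, smul_assoc,
      smul_assoc, central_smul]
  constructor
  · intro hw
    refine ⟨fun D => ?_, ?_⟩
    · have h1 := hw (D, 0, 0)
      rw [key] at h1
      simpa [fundWeight, delta] using h1
    · have h1 := hw (0, 0, 1)
      rw [key] at h1
      have h0 : AffineGl.mode (0 : Gl n) 0 = 0 := by ext1 <;> simp [AffineGl.mode]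
      simpa [fundWeight, delta, h0] using h1
  · rintro ⟨h1, h2⟩ h
    rw [key, h1, h2]
    simp only [fundWeight, delta, LinearMap.sub_apply, LinearMap.smul_apply, LinearMap.comp_apply,
      LinearMap.fst_apply, LinearMap.snd_apply, smul_eq_mul]
    module

lemma diagonal_smul_mem_weightSpace {w : BasicRep n} {q : ℚ}
    (hw : w ∈ weightSpace n (fundWeight n - q • delta n)) (D : Fin (n + 1) → ℚ) {k : ℤ} (hk : k ≠ 0) :
    ue (AffineGl.mode (Matrix.diagonal D) k) • w ∈ weightSpace n (fundWeight n - (q - k) • delta n) := by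
  rw [mem_weightSpace_iff] at hw ⊢
  refine ⟨fun D' => ?_, ?_⟩
  · rw [ue_smul_ue_smul, hw.1, smul_zero, zero_add, AffineGl.mode_lie_mode, Matrix.diagonal_mul_diagonal,
      Matrix.diagonal_mul_diagonal, zero_add, if_neg hk, zero_smul, add_zero]
    have h0 : Matrix.diagonal (fun i => D' i * D i) - Matrix.diagonal (fun i => D i * D' i) = 0 := by
      simp [mul_comm]
    have h1 : AffineGl.mode (0 : Gl n) k = 0 := by ext1 <;> simp [AffineGl.mode]
    rw [h0, h1, map_zero, zero_smul]
  · rw [ue_smul_ue_smul, hw.2, AffineGl.degree_lie_mode, map_smul, smul_assoc,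
      smul_algebra_smul_comm (-q) (ue (AffineGl.mode _ k)) w, ← add_smul]
    congr 1
    ring

lemma hwVector_mem_weightSpace : hwVector n ∈ weightSpace n (fundWeight n - ((0 : ℕ) : ℚ) • delta n) := by
  rw [mem_weightSpace_iff]
  refine ⟨fun D => hwVector_isVacuum.mode _ _ le_rfl, ?_⟩
  rw [hwVector_isVacuum.degree]; simp

lemma hwVector_mem_zeroWeightSum : hwVector n ∈ zeroWeightSum n :=
  Submodule.mem_iSup_of_mem 0 hwVector_mem_weightSpace

lemma diagonal_smul_mem_zeroWeightSum {w : BasicRep n} (hw : w ∈ zeroWeightSum n)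
    (D : Fin (n + 1) → ℚ) {k : ℤ} (hk : k ≠ 0) :
    ue (AffineGl.mode (Matrix.diagonal D) k) • w ∈ zeroWeightSum n := by
  induction hw using Submodule.iSup_induction' with
  | mem m w hw =>
    have h := diagonal_smul_mem_weightSpace hw D hk
    -- The sum $W$ has only summands with $m\ge0$. For $k>m$ the image has negative energy and is
    -- therefore zero.
    rcases le_or_gt k m with hkm | hkm
    · refine Submodule.mem_iSup_of_mem (m - k).toNat ?_
      convert h using 4
      have : ((m - k).toNat : ℤ) = m - k := Int.toNat_of_nonneg (by omega)
      exact_mod_cast this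
    · have h2 := (mem_weightSpace_iff.mp h).2
      have h3 : ue (AffineGl.mode (Matrix.diagonal D) k) • w = 0 :=
        degree_eq_zero_of_pos (z := m - k) (by omega) (by exact_mod_cast h2)
      rw [h3]
      exact Submodule.zero_mem _
  | zero => rw [smul_zero]; exact Submodule.zero_mem _
  | add w w' _ _ h h' => rw [smul_add]; exact Submodule.add_mem _ h h'

lemma cartanMode_eq (a : Fin (n + 1)) (k : ℤ) :
    cartanMode a k = AffineGl.mode (Matrix.diagonal (Pi.single a 1)) k := by
  rw [cartanMode, Matrix.diagonal_single]

/-- The sum of the weight spaces `V_Λ[Λ - m δ]` is generated by the highest weight vector under the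
lowering modes of the diagonal matrices. -/
lemma zeroWeightSum_le {S : Submodule ℚ (BasicRep n)} (hv : hwVector n ∈ S)
    (hS : ∀ (a : Fin (n + 1)) (k : ℕ), ∀ w ∈ S, ue (cartanMode a (-(k + 1 : ℕ))) • w ∈ S) :
    zeroWeightSum n ≤ S := by
  refine iSup_le fun m => ?_
  induction m using Nat.strong_induction_on with
  | _ m ih =>
    intro w hw
    obtain ⟨hw0, hwd⟩ := mem_weightSpace_iff.mp hw
    rcases Nat.eq_zero_or_pos m with rfl | hm
    · have h := mem_span_hwVector (w := w) (by rw [hwd]; simp)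
      exact (Submodule.span_le.mpr (Set.singleton_subset_iff.mpr hv)) h
    · obtain ⟨N, hN⟩ := (energyDefect_smul w).exists
      -- On this weight space $h_a(0)w=0$ and $dw=-mw$, so the vanishing of `energyDefect` is
      -- exactly this expression for $mw$.
      have h1 : (m : ℚ) • w = ∑ a : Fin (n + 1), ∑ k ∈ Finset.range N,
          ue (cartanMode a (-(k + 1 : ℕ))) • ue (cartanMode a (k + 1 : ℕ)) • w := by
        have h0 : ∀ a : Fin (n + 1), ue (cartanMode a 0) • w = 0 := fun a => by
          rw [cartanMode_eq]; exact hw0 _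
        rw [energyDefect, add_smul, Finset.sum_smul, hwd] at hN
        simp only [add_smul, smul_assoc, mul_smul, h0, smul_zero, zero_add, add_zero,
          Finset.sum_smul] at hN
        rw [neg_smul, ← sub_eq_add_neg, sub_eq_zero] at hN
        exact hN.symm
      have h2 : (m : ℚ) • w ∈ S := by
        rw [h1]
        refine Submodule.sum_mem _ fun a _ => Submodule.sum_mem _ fun k _ => hS a k _ ?_
        have h3 := diagonal_smul_mem_weightSpace hw (Pi.single a 1) (k := (k + 1 : ℕ)) (by omega)
        rw [← cartanMode_eq] at h3
        -- The inner vector has energy $m-(k+1)$: the induction hypothesis covers it when this is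
        -- nonnegative, and otherwise it is zero.
        rcases le_or_gt (k + 1) m with hkm | hkm
        · refine ih (m - (k + 1)) (by omega) ?_
          convert h3 using 4
          push_cast [Nat.cast_sub hkm]
          ring
        · have h4 := (mem_weightSpace_iff.mp h3).2
          have h5 : ue (cartanMode a (k + 1 : ℕ)) • w = 0 := by
            refine degree_eq_zero_of_pos (z := m - (k + 1)) (by omega) ?_
            convert h4 using 2
            push_cast; ring
          rw [h5]
          exact S.zero_mem
      have hm' : (m : ℚ) ≠ 0 := by exact_mod_cast hm.ne'
      have h5 := S.smul_mem (m : ℚ)⁻¹ h2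
      rwa [smul_smul, inv_mul_cancel₀ hm', one_smul] at h5

end WeightSpaces

/-! ### Equivariant cohomology and the residue pairing -/

section Cohomology
variable {n : ℕ}

/-- The linear form `(n+1-j) t₁ - j t₂` in `ℚ(t₁, t₂)`. -/
def weightForm (n j : ℕ) : EqField :=
  algebraMap EqRing EqField (((n : EqRing) + 1 - (j : EqRing)) * t₁ - (j : EqRing) * t₂)

lemma algebraMap_injective : Function.Injective (algebraMap EqRing EqField) :=
  IsFractionRing.injective EqRing EqField

lemma linearForm_ne_zero {a b : ℚ} (h : a ≠ 0 ∨ b ≠ 0) :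
    algebraMap ℚ EqRing a * t₁ + algebraMap ℚ EqRing b * t₂ ≠ 0 := by
  intro h0
  have key : ∀ v : Fin 2 → ℚ, a * v 0 + b * v 1 = 0 := by
    intro v
    have h1 : MvPolynomial.eval v (MvPolynomial.C a * MvPolynomial.X 0 +
        MvPolynomial.C b * MvPolynomial.X 1 : MvPolynomial (Fin 2) ℚ) = 0 :=
      (congrArg (MvPolynomial.eval v) h0).trans (map_zero _)
    simpa using h1
  rcases h with h | h
  · exact h (by simpa using key ![1, 0])
  · exact h (by simpa using key ![0, 1])

lemma t₁_ne_zero : algebraMap EqRing EqField t₁ ≠ 0 := by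
  have h := linearForm_ne_zero (a := 1) (b := 0) (by simp)
  rw [ne_eq, map_eq_zero_iff _ algebraMap_injective]
  simpa using h

lemma t₂_ne_zero : algebraMap EqRing EqField t₂ ≠ 0 := by
  have h := linearForm_ne_zero (a := 0) (b := 1) (by simp)
  rw [ne_eq, map_eq_zero_iff _ algebraMap_injective]
  simpa using h

lemma t₁_add_t₂_ne_zero : algebraMap EqRing EqField t₁ + algebraMap EqRing EqField t₂ ≠ 0 := by
  have h := linearForm_ne_zero (a := 1) (b := 1) (by simp)
  rw [← map_add, ne_eq, map_eq_zero_iff _ algebraMap_injective]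
  simpa using h

lemma weightForm_ne_zero (n j : ℕ) : weightForm n j ≠ 0 := by
  rw [weightForm, ne_eq, map_eq_zero_iff _ algebraMap_injective]
  have h := linearForm_ne_zero (a := n + 1 - j) (b := -j) (by
    by_cases hj : j = 0
    · left; subst hj; simp; positivity
    · right; simpa using hj)
  simpa [sub_eq_add_neg] using h

lemma weightForm_eq (n j : ℕ) : weightForm n j = ((n : EqField) + 1 - j) * algebraMap EqRing EqField t₁ -
    j * algebraMap EqRing EqField t₂ := by
  simp [weightForm]

lemma algebraMap_wL (j : Fin (n + 1)) : algebraMap EqRing EqField (wL n j) = weightForm n j := rfl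

/-- All tangent weights are, up to sign, members of one arithmetic progression of linear forms, with
$w^R$ at a point equal to minus the next form. This makes residue sums telescope. -/
lemma algebraMap_wR (j : Fin (n + 1)) : algebraMap EqRing EqField (wR n j) = -weightForm n (j + 1) := by
  rw [weightForm_eq]
  simp only [wR, map_add, map_sub, map_mul, map_natCast, map_one]
  push_cast
  ring

@[simp] lemma restrictTo_tmul (j : Fin (n + 1)) (a : EqField) (f : HT n) :
    restrictTo n j (a ⊗ₜ f) = a * algebraMap EqRing EqField (f.1 j) := by
  simp [restrictTo]

lemma restrictTo_one (j : Fin (n + 1)) : restrictTo n j 1 = 1 := by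
  rw [Algebra.TensorProduct.one_def, restrictTo_tmul]
  simp

lemma pairing_apply (γ γ' : HTK n) : pairing n γ γ' =
    ∑ j : Fin (n + 1), restrictTo n j γ * restrictTo n j γ' /
      (weightForm n j * -weightForm n (j + 1)) := by
  simp only [pairing, LinearMap.sum_apply, LinearMap.smul_apply, LinearMap.compl₁₂_apply,
    LinearMap.mul_apply', smul_eq_mul, map_mul, algebraMap_wL, algebraMap_wR]
  exact Finset.sum_congr rfl fun j _ => by rw [div_eq_inv_mul]

/-- Clearing the denominator of a class with coefficients in `ℚ(t₁, t₂)`. -/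
lemma exists_smul_eq_one_tmul {M : Type*} [AddCommGroup M] [Module EqRing M] (x : EqField ⊗[EqRing] M) :
    ∃ (r : EqRing) (m : M), r ≠ 0 ∧ r • x = 1 ⊗ₜ m := by
  induction x using TensorProduct.induction_on with
  | zero => exact ⟨1, 0, one_ne_zero, by simp⟩
  | tmul a m =>
    obtain ⟨p, q, hq, rfl⟩ := IsFractionRing.div_surjective (A := EqRing) a
    refine ⟨q, p • m, nonZeroDivisors.ne_zero hq, ?_⟩
    have hq' : algebraMap EqRing EqField q ≠ 0 := by
      rw [ne_eq, map_eq_zero_iff _ algebraMap_injective]; exact nonZeroDivisors.ne_zero hq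
    rw [TensorProduct.smul_tmul', Algebra.smul_def, mul_div_cancel₀ _ hq', ← TensorProduct.smul_tmul,
      Algebra.smul_def, mul_one]
  | add x y hx hy =>
    obtain ⟨r, m, hr, hm⟩ := hx
    obtain ⟨s, l, hs, hl⟩ := hy
    refine ⟨r * s, s • m + r • l, mul_ne_zero hr hs, ?_⟩
    rw [smul_add, TensorProduct.tmul_add, TensorProduct.tmul_smul, TensorProduct.tmul_smul, ← hm, ← hl,
      smul_smul, smul_smul, mul_comm s r]

/-- After clearing denominators a class is an honest tuple of polynomials, and such a tuple is
determined by its entries. -/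
lemma restrict_injective {γ : HTK n} (h : ∀ j, restrictTo n j γ = 0) : γ = 0 := by
  obtain ⟨r, f, hr, hf⟩ := exists_smul_eq_one_tmul γ
  have h1 : f = 0 := by
    apply Subtype.ext
    funext j
    have h2 : restrictTo n j (r • γ) = 0 := by
      rw [← algebraMap_smul EqField, map_smul, h, smul_zero]
    rw [hf, restrictTo_tmul, one_mul, map_eq_zero_iff _ algebraMap_injective] at h2
    exact h2
  rw [h1, TensorProduct.tmul_zero, ← algebraMap_smul EqField] at hf
  have hr' : algebraMap EqRing EqField r ≠ 0 := by
    rwa [ne_eq, map_eq_zero_iff _ algebraMap_injective]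
  rw [← inv_smul_smul₀ hr' γ, hf, smul_zero]

/-- Consecutive forms differ by $t_1+t_2$, so partial fractions make the sum telescope. The two ends
are $(n+1)t_1$ and $-(n+1)t_2$. -/
lemma pairing_one_one : pairing n 1 1 =
    (((n : EqField) + 1) * (algebraMap EqRing EqField t₁ * algebraMap EqRing EqField t₂))⁻¹ := by
  have h1 := t₁_ne_zero
  have h2 := t₂_ne_zero
  have h3 := t₁_add_t₂_ne_zero
  have hn : (n : EqField) + 1 ≠ 0 := by exact_mod_cast n.succ_ne_zero
  have key : ∀ j : ℕ, 1 * 1 / (weightForm n j * -weightForm n (j + 1)) =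
      (algebraMap EqRing EqField t₁ + algebraMap EqRing EqField t₂)⁻¹ *
        ((weightForm n j)⁻¹ - (weightForm n (j + 1))⁻¹) := by
    intro j
    have ha := weightForm_ne_zero n j
    have hb := weightForm_ne_zero n (j + 1)
    have hab : weightForm n (j + 1) = weightForm n j -
      (algebraMap EqRing EqField t₁ + algebraMap EqRing EqField t₂) := by
      rw [weightForm_eq, weightForm_eq]; push_cast; ring
    field_simp
    rw [hab]; ring
  simp only [pairing_apply, restrictTo_one]
  rw [Fin.sum_univ_eq_sum_range (fun j => 1 * 1 / (weightForm n j * -weightForm n (j + 1)))]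
  simp only [key]
  rw [← Finset.mul_sum, Finset.sum_range_sub', weightForm_eq, weightForm_eq]
  push_cast
  rw [show (n : EqField) + 1 - (n + 1) = 0 from sub_self _]
  simp only [sub_zero, zero_mul, zero_sub]
  field_simp
  ring

lemma restrictTo_curve (i : Fin n) (j : Fin (n + 1)) : restrictTo n j (1 ⊗ₜ curveClass n i) =
    (if j = i.castSucc then weightForm n i else 0) - (if j = i.succ then weightForm n (i + 2) else 0) := by
  rw [restrictTo_tmul, one_mul, curveClass]
  simp only [curveFun, Pi.add_apply, map_add, Pi.single_apply]
  rw [sub_eq_add_neg]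
  congr 1
  · split_ifs
    · rw [algebraMap_wL, Fin.val_castSucc]
    · simp
  · split_ifs
    · rw [algebraMap_wR, Fin.val_succ]
    · simp

/-- Localisation on $E_i$: only its two fixed points contribute, the normal weight cancels at each,
and what remains are the tangent weights of $E_i$, which are opposite. -/
lemma pairing_curve (γ : HTK n) (i : Fin n) : pairing n γ (1 ⊗ₜ curveClass n i) =
    (restrictTo n i.succ γ - restrictTo n i.castSucc γ) / weightForm n (i + 1) := by
  have h0 := weightForm_ne_zero n i
  have h1 := weightForm_ne_zero n (i + 1)
  have h2 := weightForm_ne_zero n (i + 2)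
  rw [pairing_apply]
  simp only [restrictTo_curve, mul_sub, sub_div, Finset.sum_sub_distrib, mul_ite, mul_zero, ite_div,
    zero_div, Finset.sum_ite_eq', Finset.mem_univ, if_true,
    Fin.val_castSucc, Fin.val_succ]
  rw [show (i : ℕ) + 1 + 1 = i + 2 from rfl]
  field_simp
  ring

/-- The generators `1, E_1, …, E_n` of the equivariant cohomology. -/
def classFam (n : ℕ) : Option (Fin n) → HTK n
  | none => 1
  | some i => 1 ⊗ₜ curveClass n i

/-- The diagonal matrices `Id, e_{i,i} - e_{i+1,i+1}` corresponding to `1, E_i`. -/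
def diagFam (n : ℕ) : Option (Fin n) → Fin (n + 1) → ℚ
  | none => 1
  | some i => Pi.single i.castSucc 1 - Pi.single i.succ 1

/-- Both sides are minus the Cartan matrix of type $A_n$. The self-intersection $-2$ comes from the
relation that the forms with indices $i$ and $i+2$ add up to twice the form with index $i+1$. -/
lemma pairing_curve_curve (i j : Fin n) :
    pairing n (1 ⊗ₜ curveClass n j) (1 ⊗ₜ curveClass n i) =
      -(((diagFam n (some j) ⬝ᵥ diagFam n (some i) : ℚ)) : EqField) := by
  have h1 := weightForm_ne_zero n (i + 1)
  rw [pairing_curve, restrictTo_curve, restrictTo_curve, div_eq_iff h1]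
  simp only [diagFam, dotProduct_sub, dotProduct_single, Pi.single_apply, mul_one,
    Pi.sub_apply, Fin.castSucc_inj, Fin.succ_inj]
  have e1 : (i.succ = j.castSucc) ↔ (j : ℕ) = i + 1 := by simp [Fin.ext_iff, eq_comm]
  have e2 : (i.castSucc = j.succ) ↔ (i : ℕ) = j + 1 := by simp [Fin.ext_iff]
  have e3 : (i = j) ↔ (i : ℕ) = j := by simp [Fin.ext_iff]
  simp only [e1, e2, e3]
  by_cases c1 : (j : ℕ) = i + 1
  · have c2 : ¬ (i : ℕ) = j + 1 := by omega
    have c4 : ¬ (i : ℕ) = i + 1 + 1 := by omega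
    simp [c1, c4]
  by_cases c2 : (i : ℕ) = j + 1
  · have c3 : ¬ (i : ℕ) = j := by omega
    simp [c2, add_assoc]
  by_cases c3 : (i : ℕ) = j
  · simp [c3]
    simp only [weightForm_eq]
    push_cast
    ring
  · simp [c1, c2, c3]

/-- Pairing with $1$ isolates the coefficient of $1$, because every $E_i$ is orthogonal to $1$. The
remaining coefficients vanish one after another on restriction to the successive fixed points, since
only $E_{i-1}$ and $E_i$ meet $p_i$. -/
lemma linearIndependent_classFam : LinearIndependent EqField (classFam n) := by
  rw [Fintype.linearIndependent_iff]
  intro g hg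
  rw [Fintype.sum_option] at hg
  have h0 : g none = 0 := by
    have h := congr(pairing n $hg 1)
    rw [map_add, map_sum, LinearMap.add_apply, LinearMap.sum_apply, Finset.sum_eq_zero, add_zero, map_smul,
      LinearMap.smul_apply, map_zero, LinearMap.zero_apply, classFam, pairing_one_one] at h
    · refine (smul_eq_zero.mp h).resolve_right (inv_ne_zero (mul_ne_zero ?_
        (mul_ne_zero t₁_ne_zero t₂_ne_zero)))
      exact_mod_cast n.succ_ne_zero
    · intro i _
      rw [map_smul, LinearMap.smul_apply, pairing_comm, classFam, pairing_curve, restrictTo_one,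
        restrictTo_one]
      simp
  rw [h0, zero_smul, zero_add] at hg
  have h1 : ∀ (m : ℕ) (hm : m < n), g (some ⟨m, hm⟩) = 0 := by
    intro m
    induction m using Nat.strong_induction_on with
    | _ m ih =>
      intro hm
      have h := congr(restrictTo n (Fin.castSucc ⟨m, hm⟩) $hg)
      rw [map_sum, map_zero, Finset.sum_eq_single ⟨m, hm⟩] at h
      · rw [map_smul, classFam, restrictTo_curve, if_pos rfl, if_neg (by simp [Fin.ext_iff]), sub_zero,
          smul_eq_mul] at h
        exact (mul_eq_zero.mp h).resolve_right (weightForm_ne_zero _ _)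
      · intro j _ hj
        rw [map_smul, classFam, restrictTo_curve, if_neg fun h => hj (Fin.castSucc_injective _ h).symm]
        split_ifs with h'
        · have : (m : ℕ) = j + 1 := by simpa [Fin.ext_iff] using h'
          have := ih j (by omega) j.2
          rw [this, zero_smul]
        · simp
      · simp
  rintro (_ | i)
  · exact h0
  · exact h1 i i.2

lemma restrict_pi_injective : Function.Injective (LinearMap.pi (restrictTo n)) := by
  rw [injective_iff_map_eq_zero]
  intro γ h
  exact restrict_injective fun j => congrFun h j

instance : FiniteDimensional EqField (HTK n) :=
  FiniteDimensional.of_injective _ restrict_pi_injective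

lemma span_classFam : Submodule.span EqField (Set.range (classFam n)) = ⊤ := by
  refine linearIndependent_classFam.span_eq_top_of_card_eq_finrank' (le_antisymm ?_ ?_)
  · exact linearIndependent_classFam.fintype_card_le_finrank
  · have := LinearMap.finrank_le_finrank_of_injective (restrict_pi_injective (n := n))
    simpa using this

/-- The basis `1, E_1, …, E_n` of the equivariant cohomology over `ℚ(t₁, t₂)`. -/
def classBasis (n : ℕ) : Module.Basis (Option (Fin n)) EqField (HTK n) :=
  Module.Basis.mk linearIndependent_classFam span_classFam.ge

lemma classBasis_apply (o : Option (Fin n)) : classBasis n o = classFam n o :=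
  Module.Basis.mk_apply _ _ _

/-- Orthogonality to every $E_i$ says that neighbouring restrictions agree, so the class is a
multiple of $1$; and $\langle1,1\rangle\ne0$. -/
lemma pairing_nondegenerate {γ : HTK n} (h : ∀ γ', pairing n γ γ' = 0) : γ = 0 := by
  have h1 : ∀ i : Fin n, restrictTo n i.succ γ = restrictTo n i.castSucc γ := by
    intro i
    have h2 := h (1 ⊗ₜ curveClass n i)
    rw [pairing_curve, div_eq_zero_iff, sub_eq_zero] at h2
    exact h2.resolve_right (weightForm_ne_zero _ _)
  have h2 : ∀ j, restrictTo n j γ = restrictTo n 0 γ := by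
    intro j
    induction j using Fin.induction with
    | zero => rfl
    | succ i ih => rw [h1, ih]
  have h3 : γ = restrictTo n 0 γ • 1 := by
    rw [← sub_eq_zero]
    refine restrict_injective fun j => ?_
    rw [map_sub, map_smul, restrictTo_one, h2, smul_eq_mul, mul_one, sub_self]
  have h4 := h 1
  rw [h3, map_smul, LinearMap.smul_apply, pairing_one_one] at h4
  have hn : (n : EqField) + 1 ≠ 0 := by exact_mod_cast n.succ_ne_zero
  rw [h3, (smul_eq_zero.mp h4).resolve_right (inv_ne_zero (mul_ne_zero hn
    (mul_ne_zero t₁_ne_zero t₂_ne_zero))), zero_smul]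

end Cohomology

/-! ### The embedding of the Heisenberg algebra -/

section HeisEmbedding
variable {n : ℕ}

/-- The coefficient of the image of `𝔭_k(γ)` for a generator `γ` of the cohomology. -/
def heisCoeff (n : ℕ) (k : NZ) : Option (Fin n) → EqField
  | none => if k.1 < 0 then 1 else -(((n : EqField) + 1) ^ 2 * algebraMap EqRing EqField (t₁ * t₂))⁻¹
  | some _ => 1

/-- The images of the Heisenberg operators in `gl^(n+1) ⊗ ℚ(t₁, t₂)`. -/
def heisModes (n : ℕ) : (NZ →₀ HTK n) →ₗ[EqField] EqField ⊗[ℚ] AffineGl n :=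
  Finsupp.lsum EqField fun k => (classBasis n).constr EqField fun o =>
    heisCoeff n k o ⊗ₜ[ℚ] AffineGl.mode (Matrix.diagonal (diagFam n o)) k.1

lemma heisModes_single (k : NZ) (o : Option (Fin n)) :
    heisModes n (.single k (classFam n o)) =
      heisCoeff n k o ⊗ₜ AffineGl.mode (Matrix.diagonal (diagFam n o)) k.1 := by
  rw [heisModes, Finsupp.lsum_single, ← classBasis_apply, Module.Basis.constr_basis]

lemma diagFam_none_dotProduct_some (i : Fin n) : diagFam n none ⬝ᵥ diagFam n (some i) = 0 := by
  simp [diagFam, dotProduct_sub]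

lemma pairing_one_curve (i : Fin n) : pairing n (classFam n none) (classFam n (some i)) = 0 := by
  rw [classFam, classFam, pairing_curve, restrictTo_one, restrictTo_one, sub_self, zero_div]

/-- The normalisation of the embedding is determined here. Exactly one of $k,l$ is positive, so for
the class $1$ the coefficients multiply to $-1/((n+1)^2t_1t_2)$, which times
$\operatorname{tr}(\mathrm{Id})=n+1$ is $-\langle1,1\rangle$. The mixed terms vanish on both sides.
-/
lemma heisCoeff_mul (k l : NZ) (h : k.1 + l.1 = 0) (o o' : Option (Fin n)) :
    heisCoeff n k o * heisCoeff n l o' * ((diagFam n o ⬝ᵥ diagFam n o' : ℚ) : EqField) =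
      -pairing n (classFam n o) (classFam n o') := by
  have hk := k.2
  rcases o with _ | i <;> rcases o' with _ | j
  · have hn : (n : EqField) + 1 ≠ 0 := by exact_mod_cast n.succ_ne_zero
    have h1 := t₁_ne_zero
    have h2 := t₂_ne_zero
    have hc : heisCoeff n k none * heisCoeff n l none =
        -(((n : EqField) + 1) ^ 2 * algebraMap EqRing EqField (t₁ * t₂))⁻¹ := by
      simp only [heisCoeff]
      by_cases hk' : k.1 < 0
      · rw [if_pos hk', if_neg (by omega), one_mul]
      · rw [if_neg hk', if_pos (by omega), mul_one]
    have hd : ((diagFam n none ⬝ᵥ diagFam n none : ℚ) : EqField) = n + 1 := by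
      simp [diagFam]
    rw [hc, hd, classFam, pairing_one_one, map_mul]
    field_simp
  · rw [diagFam_none_dotProduct_some, pairing_one_curve]
    simp
  · rw [dotProduct_comm, diagFam_none_dotProduct_some, pairing_comm, pairing_one_curve]
    simp
  · rw [classFam, classFam, pairing_curve_curve, neg_neg, heisCoeff, heisCoeff, one_mul, one_mul]

/-- The bracket of `gl^(n+1) ⊗ ℚ(t₁, t₂)` as a bilinear map. -/
def affBracket (n : ℕ) : (EqField ⊗[ℚ] AffineGl n) →ₗ[EqField] (EqField ⊗[ℚ] AffineGl n) →ₗ[EqField]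
    EqField ⊗[ℚ] AffineGl n :=
  LinearMap.mk₂ EqField (fun x y => ⁅x, y⁆) (fun x y z => add_lie x y z)
    (fun r x y => smul_lie r x y) (fun x y z => lie_add x y z) fun r x y => lie_smul r x y

/-- The action of `gl^(n+1) ⊗ ℚ(t₁, t₂)` on `V_Λ ⊗ ℚ(t₁, t₂)` as a bilinear map. -/
def affAction (n : ℕ) : (EqField ⊗[ℚ] AffineGl n) →ₗ[EqField] (EqField ⊗[ℚ] BasicRep n) →ₗ[EqField]
    EqField ⊗[ℚ] BasicRep n :=
  LinearMap.mk₂ EqField (fun x y => ⁅x, y⁆) (fun x y z => add_lie x y z)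
    (fun r x y => smul_lie r x y) (fun x y z => lie_add x y z) fun r x y => lie_smul r x y

lemma affBracket_tmul (a b : EqField) (x y : AffineGl n) :
    affBracket n (a ⊗ₜ x) (b ⊗ₜ y) = (a * b) ⊗ₜ ⁅x, y⁆ := rfl

lemma affAction_tmul (a b : EqField) (x : AffineGl n) (w : BasicRep n) :
    affAction n (a ⊗ₜ x) (b ⊗ₜ w) = (a * b) ⊗ₜ (ue x • w) := rfl

lemma affAction_lie (x y : EqField ⊗[ℚ] AffineGl n) (w : EqField ⊗[ℚ] BasicRep n) :
    affAction n (affBracket n x y) w =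
      affAction n x (affAction n y w) - affAction n y (affAction n x w) :=
  lie_lie x y w

lemma diagonal_lie_diagonal (D D' : Fin (n + 1) → ℚ) (k l : ℤ) :
    ⁅AffineGl.mode (Matrix.diagonal D) k, AffineGl.mode (Matrix.diagonal D') l⁆ =
      (if k + l = 0 then (k : ℚ) * (D ⬝ᵥ D') else 0) • AffineGl.central n := by
  rw [AffineGl.mode_lie_mode, Matrix.diagonal_mul_diagonal, Matrix.diagonal_mul_diagonal,
    Matrix.trace_diagonal]
  simp only [mul_comm (D' _), sub_self, dotProduct]
  have : AffineGl.mode (0 : Gl n) (k + l) = 0 := by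
    ext1 <;> simp [AffineGl.mode]
  rw [this, zero_add]

lemma heisModes_lie (u v : NZ →₀ HTK n) : affBracket n (heisModes n u) (heisModes n v) =
    heisCocycle n u v • ((1 : EqField) ⊗ₜ[ℚ] AffineGl.central n) := by
  suffices h : (affBracket n).compl₁₂ (heisModes n) (heisModes n) =
      (heisCocycle n).compr₂ (LinearMap.toSpanSingleton EqField _ (1 ⊗ₜ[ℚ] AffineGl.central n)) from
    congr($h u v)
  refine Finsupp.lhom_ext' fun k => (classBasis n).ext fun o => Finsupp.lhom_ext' fun l =>
    (classBasis n).ext fun o' => ?_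
  simp only [LinearMap.comp_apply, LinearMap.compl₁₂_apply, LinearMap.compr₂_apply,
    Finsupp.lsingle_apply, LinearMap.toSpanSingleton_apply, classBasis_apply, heisModes_single,
    affBracket_tmul, diagonal_lie_diagonal, heisCocycle_single]
  split_ifs with h
  · rw [TensorProduct.tmul_smul, TensorProduct.smul_tmul', TensorProduct.smul_tmul', Rat.smul_def,
      smul_eq_mul, mul_one]
    congr 1
    push_cast
    linear_combination (k.1 : EqField) * heisCoeff_mul k l h o o'
  · simp

lemma one_tmul_injective (M : Type*) [AddCommGroup M] [Module ℚ M] :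
    Function.Injective fun m : M => (1 : EqField) ⊗ₜ[ℚ] m :=
  Module.FaithfullyFlat.tensorProduct_mk_injective (A := ℚ) (B := EqField) M

lemma one_tmul_central_ne_zero : (1 : EqField) ⊗ₜ[ℚ] AffineGl.central n ≠ 0 := by
  intro h
  have h1 := one_tmul_injective (AffineGl n) (a₁ := AffineGl.central n) (a₂ := 0) (by simpa using h)
  have h2 : (AffineGl.central n).c = 0 := by rw [h1]; rfl
  simp [AffineGl.central] at h2

lemma affBracket_central (z : EqField ⊗[ℚ] AffineGl n) :
    affBracket n (1 ⊗ₜ AffineGl.central n) z = 0 := by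
  induction z using TensorProduct.induction_on with
  | zero => exact map_zero _
  | tmul a x => rw [affBracket_tmul, AffineGl.central_lie, TensorProduct.tmul_zero]
  | add x y hx hy => rw [map_add, hx, hy, add_zero]

lemma heisCocycle_single_neg (u : NZ →₀ HTK n) (k : NZ) (γ : HTK n) :
    heisCocycle n u (.single (-k) γ) = -(k.1 : EqField) * pairing n (u k) γ := by
  induction u using Finsupp.induction_linear with
  | zero => simp
  | add u u' hu hu' =>
    simp only [map_add, LinearMap.add_apply, Finsupp.add_apply, hu, hu', mul_add]
  | single l γ' =>
    have hneg : (-k).1 = -k.1 := rfl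
    rw [heisCocycle_single, hneg]
    by_cases h : l = k
    · rw [h, if_pos (add_neg_cancel _), Finsupp.single_eq_same]
    · rw [if_neg (fun e => h (Subtype.ext (add_neg_eq_zero.mp e))), Finsupp.single_eq_of_ne (Ne.symm h),
        map_zero, LinearMap.zero_apply, mul_zero]

lemma heisCocycle_nondegenerate {u : NZ →₀ HTK n} (h : ∀ v, heisCocycle n u v = 0) : u = 0 := by
  ext1 k
  refine pairing_nondegenerate fun γ' => ?_
  have h1 := h (.single (-k) γ')
  rw [heisCocycle_single_neg] at h1
  refine (mul_eq_zero.mp h1).resolve_left ?_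
  exact neg_ne_zero.mpr (Int.cast_ne_zero.mpr k.2)

/-- The embedding of `ℋ` into `gl^(n+1) ⊗ ℚ(t₁, t₂)`. -/
def heisHom (n : ℕ) : Heis n →ₗ⁅EqField⁆ EqField ⊗[ℚ] AffineGl n where
  toFun x := heisModes n x.modes + x.c • ((1 : EqField) ⊗ₜ[ℚ] AffineGl.central n)
  map_add' x y := by rw [Heis.add_modes, Heis.add_c, map_add, add_smul, add_add_add_comm]
  map_smul' r x := by rw [Heis.smul_modes, Heis.smul_c, map_smul, mul_smul, ← smul_add, RingHom.id_apply]
  map_lie' {x y} := by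
    change _ = affBracket n _ _
    have hc : ∀ z, affBracket n z (1 ⊗ₜ AffineGl.central n) = 0 := fun z =>
      (lie_skew _ _).symm.trans (neg_eq_zero.mpr (affBracket_central z))
    rw [map_add _ (heisModes n y.modes), map_smul _ y.c, hc, smul_zero, add_zero, map_add,
      LinearMap.add_apply, map_smul, LinearMap.smul_apply, affBracket_central, smul_zero, add_zero, heisModes_lie, Heis.lie_modes,
      map_zero, zero_add, Heis.lie_c]

lemma heisHom_apply (x : Heis n) :
    heisHom n x = heisModes n x.modes + x.c • ((1 : EqField) ⊗ₜ[ℚ] AffineGl.central n) := rfl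

lemma heisHom_p (k : NZ) (γ : HTK n) : heisHom n (Heis.p k γ) = heisModes n (.single k γ) := by
  rw [heisHom_apply, Heis.p, zero_smul, add_zero]

/-- If the image of $x$ is zero, then its mode part is sent to a central element, so the cocycle
pairs it to zero with everything. Nondegeneracy kills the modes, and the central line embeds. -/
lemma heisHom_injective : Function.Injective (heisHom n) := by
  rw [injective_iff_map_eq_zero]
  intro x hx
  rw [heisHom_apply] at hx
  have hm : x.modes = 0 := by
    refine heisCocycle_nondegenerate fun v => ?_
    have h := heisModes_lie x.modes v
    rw [eq_neg_of_add_eq_zero_left hx, map_neg, map_smul, LinearMap.neg_apply, LinearMap.smul_apply,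
      affBracket_central, smul_zero, neg_zero] at h
    exact (smul_eq_zero.mp h.symm).resolve_right one_tmul_central_ne_zero
  rw [hm, map_zero, zero_add] at hx
  ext1
  · exact hm
  · exact (smul_eq_zero.mp hx).resolve_right one_tmul_central_ne_zero

lemma NZ.eq_ofPos (k : NZ) (h : 0 < k.1) : ∃ m : ℕ+, k = NZ.ofPos m :=
  ⟨⟨k.1.toNat, by omega⟩, Subtype.ext (by simp only [NZ.ofPos, PNat.mk_coe]; omega)⟩

lemma NZ.eq_neg_ofPos (k : NZ) (h : k.1 < 0) : ∃ m : ℕ+, k = -NZ.ofPos m :=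
  ⟨⟨(-k.1).toNat, by omega⟩, Subtype.ext (by
    change k.1 = -((-k.1).toNat : ℤ)
    omega)⟩

lemma diagonal_diagFam_none : Matrix.diagonal (diagFam n none) = 1 := Matrix.diagonal_one

lemma diagonal_diagFam_some (i : Fin n) : Matrix.diagonal (diagFam n (some i)) =
    Matrix.single i.castSucc i.castSucc 1 - Matrix.single i.succ i.succ 1 := by
  rw [← Matrix.diagonal_single, ← Matrix.diagonal_single, Matrix.diagonal_sub]
  rfl

lemma isHeisEmbedding_heisHom : IsHeisEmbedding (heisHom n) where
  one_neg k := by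
    have h : (-NZ.ofPos k).1 = -(k : ℤ) := rfl
    have hk := k.pos
    rw [heisHom_p, show (1 : HTK n) = classFam n none from rfl, heisModes_single,
      diagonal_diagFam_none, heisCoeff, if_pos (by rw [h]; omega), h]
  one_pos k := by
    have h : (NZ.ofPos k).1 = (k : ℤ) := rfl
    rw [heisHom_p, show (1 : HTK n) = classFam n none from rfl, heisModes_single,
      diagonal_diagFam_none, heisCoeff, if_neg (by rw [h]; omega), h]
  curve k i := by
    rw [heisHom_p, show 1 ⊗ₜ curveClass n i = classFam n (some i) from rfl, heisModes_single,
      diagonal_diagFam_some, heisCoeff]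
  central := by
    rw [heisHom_apply, Heis.central, map_zero, zero_add, one_smul]

/-- The inclusion of the span of the Heisenberg operators in `ℋ`. -/
def heisIncl (n : ℕ) : (NZ →₀ HTK n) →ₗ[EqField] Heis n where
  toFun u := ⟨u, 0⟩
  map_add' u v := by ext1 <;> simp
  map_smul' r u := by ext1 <;> simp

lemma IsHeisEmbedding.ext {φ ψ : Heis n →ₗ⁅EqField⁆ EqField ⊗[ℚ] AffineGl n} (hφ : IsHeisEmbedding φ)
    (hψ : IsHeisEmbedding ψ) : ψ = φ := by
  have h : ψ.toLinearMap ∘ₗ heisIncl n = φ.toLinearMap ∘ₗ heisIncl n := by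
    refine Finsupp.lhom_ext' fun k => (classBasis n).ext fun o => ?_
    rw [classBasis_apply]
    change ψ (Heis.p k (classFam n o)) = φ (Heis.p k (classFam n o))
    rcases o with _ | i
    · rcases lt_or_gt_of_ne k.2 with hk | hk
      · obtain ⟨m, rfl⟩ := NZ.eq_neg_ofPos k hk
        exact (hψ.one_neg m).trans (hφ.one_neg m).symm
      · obtain ⟨m, rfl⟩ := NZ.eq_ofPos k hk
        exact (hψ.one_pos m).trans (hφ.one_pos m).symm
    · exact (hψ.curve k i).trans (hφ.curve k i).symm
  ext x
  have hx : x = heisIncl n x.modes + x.c • Heis.central n := by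
    ext1 <;> simp [heisIncl, Heis.central]
  rw [hx, map_add, map_add, map_smul, map_smul, hφ.central, hψ.central]
  exact congrArg (· + _) congr($h x.modes)

end HeisEmbedding

/-! ### Degree filtration and irreducibility of Fock space -/

section FockFiltration
variable {n : ℕ}

/-- The constants and the generators of Fock space. -/
def lowDegree (n : ℕ) : Submodule EqField (FockK n) := 1 ⊔ LinearMap.range (creator n)

/-- The polynomials of degree less than `d` in the creation operators. -/
def degLT (n : ℕ) : ℕ → Submodule EqField (FockK n)
  | 0 => ⊥
  | d + 1 => lowDegree n ^ d

lemma algebraMap_mem_lowDegree (r : EqField) : algebraMap EqField (FockK n) r ∈ lowDegree n :=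
  Submodule.mem_sup_left (Submodule.mem_one.mpr ⟨r, rfl⟩)

lemma creator_mem_lowDegree (u : NZ →₀ HTK n) : creator n u ∈ lowDegree n :=
  Submodule.mem_sup_right ⟨u, rfl⟩

lemma mem_lowDegree {f : FockK n} (h : f ∈ lowDegree n) :
    ∃ (r : EqField) (u : NZ →₀ HTK n), f = algebraMap EqField (FockK n) r + creator n u := by
  obtain ⟨a, ha, b, ⟨u, rfl⟩, rfl⟩ := Submodule.mem_sup.mp h
  obtain ⟨r, rfl⟩ := Submodule.mem_one.mp ha
  exact ⟨r, u, rfl⟩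

lemma mul_mem_degLT {d : ℕ} {x f : FockK n} (hx : x ∈ lowDegree n) (hf : f ∈ degLT n d) :
    x * f ∈ degLT n (d + 1) := by
  cases d with
  | zero => rw [(Submodule.mem_bot _).mp hf, mul_zero]; exact zero_mem _
  | succ d => rw [degLT, pow_succ']; exact Submodule.mul_mem_mul hx hf

lemma degLT_succ_induction {P : ℕ → FockK n → Prop} (hadd : ∀ d f g, P d f → P d g → P d (f + g))
    (hc : ∀ r, P 0 (algebraMap EqField (FockK n) r))
    (hmul : ∀ d, ∀ x ∈ lowDegree n, ∀ f ∈ degLT n (d + 1), P d f → P (d + 1) (x * f)) (d : ℕ) {f : FockK n}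
    (hf : f ∈ degLT n (d + 1)) : P d f := by
  induction d generalizing f with
  | zero =>
    rw [degLT, pow_zero] at hf
    obtain ⟨r, rfl⟩ := Submodule.mem_one.mp hf
    exact hc r
  | succ d ih =>
    rw [degLT, pow_succ'] at hf
    induction hf using Submodule.mul_induction_on' with
    | mem_mul_mem x hx f hf => exact hmul d x hx f hf (ih hf)
    | add x _ y _ hx hy => exact hadd _ _ _ hx hy

lemma toFockK_creation_single (k : ℕ+) (γ : HT n) :
    toFockK n (creation n (.single k γ)) = creator n (.single (-NZ.ofPos k) (1 ⊗ₜ γ)) := by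
  have hk : (-NZ.ofPos k).1 < 0 := by
    have := k.pos
    change -(k : ℤ) < 0
    omega
  have h2 : negPNat (-NZ.ofPos k) hk = k := by
    apply PNat.coe_injective
    change (- -(k : ℤ)).toNat = k
    omega
  simp [creator, hk, Finsupp.lsingle_apply, h2]

lemma creationEmb_single_eq (k : ℕ+) (γ : HT n) :
    creationEmb n (.single k γ) = .single (-NZ.ofPos k) (1 ⊗ₜ γ) :=
  creationEmb_single n k γ

lemma toFockK_creation (m : ℕ+ →₀ HT n) : toFockK n (creation n m) = creator n (creationEmb n m) := by
  induction m using Finsupp.induction_linear with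
  | zero => simp
  | add m m' h h' => simp only [map_add, h, h']
  | single k γ => rw [toFockK_creation_single, creationEmb_single_eq]

lemma exists_mem_pow_lowDegree (f : FockK n) : ∃ d, f ∈ lowDegree n ^ d := by
  have h1 : (1 : FockK n) ∈ lowDegree n := by
    simpa using algebraMap_mem_lowDegree (n := n) 1
  have hle : ∀ d e, lowDegree n ^ d ≤ lowDegree n ^ (d + e) := by
    intro d e f hf
    rw [pow_add, ← mul_one f]
    refine Submodule.mul_mem_mul hf ?_
    simpa using Submodule.pow_mem_pow _ h1 e
  induction f using fock_induction with
  | hc r => exact ⟨1, by simpa using algebraMap_mem_lowDegree r⟩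
  | hι m => exact ⟨1, by simpa [toFockK_creation] using creator_mem_lowDegree _⟩
  | hmul f g hf hg =>
    obtain ⟨d, hd⟩ := hf
    obtain ⟨e, he⟩ := hg
    exact ⟨d + e, by rw [pow_add]; exact Submodule.mul_mem_mul hd he⟩
  | hadd f g hf hg =>
    obtain ⟨d, hd⟩ := hf
    obtain ⟨e, he⟩ := hg
    exact ⟨d + e, add_mem (hle d e hd) (add_comm e d ▸ hle e d he)⟩

lemma annihilator_creator_of_pos (k : NZ) (hk : 0 < k.1) (γ : HTK n) (u : NZ →₀ HTK n) :
    annihilator n (.single k γ) (creator n u) =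
      algebraMap EqField (FockK n) (heisCocycle n (.single k γ) u) := by
  have h := annihilator_creator_sub (.single k γ) u
  rwa [creator_of_pos k (by omega), map_zero, sub_zero] at h

/-- A derivation that sends generators to scalars lowers the degree by one. The filtration starts
with the zero space, so that constants fit the same statement. -/
lemma annihilator_mem_degLT {k : NZ} (hk : 0 < k.1) (γ : HTK n) (d : ℕ) {f : FockK n}
    (hf : f ∈ degLT n (d + 1)) : annihilator n (.single k γ) f ∈ degLT n d := by
  refine degLT_succ_induction (P := fun d f => annihilator n (.single k γ) f ∈ degLT n d)
    (fun d f g hf hg => ?_) (fun r => ?_) (fun d x hx f hf ih => ?_) d hf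
  · rw [map_add]; exact add_mem hf hg
  · rw [annihilator_algebraMap]; exact zero_mem _
  · obtain ⟨r, u, rfl⟩ := mem_lowDegree hx
    rw [annihilator_mul, map_add, annihilator_algebraMap, zero_add, annihilator_creator_of_pos k hk,
      mul_comm f, ← Algebra.smul_def]
    exact add_mem (mul_mem_degLT hx ih) (Submodule.smul_mem _ _ hf)

lemma exists_pairing_eq_coord (o : Option (Fin n)) : ∃ γ, pairing n γ = (classBasis n).coord o := by
  have hinj : Function.Injective (pairing n) := by
    rw [injective_iff_map_eq_zero]
    exact fun γ h => pairing_nondegenerate fun γ' => by rw [h, LinearMap.zero_apply]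
  have hfr : Module.finrank EqField (HTK n) = Module.finrank EqField (HTK n →ₗ[EqField] EqField) :=
    Subspace.dual_finrank_eq.symm
  exact (LinearMap.injective_iff_surjective_of_finrank_eq_finrank hfr).mp hinj _

/-- The basis dual to `1, E_1, …, E_n` for the Poincaré pairing. -/
def dualClass (o : Option (Fin n)) : HTK n := (exists_pairing_eq_coord o).choose

lemma pairing_dualClass (o : Option (Fin n)) : pairing n (dualClass o) = (classBasis n).coord o :=
  (exists_pairing_eq_coord o).choose_spec

/-- The partial Euler operator `∑_{k ∈ s} ∑_o 𝔭_{-k}(E_o) (-1/k) 𝔭_k(E_o^*)`. -/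
def eulerOn (s : Finset ℕ+) (f : FockK n) : FockK n :=
  ∑ k ∈ s, ∑ o, creator n (.single (-NZ.ofPos k) (classBasis n o)) *
    ((-((k : ℕ) : EqField))⁻¹ • annihilator n (.single (NZ.ofPos k) (dualClass o)) f)

lemma eulerOn_add (s : Finset ℕ+) (f g : FockK n) : eulerOn s (f + g) = eulerOn s f + eulerOn s g := by
  simp only [eulerOn, map_add, smul_add, mul_add, Finset.sum_add_distrib]

lemma eulerOn_mul (s : Finset ℕ+) (f g : FockK n) :
    eulerOn s (f * g) = f * eulerOn s g + g * eulerOn s f := by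
  simp only [eulerOn, annihilator_mul, smul_add, mul_add, Finset.sum_add_distrib, Finset.mul_sum,
    mul_smul_comm, mul_left_comm _ (creator n _)]

lemma eulerOn_algebraMap (s : Finset ℕ+) (r : EqField) :
    eulerOn s (algebraMap EqField (FockK n) r) = 0 := by
  simp only [eulerOn, annihilator_algebraMap, smul_zero, mul_zero, Finset.sum_const_zero]

lemma ofPos_pos (k : ℕ+) : 0 < (NZ.ofPos k).1 := by
  have := k.pos
  change 0 < (k : ℤ)
  omega

/-- The commutator contributes $-k$ times the pairing, which the factor $-1/k$ normalises. Summing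
over dual bases then reproduces the class. -/
lemma eulerOn_creator_single (s : Finset ℕ+) (k : ℕ+) (hk : k ∈ s) (γ : HTK n) :
    eulerOn s (creator n (.single (-NZ.ofPos k) γ)) = creator n (.single (-NZ.ofPos k) γ) := by
  have hk0 : -((k : ℕ) : EqField) ≠ 0 := neg_ne_zero.mpr (Nat.cast_ne_zero.mpr k.ne_zero)
  rw [eulerOn, Finset.sum_eq_single_of_mem k hk]
  · have h : ∀ o, creator n (.single (-NZ.ofPos k) (classBasis n o)) *
        ((-((k : ℕ) : EqField))⁻¹ • annihilator n (.single (NZ.ofPos k) (dualClass o))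
          (creator n (.single (-NZ.ofPos k) γ))) =
        creator n (.single (-NZ.ofPos k) ((classBasis n).repr γ o • classBasis n o)) := by
      intro o
      have hc : ((NZ.ofPos k).1 : EqField) = ((k : ℕ) : EqField) := by
        change (((k : ℕ) : ℤ) : EqField) = _
        exact Int.cast_natCast _
      rw [annihilator_creator_of_pos _ (ofPos_pos k), heisCocycle_single_neg, Finsupp.single_eq_same,
        pairing_dualClass, Module.Basis.coord_apply, hc, ← Finsupp.smul_single, map_smul,
        Algebra.algebraMap_eq_smul_one, smul_smul, inv_mul_cancel_left₀ hk0, mul_smul_comm, mul_one]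
    rw [Finset.sum_congr rfl fun o _ => h o, ← map_sum, ← Finsupp.single_finsetSum,
      (classBasis n).sum_repr]
  · intro l _ hl
    refine Finset.sum_eq_zero fun o _ => ?_
    rw [annihilator_creator_of_pos _ (ofPos_pos l), heisCocycle_single_neg, Finsupp.single_eq_of_ne,
      map_zero, LinearMap.zero_apply, mul_zero, map_zero, smul_zero, mul_zero]
    intro h
    apply hl
    have h1 := congrArg Subtype.val h
    change (k : ℤ) = l at h1
    exact PNat.coe_injective (by omega)

lemma exists_eulerOn_creator (u : NZ →₀ HTK n) :
    ∃ s₀ : Finset ℕ+, ∀ s, s₀ ⊆ s → eulerOn s (creator n u) = creator n u := by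
  induction u using Finsupp.induction_linear with
  | zero => exact ⟨∅, fun s _ => by simpa using eulerOn_algebraMap s 0⟩
  | add u v hu hv =>
    obtain ⟨s, hs⟩ := hu
    obtain ⟨s', hs'⟩ := hv
    refine ⟨s ∪ s', fun r hr => ?_⟩
    rw [map_add, eulerOn_add, hs r (Finset.union_subset_left hr), hs' r (Finset.union_subset_right hr)]
  | single k γ =>
    rcases lt_or_gt_of_ne k.2 with hk | hk
    · obtain ⟨m, rfl⟩ := NZ.eq_neg_ofPos k hk
      exact ⟨{m}, fun s hs => eulerOn_creator_single s m (hs (Finset.mem_singleton_self m)) γ⟩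
    · rw [creator_of_pos k (by omega)]
      exact ⟨∅, fun s _ => by simpa using eulerOn_algebraMap s 0⟩

/-- The Euler operator is a derivation fixing the generators, so it acts by the degree up to terms
of lower degree. The partial sum suffices once `s` contains all modes that occur in `f`. -/
lemma exists_eulerOn_sub_mem (d : ℕ) {f : FockK n} (hf : f ∈ degLT n (d + 1)) :
    ∃ s₀ : Finset ℕ+, ∀ s, s₀ ⊆ s → eulerOn s f - d • f ∈ degLT n d := by
  refine degLT_succ_induction
    (P := fun d f => ∃ s₀ : Finset ℕ+, ∀ s, s₀ ⊆ s → eulerOn s f - d • f ∈ degLT n d)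
    (fun d f g hf hg => ?_) (fun r => ?_) (fun d x hx f hf ih => ?_) d hf
  · obtain ⟨s, hs⟩ := hf
    obtain ⟨s', hs'⟩ := hg
    refine ⟨s ∪ s', fun r hr => ?_⟩
    rw [eulerOn_add, smul_add, add_sub_add_comm]
    exact add_mem (hs r (Finset.union_subset_left hr)) (hs' r (Finset.union_subset_right hr))
  · refine ⟨∅, fun s _ => ?_⟩
    rw [eulerOn_algebraMap, zero_smul, sub_zero]
    exact zero_mem _
  · obtain ⟨r, u, rfl⟩ := mem_lowDegree hx
    obtain ⟨s, hs⟩ := exists_eulerOn_creator u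
    obtain ⟨s', hs'⟩ := ih
    refine ⟨s ∪ s', fun t ht => ?_⟩
    have h1 := hs' t (Finset.union_subset_right ht)
    have h2 := mul_mem_degLT hx h1
    have h3 := Submodule.smul_mem _ r hf
    rw [eulerOn_mul, eulerOn_add, eulerOn_algebraMap, zero_add, hs t (Finset.union_subset_left ht)]
    convert sub_mem h2 h3 using 1
    rw [Algebra.smul_def r f]
    simp only [nsmul_eq_mul]
    push_cast
    ring

/-- Descent on the degree. If some annihilation operator does not kill $f$, its value is a nonzero
element of `N` of lower degree. If all of them kill $f$, so does the Euler operator; then $d\cdot f$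
has degree less than $d$, and so does $f$ because the characteristic is zero, unless $d=0$ and $f$
is a nonzero constant. -/
lemma one_mem_of_annihilator_mem {N : Submodule EqField (FockK n)}
    (hN : ∀ k : NZ, 0 < k.1 → ∀ γ, ∀ f ∈ N, annihilator n (.single k γ) f ∈ N) {f : FockK n} (hf : f ∈ N)
    (hf0 : f ≠ 0) : (1 : FockK n) ∈ N := by
  have key : ∀ d, ∀ f ∈ degLT n d, f ∈ N → f ≠ 0 → (1 : FockK n) ∈ N := by
    intro d
    induction d with
    | zero => exact fun f hd _ h0 => absurd ((Submodule.mem_bot _).mp hd) h0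
    | succ d ih =>
      intro f hd hf h0
      by_cases h : ∃ k : NZ, 0 < k.1 ∧ ∃ γ, annihilator n (.single k γ) f ≠ 0
      · obtain ⟨k, hk, γ, hγ⟩ := h
        exact ih _ (annihilator_mem_degLT hk γ d hd) (hN k hk γ f hf) hγ
      · push Not at h
        obtain ⟨s, hs⟩ := exists_eulerOn_sub_mem d hd
        have h1 : eulerOn s f = 0 := Finset.sum_eq_zero fun k _ => Finset.sum_eq_zero fun o _ => by
          rw [h _ (ofPos_pos k), smul_zero, mul_zero]
        have h2 := hs s subset_rfl
        rw [h1, zero_sub, neg_mem_iff] at h2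
        cases d with
        | zero =>
          rw [degLT, pow_zero] at hd
          obtain ⟨r, rfl⟩ := Submodule.mem_one.mp hd
          have hr : r ≠ 0 := by rintro rfl; exact h0 (map_zero _)
          have h3 := Submodule.smul_mem _ r⁻¹ hf
          rwa [Algebra.algebraMap_eq_smul_one, inv_smul_smul₀ hr] at h3
        | succ d =>
          refine ih f ?_ hf h0
          have hd0 : ((d + 1 : ℕ) : EqField) ≠ 0 := Nat.cast_ne_zero.mpr d.succ_ne_zero
          rw [← Nat.cast_smul_eq_nsmul EqField] at h2
          have h3 := Submodule.smul_mem _ ((d + 1 : ℕ) : EqField)⁻¹ h2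
          rwa [inv_smul_smul₀ hd0] at h3
  obtain ⟨d, hd⟩ := exists_mem_pow_lowDegree f
  exact key (d + 1) f hd hf hf0

end FockFiltration

/-! ### Intertwiners out of Fock space -/

section FockHom
variable {n : ℕ} {V : Type*} [AddCommGroup V] [Module EqField V]
  {op : (NZ →₀ HTK n) →ₗ[EqField] Module.End EqField V}

lemma heisCocycle_creationEmb (m m' : ℕ+ →₀ HT n) :
    heisCocycle n (creationEmb n m) (creationEmb n m') = 0 := by
  induction m using Finsupp.induction_linear with
  | zero => simp
  | add m₁ m₂ h₁ h₂ => rw [map_add, map_add, LinearMap.add_apply, h₁, h₂, add_zero]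
  | single k γ =>
    rw [creationEmb_single]
    have := k.pos
    exact heisCocycle_creationEmb_of_neg _ (by simp only; omega) _ _

/-- A homomorphism of algebras out of Fock space is determined by commuting creation operators. -/
lemma exists_fockHom (A : Type*) [CommRing A] [Algebra EqField A] (g : (ℕ+ →₀ HT n) →+ A)
    (hg : ∀ (r : EqRing) m, g (r • m) = algebraMap EqRing EqField r • g m) :
    ∃ L : FockK n →ₐ[EqField] A, ∀ m, L (toFockK n (creation n m)) = g m := by
  let : Algebra EqRing A := ((algebraMap EqField A).comp (algebraMap EqRing EqField)).toAlgebra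
  have : IsScalarTower EqRing EqField A := IsScalarTower.of_algebraMap_eq' rfl
  let g' : (ℕ+ →₀ HT n) →ₗ[EqRing] A :=
    { toFun := g
      map_add' := map_add g
      map_smul' := fun r m => by rw [hg, algebraMap_smul, RingHom.id_apply] }
  let F : Fock n →ₐ[EqRing] A := (creation_isSymmetricAlgebra n).lift g'
  let L : EqField ⊗[EqRing] Fock n →ₐ[EqField] A :=
    Algebra.TensorProduct.lift (Algebra.ofId EqField A) F fun _ _ => Commute.all _ _
  refine ⟨L, fun m => ?_⟩
  have h1 : L ((1 : EqField) ⊗ₜ[EqRing] creation n m) = F (creation n m) := by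
    rw [Algebra.TensorProduct.lift_tmul, map_one, one_mul]
  exact h1.trans ((creation_isSymmetricAlgebra n).lift_eq g' m)

/-- The universal property of Fock space needs a commutative target. The creation operators commute,
so the subalgebra of endomorphisms that they generate serves. -/
lemma exists_fockHom_end (hop : ∀ u v, op u * op v = op v * op u + heisCocycle n u v • 1) :
    ∃ L : FockK n →ₐ[EqField] Module.End EqField V, ∀ m,
      L (toFockK n (creation n m)) = op (creationEmb n m) := by
  let s : Set (Module.End EqField V) := Set.range fun m => op (creationEmb n m)
  have hs : ∀ a ∈ s, ∀ b ∈ s, a * b = b * a := by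
    rintro _ ⟨m, rfl⟩ _ ⟨m', rfl⟩
    simp only
    rw [hop, heisCocycle_creationEmb, zero_smul, add_zero]
  have hcomm := Algebra.isMulCommutative_adjoin EqField hs
  let : CommRing (Algebra.adjoin EqField s) := { mul_comm := hcomm.is_comm.comm }
  let g : (ℕ+ →₀ HT n) →+ Algebra.adjoin EqField s :=
    { toFun := fun m => ⟨op (creationEmb n m), Algebra.subset_adjoin ⟨m, rfl⟩⟩
      map_zero' := Subtype.ext (by simp)
      map_add' := fun m m' => Subtype.ext (by simp) }
  obtain ⟨L, hL⟩ := exists_fockHom (n := n) (Algebra.adjoin EqField s) g fun r m => Subtype.ext (by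
    change op (creationEmb n (r • m)) = algebraMap EqRing EqField r • op (creationEmb n m)
    rw [map_smul, ← algebraMap_smul EqField r (creationEmb n m), map_smul])
  exact ⟨(Algebra.adjoin EqField s).val.comp L, fun m => congrArg Subtype.val (hL m)⟩

variable (L : FockK n →ₐ[EqField] Module.End EqField V)

lemma fockHom_creator_single (hL : ∀ m, L (toFockK n (creation n m)) = op (creationEmb n m))
    (k : NZ) (hk : k.1 < 0) (γ : HTK n) : L (creator n (.single k γ)) = op (.single k γ) := by
  obtain ⟨m, rfl⟩ := NZ.eq_neg_ofPos k hk
  induction γ using TensorProduct.induction_on with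
  | zero => simp
  | add x y hx hy => simp only [Finsupp.single_add, map_add, hx, hy]
  | tmul a γ =>
    have h : (a ⊗ₜ[EqRing] γ : HTK n) = a • (1 ⊗ₜ γ) := by simp [TensorProduct.smul_tmul']
    rw [h, ← Finsupp.smul_single, map_smul, map_smul, map_smul, ← toFockK_creation_single, hL,
      creationEmb_single_eq]

/-- Taking the commutator with `op u` and applying the annihilation part of `u` are both
derivations, and they agree on the generators by the Heisenberg relations. -/
lemma op_mul_fockHom (hop : ∀ u v, op u * op v = op v * op u + heisCocycle n u v • 1)
    (hL : ∀ m, L (toFockK n (creation n m)) = op (creationEmb n m)) (u : NZ →₀ HTK n) (f : FockK n) :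
    op u * L f = L f * op u + L (annihilator n u f) := by
  induction f using fock_induction with
  | hc r => rw [AlgHom.commutes, annihilator_algebraMap, map_zero, add_zero, Algebra.commutes]
  | hι m => rw [hL, hop, annihilator_ι, AlgHom.commutes, Algebra.algebraMap_eq_smul_one]
  | hmul f g hf hg =>
    rw [map_mul, ← mul_assoc, hf, add_mul, mul_assoc, hg, annihilator_mul, map_add, map_mul,
      mul_comm g, map_mul, mul_add]
    noncomm_ring
  | hadd f g hf hg => rw [map_add, mul_add, hf, hg, map_add, map_add, add_mul]; abel

/-- The intertwiner from Fock space defined by a vacuum vector. -/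
def fockIntertwiner (v : V) : FockK n →ₗ[EqField] V := LinearMap.applyₗ v ∘ₗ L.toLinearMap

variable {L} {v : V}

lemma op_fockIntertwiner (hop : ∀ u v, op u * op v = op v * op u + heisCocycle n u v • 1)
    (hL : ∀ m, L (toFockK n (creation n m)) = op (creationEmb n m))
    (hv : ∀ k : NZ, 0 < k.1 → ∀ γ, op (.single k γ) v = 0) (u : NZ →₀ HTK n) (f : FockK n) :
    op u (fockIntertwiner L v f) = fockIntertwiner L v (creator n u * f + annihilator n u f) := by
  induction u using Finsupp.induction_linear with
  | zero =>
    have h0 : annihilator n (0 : NZ →₀ HTK n) f = 0 := by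
      simpa using annihilator_smul (0 : EqField) (0 : NZ →₀ HTK n) f
    simp [h0]
  | add u w hu hw =>
    rw [map_add, LinearMap.add_apply, hu, hw, ← map_add, map_add (creator n), annihilator_add]
    congr 1
    ring
  | single k γ =>
    have h : op (.single k γ) (L f v) =
        L f (op (.single k γ) v) + L (annihilator n (.single k γ) f) v :=
      congr($(op_mul_fockHom L hop hL (.single k γ) f) v)
    change op (.single k γ) (L f v) = L _ v
    rcases lt_or_gt_of_ne k.2 with hk | hk
    · rw [h, annihilator_of_neg k hk, map_zero, LinearMap.zero_apply, add_zero, add_zero, mul_comm,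
        map_mul, fockHom_creator_single L hL k hk]
      rfl
    · rw [h, hv k hk, map_zero, zero_add, creator_of_pos k (by omega), zero_mul, zero_add]

lemma fockIntertwiner_one : fockIntertwiner L v 1 = v := by
  change L 1 v = v
  rw [map_one]
  rfl

/-- The kernel is stable under annihilation, so if it were nonzero it would contain the vacuum,
whose image is $v\ne0$. -/
lemma fockIntertwiner_injective (hop : ∀ u v, op u * op v = op v * op u + heisCocycle n u v • 1)
    (hL : ∀ m, L (toFockK n (creation n m)) = op (creationEmb n m))
    (hv : ∀ k : NZ, 0 < k.1 → ∀ γ, op (.single k γ) v = 0) (hv0 : v ≠ 0) :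
    Function.Injective (fockIntertwiner L v) := by
  rw [← LinearMap.ker_eq_bot, Submodule.eq_bot_iff]
  intro f hf
  by_contra hf0
  have h := one_mem_of_annihilator_mem (N := LinearMap.ker (fockIntertwiner L v))
    (fun k hk γ f hf => by
      have h1 := op_fockIntertwiner hop hL hv (.single k γ) f
      rw [LinearMap.mem_ker.mp hf, map_zero, creator_of_pos k (by omega), zero_mul, zero_add] at h1
      exact h1.symm) hf hf0
  rw [LinearMap.mem_ker, fockIntertwiner_one] at h
  exact hv0 h

/-- An endomorphism of Fock space that commutes with the Heisenberg operators and fixes the vacuum is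
the identity. -/
lemma eq_id_of_commutes {F : FockK n →ₗ[EqField] FockK n} (h : ∀ (x : Heis n) f, F ⁅x, f⁆ = ⁅x, F f⁆)
    (h1 : F 1 = 1) (f : FockK n) : F f = f := by
  have hcr : ∀ m f, F (toFockK n (creation n m) * f) = toFockK n (creation n m) * F f := by
    intro m f
    induction m using Finsupp.induction_linear with
    | zero => simp
    | add m m' hm hm' => simp only [map_add, add_mul, hm, hm']
    | single k γ =>
      have h2 := h (Heis.p (-NZ.ofPos k) (1 ⊗ₜ γ)) f
      have hk : (-NZ.ofPos k).1 < 0 := neg_lt_zero.mpr (ofPos_pos k)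
      simpa only [heis_lie_def, Heis.p, annihilator_of_neg _ hk, zero_smul, add_zero,
        ← toFockK_creation_single] using h2
  have key : ∀ f g, F (f * g) = f * F g := by
    intro f
    induction f using fock_induction with
    | hc r => intro g; rw [← Algebra.smul_def, map_smul, Algebra.smul_def]
    | hι m => exact hcr m
    | hmul f f' hf hf' => intro g; rw [mul_assoc, hf, hf', mul_assoc]
    | hadd f f' hf hf' => intro g; rw [add_mul, map_add, hf, hf', add_mul]
  have := key f 1
  rwa [mul_one, h1, mul_one] at this

end FockHom

/-! ### The Heisenberg action on $W$ and the isomorphism -/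

section HeisModule
variable {n : ℕ}

/-- The action of `𝔭_k(γ)` on `V_Λ ⊗ ℚ(t₁, t₂)`. -/
def heisOp (n : ℕ) : (NZ →₀ HTK n) →ₗ[EqField] Module.End EqField (EqField ⊗[ℚ] BasicRep n) :=
  affAction n ∘ₗ heisModes n

lemma affAction_central (w : EqField ⊗[ℚ] BasicRep n) : affAction n (1 ⊗ₜ AffineGl.central n) w = w := by
  induction w using TensorProduct.induction_on with
  | zero => exact map_zero _
  | tmul a w => rw [affAction_tmul, one_mul, central_smul]
  | add x y hx hy => rw [map_add, hx, hy]

lemma heisOp_mul (u v : NZ →₀ HTK n) :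
    heisOp n u * heisOp n v = heisOp n v * heisOp n u + heisCocycle n u v • 1 := by
  refine LinearMap.ext fun w => ?_
  have h := affAction_lie (heisModes n u) (heisModes n v) w
  rw [heisModes_lie, map_smul, LinearMap.smul_apply, affAction_central] at h
  exact (sub_eq_iff_eq_add'.mp h.symm)

lemma lie_heisHom (x : Heis n) (w : EqField ⊗[ℚ] BasicRep n) :
    ⁅heisHom n x, w⁆ = heisOp n x.modes w + x.c • w := by
  change affAction n (heisHom n x) w = _
  rw [heisHom_apply, map_add, LinearMap.add_apply, map_smul, LinearMap.smul_apply, affAction_central]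
  rfl

/-- An induction principle: a linear condition on Heisenberg modes can be checked on generators. -/
lemma modes_induction {P : Submodule EqField (NZ →₀ HTK n)}
    (h : ∀ k o, Finsupp.single k (classFam n o) ∈ P) (u : NZ →₀ HTK n) : u ∈ P := by
  induction u using Finsupp.induction_linear with
  | zero => exact zero_mem _
  | add u v hu hv => exact add_mem hu hv
  | single k γ =>
    rw [← (classBasis n).sum_repr γ, Finsupp.single_finsetSum]
    refine sum_mem fun o _ => ?_
    rw [← Finsupp.smul_single, classBasis_apply]
    exact Submodule.smul_mem _ _ (h k o)

lemma heisOp_single_tmul (k : NZ) (o : Option (Fin n)) (a : EqField) (w : BasicRep n) :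
    heisOp n (.single k (classFam n o)) (a ⊗ₜ w) =
      (heisCoeff n k o * a) ⊗ₜ (ue (AffineGl.mode (Matrix.diagonal (diagFam n o)) k.1) • w) := by
  rw [heisOp, LinearMap.comp_apply, heisModes_single, affAction_tmul]

lemma heisOp_mem_WK (u : NZ →₀ HTK n) {w : EqField ⊗[ℚ] BasicRep n} (hw : w ∈ WK n) :
    heisOp n u w ∈ WK n := by
  refine modes_induction (P := (WK n).comap ((heisOp n).flip w)) (fun k o => ?_) u
  change heisOp n _ w ∈ WK n
  rw [WK, Submodule.baseChange_eq_span] at hw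
  induction hw using Submodule.span_induction with
  | mem x hx =>
    obtain ⟨w, hw, rfl⟩ := hx
    exact (heisOp_single_tmul k o 1 w).symm ▸
      Submodule.tmul_mem_baseChange_of_mem _ (diagonal_smul_mem_zeroWeightSum hw _ k.2)
  | zero => rw [map_zero]; exact zero_mem _
  | add x y _ _ hx hy => rw [map_add]; exact add_mem hx hy
  | smul a x _ hx => rw [map_smul]; exact Submodule.smul_mem _ _ hx

lemma heisOp_hwVectorK (k : NZ) (hk : 0 < k.1) (γ : HTK n) : heisOp n (.single k γ) (hwVectorK n) = 0 := by
  rw [← (classBasis n).sum_repr γ, Finsupp.single_finsetSum, map_sum, LinearMap.sum_apply]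
  refine Finset.sum_eq_zero fun o _ => ?_
  rw [← Finsupp.smul_single, map_smul, LinearMap.smul_apply, classBasis_apply, hwVectorK,
    heisOp_single_tmul, hwVector_isVacuum.mode _ _ hk.le, TensorProduct.tmul_zero, smul_zero]

lemma hwVectorK_mem : hwVectorK n ∈ WK n :=
  Submodule.tmul_mem_baseChange_of_mem _ hwVector_mem_zeroWeightSum

lemma hwVectorK_ne_zero : hwVectorK n ≠ 0 := fun h =>
  hwVector_ne_zero (one_tmul_injective (BasicRep n) (by simpa [hwVectorK] using h))

lemma heisCoeff_ne_zero (k : NZ) (o : Option (Fin n)) : heisCoeff n k o ≠ 0 := by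
  rcases o with _ | i
  · have hn : (n : EqField) + 1 ≠ 0 := by exact_mod_cast n.succ_ne_zero
    rw [heisCoeff, map_mul]
    split_ifs
    · exact one_ne_zero
    · exact neg_ne_zero.mpr (inv_ne_zero (mul_ne_zero (pow_ne_zero _ hn)
        (mul_ne_zero t₁_ne_zero t₂_ne_zero)))
  · exact one_ne_zero

/-- The map `D ↦ diag(D)(k)`. -/
def diagMode (n : ℕ) (k : ℤ) : (Fin (n + 1) → ℚ) →ₗ[ℚ] EqField ⊗[ℚ] AffineGl n :=
  TensorProduct.mk ℚ EqField (AffineGl n) 1 ∘ₗ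
    { toFun := fun D => AffineGl.mode (Matrix.diagonal D) k
      map_add' := fun D D' => by
        rw [show Matrix.diagonal (D + D') = _ from (Matrix.diagonal_add D D').symm]
        ext1
        · exact Finsupp.single_add k _ _
        · exact (add_zero _).symm
        · exact (add_zero _).symm
      map_smul' := fun r D => by
        rw [Matrix.diagonal_smul]
        ext1 <;> simp [AffineGl.mode] }

lemma diagMode_apply (k : ℤ) (D : Fin (n + 1) → ℚ) :
    diagMode n k D = 1 ⊗ₜ AffineGl.mode (Matrix.diagonal D) k := rfl

/-- Sums of the simple differences give every $e_a-e_b$, and $(n+1)e_a=\sum_be_b+\sum_b(e_a-e_b)$.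
-/
lemma single_mem_of_diagFam_mem {P : Submodule ℚ (Fin (n + 1) → ℚ)} (h : ∀ o, diagFam n o ∈ P)
    (a : Fin (n + 1)) : Pi.single a 1 ∈ P := by
  have h0 : ∀ b : Fin (n + 1), (Pi.single 0 1 - Pi.single b 1 : Fin (n + 1) → ℚ) ∈ P := by
    intro b
    induction b using Fin.induction with
    | zero => rw [sub_self]; exact zero_mem _
    | succ i ih =>
      rw [← sub_add_sub_cancel _ (Pi.single i.castSucc 1)]
      exact add_mem ih (h (some i))
  have h1 : ∀ b : Fin (n + 1), (Pi.single a 1 - Pi.single b 1 : Fin (n + 1) → ℚ) ∈ P := by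
    intro b
    rw [← sub_sub_sub_cancel_left _ _ (Pi.single 0 1)]
    exact sub_mem (h0 b) (h0 a)
  have h2 : ((n + 1 : ℕ) : ℚ) • (Pi.single a 1 : Fin (n + 1) → ℚ) =
      diagFam n none + ∑ b, (Pi.single a 1 - Pi.single b 1 : Fin (n + 1) → ℚ) := by
    rw [Finset.sum_sub_distrib, Finset.sum_const, Finset.card_univ, Fintype.card_fin, diagFam,
      Nat.cast_smul_eq_nsmul]
    have : ∑ b : Fin (n + 1), (Pi.single b 1 : Fin (n + 1) → ℚ) = 1 := Finset.univ_sum_single 1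
    rw [this, add_sub_cancel]
  have h3 : ((n + 1 : ℕ) : ℚ) ≠ 0 := Nat.cast_ne_zero.mpr n.succ_ne_zero
  rw [← inv_smul_smul₀ h3 (Pi.single a 1), h2]
  exact Submodule.smul_mem _ _ (add_mem (h none) (sum_mem fun b _ => h1 b))

/-- Stability under the Heisenberg operators thus implies stability under each $e_{a,a}(k)$, which
is what `zeroWeightSum_le` asks for. -/
lemma exists_heisModes_eq_cartanMode (a : Fin (n + 1)) (k : NZ) :
    ∃ u, heisModes n u = (1 : EqField) ⊗ₜ cartanMode a k.1 := by
  rw [cartanMode_eq]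
  refine single_mem_of_diagFam_mem
    (P := ((LinearMap.range (heisModes n)).restrictScalars ℚ).comap (diagMode n k.1)) (fun o => ?_) a
  refine ⟨(heisCoeff n k o)⁻¹ • .single k (classFam n o), ?_⟩
  rw [map_smul, heisModes_single, TensorProduct.smul_tmul', smul_eq_mul,
    inv_mul_cancel₀ (heisCoeff_ne_zero k o), diagMode_apply]

lemma WK_le {S : Submodule EqField (EqField ⊗[ℚ] BasicRep n)}
    (hv : hwVectorK n ∈ S) (hS : ∀ u, ∀ w ∈ S, heisOp n u w ∈ S) : WK n ≤ S := by
  rw [WK, Submodule.baseChange_eq_span, Submodule.span_le]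
  rintro _ ⟨w, hw, rfl⟩
  refine zeroWeightSum_le (S := (S.restrictScalars ℚ).comap (TensorProduct.mk ℚ EqField (BasicRep n) 1))
    hv (fun a k w hw => ?_) hw
  obtain ⟨u, hu⟩ := exists_heisModes_eq_cartanMode a ⟨-(k + 1 : ℕ), by omega⟩
  have h := hS u _ hw
  rw [heisOp, LinearMap.comp_apply, hu] at h
  simpa [affAction_tmul] using h

lemma exists_fockEquiv (hW : ∀ (x : Heis n), ∀ w ∈ WK n, ⁅heisHom n x, w⁆ ∈ WK n) :
    ∃ Φ : WK n ≃ₗ[EqField] FockK n,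
      (∀ (x : Heis n) (w : WK n),
        Φ ⟨⁅heisHom n x, (w : EqField ⊗[ℚ] BasicRep n)⁆, hW x w w.2⟩ = ⁅x, Φ w⁆) ∧
      Φ ⟨hwVectorK n, hwVectorK_mem⟩ = vac n := by
  obtain ⟨L, hL⟩ := exists_fockHom_end (heisOp_mul (n := n))
  have hop := op_fockIntertwiner heisOp_mul hL heisOp_hwVectorK
  have hinj := fockIntertwiner_injective heisOp_mul hL heisOp_hwVectorK hwVectorK_ne_zero
  have hone : fockIntertwiner L (hwVectorK n) 1 = hwVectorK n := fockIntertwiner_one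
  have hrange : LinearMap.range (fockIntertwiner L (hwVectorK n)) = WK n := by
    refine le_antisymm ?_ (WK_le ⟨1, hone⟩ ?_)
    -- The image lies in $W\otimes\mathbb K$ because it is obtained from $v$ by operators preserving
    -- that space. The converse inclusion holds because the image contains $v$ and is stable under
    -- all Heisenberg operators.
    · have key : ∀ f, ∀ w ∈ WK n, L f w ∈ WK n := by
        intro f
        induction f using fock_induction with
        | hc r =>
          intro w hw
          rw [AlgHom.commutes]
          exact Submodule.smul_mem _ r hw
        | hι m => intro w hw; rw [hL]; exact heisOp_mem_WK _ hw
        | hmul f g hf hg => intro w hw; rw [map_mul]; exact hf _ (hg _ hw)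
        | hadd f g hf hg => intro w hw; rw [map_add]; exact add_mem (hf _ hw) (hg _ hw)
      rintro _ ⟨f, rfl⟩
      exact key f _ hwVectorK_mem
    · rintro u _ ⟨f, rfl⟩
      exact ⟨_, (hop u f).symm⟩
  let e : FockK n ≃ₗ[EqField] WK n :=
    (LinearEquiv.ofInjective _ hinj).trans (LinearEquiv.ofEq _ _ hrange)
  have he : ∀ f, (e f : EqField ⊗[ℚ] BasicRep n) = fockIntertwiner L (hwVectorK n) f := fun f => rfl
  refine ⟨e.symm, fun x w => ?_, ?_⟩
  · rw [LinearEquiv.symm_apply_eq]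
    obtain ⟨f, rfl⟩ := e.surjective w
    refine Subtype.ext ?_
    simp only [e.symm_apply_apply, lie_heisHom, he, heis_lie_def, hop]
    rw [map_add _ (_ + _), map_smul]
  · rw [LinearEquiv.symm_apply_eq]
    exact Subtype.ext hone.symm

/-- The composite $\Phi'\Phi^{-1}$ commutes with the Heisenberg algebra and fixes the vacuum, so it
is the identity of Fock space. -/
lemma fockEquiv_unique (hW : ∀ (x : Heis n), ∀ w ∈ WK n, ⁅heisHom n x, w⁆ ∈ WK n)
    {Φ Φ' : WK n ≃ₗ[EqField] FockK n}
    (h : ∀ (x : Heis n) (w : WK n),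
      Φ ⟨⁅heisHom n x, (w : EqField ⊗[ℚ] BasicRep n)⁆, hW x w w.2⟩ = ⁅x, Φ w⁆)
    (h' : ∀ (x : Heis n) (w : WK n),
      Φ' ⟨⁅heisHom n x, (w : EqField ⊗[ℚ] BasicRep n)⁆, hW x w w.2⟩ = ⁅x, Φ' w⁆)
    (hv : Φ ⟨hwVectorK n, hwVectorK_mem⟩ = vac n) (hv' : Φ' ⟨hwVectorK n, hwVectorK_mem⟩ = vac n) :
    Φ' = Φ := by
  have key := eq_id_of_commutes (F := (Φ.symm.trans Φ').toLinearMap) (fun x f => by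
    obtain ⟨w, rfl⟩ := Φ.surjective f
    rw [← h x w]
    simp only [LinearEquiv.coe_coe, LinearEquiv.trans_apply, LinearEquiv.symm_apply_apply]
    exact h' x w) (by
    have hv1 : Φ.symm (vac n) = ⟨hwVectorK n, hwVectorK_mem⟩ := by rw [← hv, Φ.symm_apply_apply]
    exact (congrArg Φ' hv1).trans hv')
  refine LinearEquiv.ext fun w => ?_
  have := key (Φ w)
  rwa [LinearEquiv.coe_coe, LinearEquiv.trans_apply, LinearEquiv.symm_apply_apply] at this

end HeisModule

end

end AnHilb

theorem mainTheorem7 (n : ℕ) :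
    ∃ φ : Heis n →ₗ⁅EqField⁆ EqField ⊗[ℚ] AffineGl n,
      (IsHeisEmbedding φ ∧ Function.Injective φ ∧
        ∀ ψ : Heis n →ₗ⁅EqField⁆ EqField ⊗[ℚ] AffineGl n, IsHeisEmbedding ψ → ψ = φ) ∧
      ∃ (hW : ∀ (x : Heis n), ∀ w ∈ WK n, ⁅φ x, w⁆ ∈ WK n) (hv : hwVectorK n ∈ WK n),
        ∃! Φ : WK n ≃ₗ[EqField] FockK n,
          (∀ (x : Heis n) (w : WK n),
            Φ ⟨⁅φ x, (w : EqField ⊗[ℚ] BasicRep n)⁆, hW x w w.2⟩ = ⁅x, Φ w⁆) ∧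
          Φ ⟨hwVectorK n, hv⟩ = vac n := by
  have hW : ∀ (x : Heis n), ∀ w ∈ WK n, ⁅heisHom n x, w⁆ ∈ WK n := fun x w hw => by
    rw [lie_heisHom]
    exact add_mem (heisOp_mem_WK _ hw) (Submodule.smul_mem _ _ hw)
  obtain ⟨Φ, h, hv⟩ := exists_fockEquiv hW
  exact ⟨heisHom n, ⟨isHeisEmbedding_heisHom, heisHom_injective,
    fun ψ hψ => isHeisEmbedding_heisHom.ext hψ⟩, hW, hwVectorK_mem, Φ, ⟨h, hv⟩,
    fun Φ' h' => fockEquiv_unique hW h h'.1 hv h'.2⟩
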